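/- Let $G$ be a finite group. A ($G$-)Mackey functor $M$ assigns to each finite $G$-set $X$ an abelian group $M(X)$, with restrictions $f^*$ and transfers $f_*$ along all equivariant maps $f$, functorial and satisfying the base change formula for all pullback squares, and with $M$ taking finite disjoint unions to products. A (commutative) Green functor is a Mackey functor with values in commutative rings whose restrictions are ring homomorphisms and which satisfies Frobenius reciprocity $a\cdot f_*(b)=f_*(f^*(a)\cdot b)$; a module over a Green functor $R$ is a Mackey functor $M$ with $R(X)$-module structures on $M(X)$ such that $f^*(rm)=f^*(r)f^*(m)$, $r\cdot f_*(m)=f_*(f^*(r)m)$ and $f_*(r)\cdot m=f_*(r\cdot f^*(m))$. Let $\underline A$ be the Burnside Green functor: $\underline A(X)$ is the Grothendieck ring of finite $G$-sets over $X$. Let $R=\underline A^{\mathcal O^{\perp}}[x_{G/G}]$ be the free Green functor on a fixed generator: $R(X)$ is the group completion of the commutative semiring of isomorphism classes of diagrams $G/G\leftarrow A\xrightarrow{q}B\to X$ of finite $G$-sets in which $q$ preserves isotropy groups (sums are disjoint unions, products are $G/G\leftarrow (A\times_X B')\sqcup(B\times_X A')\to B\times_X B'\to X$, restriction is pullback,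 transfer is composition). The generator $x_{G/G}\in R(G/G)$ is the class of $G/G\leftarrow G/G\to G/G\to G/G$. Regard $\underline A$ as an $R$-module through the augmentation $R\to\underline A$, $x_{G/G}\mapsto 0$, which sends the class of $G/G\leftarrow A\xrightarrow{q}B\to X$ to the class of $B\setminus q(A)\to X$. For an $R$-module $M$ let $\underline{\operatorname{Tor}}^R_n(M,-)$ be the $n$-th left derived functor of the relative box product $M\boxtimes_R-$ on the abelian category of $R$-modules. Then, as $R$-modules, $$\underline{\operatorname{Tor}}^R_0(\underline A,\underline A)\cong\underline A,\qquad \underline{\operatorname{Tor}}^R_1(\underline A,\underline A)\cong\underline A,\qquad \underline{\operatorname{Tor}}^R_n(\underline A,\underline A)=0\ \text{ for all } n>1 .$$ -/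

import Mathlib

universe u v

set_option linter.unusedVariables false

namespace Equivariant

/-! ### Finite `G`-sets -/

/-- A finite `G`-set. Its morphisms are the equivariant maps `X →[G] Y`. -/
structure FinGSet (G : Type u) [Group G] where
  carrier : Type u
  [action : MulAction G carrier]
  [finite : Finite carrier]

attribute [instance] FinGSet.action FinGSet.finite

instance {G : Type u} [Group G] : CoeSort (FinGSet G) (Type u) := ⟨FinGSet.carrier⟩

namespace FinGSet

variable {G : Type u} [Group G]

/-- The one-point `G`-set `G/G`. -/
def pt (G : Type u) [Group G] : FinGSet G :=
  letI : MulAction G PUnit.{u + 1} :=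
    { smul := fun _ x => x, one_smul := fun _ => rfl, mul_smul := fun _ _ _ => rfl }
  ⟨PUnit.{u + 1}⟩

/-- The empty `G`-set. -/
def empty (G : Type u) [Group G] : FinGSet G :=
  letI : MulAction G PEmpty.{u + 1} :=
    { smul := fun _ x => x, one_smul := fun _ => rfl, mul_smul := fun _ _ _ => rfl }
  ⟨PEmpty.{u + 1}⟩

instance : IsEmpty (empty G) := inferInstanceAs (IsEmpty PEmpty)

/-- The disjoint union of two finite `G`-sets. -/
def sum (X Y : FinGSet G) : FinGSet G :=
  letI : MulAction G (X ⊕ Y) :=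
    { smul := fun g => Sum.map (g • ·) (g • ·)
      one_smul := by rintro (x | x) <;> exact congrArg _ (one_smul G x)
      mul_smul := by rintro g h (x | x) <;> exact congrArg _ (mul_smul g h x) }
  ⟨X ⊕ Y⟩

/-- The product of two finite `G`-sets, with the diagonal action. -/
def prod (X Y : FinGSet G) : FinGSet G := ⟨X × Y⟩

/-- The fibre product of two finite `G`-sets over a third one. -/
def pullback {X Y Z : FinGSet G} (f : X →[G] Z) (g : Y →[G] Z) : FinGSet G :=
  letI : MulAction G {w : X × Y // f w.1 = g w.2} :=
    { smul := fun a w => ⟨a • w.1, by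
        rw [Prod.smul_fst, Prod.smul_snd, map_smul, map_smul, w.2]⟩
      one_smul := fun w => Subtype.ext (one_smul G w.1)
      mul_smul := fun a b w => Subtype.ext (mul_smul a b w.1) }
  ⟨{w : X × Y // f w.1 = g w.2}⟩

/-- The first inclusion into a disjoint union. -/
def inl (X Y : FinGSet G) : X →[G] sum X Y := ⟨Sum.inl, fun _ _ => rfl⟩

/-- The second inclusion into a disjoint union. -/
def inr (X Y : FinGSet G) : Y →[G] sum X Y := ⟨Sum.inr, fun _ _ => rfl⟩

/-- The map out of a disjoint union. -/
def sumElim {X Y Z : FinGSet G} (f : X →[G] Z) (g : Y →[G] Z) : sum X Y →[G] Z :=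
  ⟨Sum.elim f g, by rintro a (x | x); exacts [map_smul f a x, map_smul g a x]⟩

/-- The disjoint union of two maps. -/
def sumMap {X Y X' Y' : FinGSet G} (f : X →[G] X') (g : Y →[G] Y') :
    sum X Y →[G] sum X' Y' :=
  sumElim ((inl X' Y').comp f) ((inr X' Y').comp g)

/-- The first projection from a product. -/
def fst (X Y : FinGSet G) : prod X Y →[G] X := ⟨Prod.fst, fun _ _ => rfl⟩

/-- The second projection from a product. -/
def snd (X Y : FinGSet G) : prod X Y →[G] Y := ⟨Prod.snd, fun _ _ => rfl⟩

/-- The map into a product. -/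
def prodLift {X Y Z : FinGSet G} (f : Z →[G] X) (g : Z →[G] Y) : Z →[G] prod X Y :=
  ⟨fun z => (f z, g z), fun a z => Prod.ext (map_smul f a z) (map_smul g a z)⟩

/-- The product of the identity of `U` with a map. -/
def prodMap (U : FinGSet G) {X Y : FinGSet G} (f : X →[G] Y) : prod U X →[G] prod U Y :=
  prodLift (fst U X) (f.comp (snd U X))

section pullback

variable {X Y Z : FinGSet G} (f : X →[G] Z) (g : Y →[G] Z)

/-- The first projection from a fibre product. -/
def pfst : pullback f g →[G] X := ⟨fun w => w.1.1, fun _ _ => rfl⟩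

/-- The second projection from a fibre product. -/
def psnd : pullback f g →[G] Y := ⟨fun w => w.1.2, fun _ _ => rfl⟩

variable {f g}

/-- The map into a fibre product. -/
def plift {W : FinGSet G} (a : W →[G] X) (b : W →[G] Y) (h : ∀ w, f (a w) = g (b w)) :
    W →[G] pullback f g :=
  ⟨fun w => ⟨(a w, b w), h w⟩,
    fun s w => Subtype.ext (Prod.ext (map_smul a s w) (map_smul b s w))⟩

end pullback

end FinGSet

/-- The square `f ∘ p = g ∘ q` is a pullback square of `G`-sets. -/
structure IsCartesian {G : Type u} [Group G] {P X Y Z : FinGSet G}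
    (p : P →[G] X) (q : P →[G] Y) (f : X →[G] Z) (g : Y →[G] Z) : Prop where
  comm : ∀ w, f (p w) = g (q w)
  lift : ∀ x y, f x = g y → ∃! w, p w = x ∧ q w = y

theorem isCartesian_pullback {G : Type u} [Group G] {X Y Z : FinGSet G}
    (f : X →[G] Z) (g : Y →[G] Z) :
    IsCartesian (FinGSet.pfst f g) (FinGSet.psnd f g) f g :=
  ⟨fun w => w.2, fun x y h => ⟨⟨(x, y), h⟩, ⟨rfl, rfl⟩,
    fun _ hw => Subtype.ext (Prod.ext hw.1 hw.2)⟩⟩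

/-! ### Mackey functors, Green functors and their modules -/

/-- The structure of a `G`-Mackey functor on a family `M` of abelian groups indexed by the finite
`G`-sets: restrictions along all maps (contravariant) and transfers along all maps (covariant) which
satisfy the base change formula for all pullback squares, such that `M` takes disjoint unions to
products. Equivalently, a product-preserving functor from the category of spans of finite
`G`-sets to abelian groups, the span `X ← W → Y` acting by restriction to `W` and transfer to `Y`. -/
structure MackeyStr {G : Type u} [Group G] (M : FinGSet G → Type v)
    [∀ X, AddCommGroup (M X)] where
  res : ∀ {X Y : FinGSet G}, (X →[G] Y) → M Y →+ M X
  tr : ∀ {X Y : FinGSet G}, (X →[G] Y) → M X →+ M Y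
  res_id : ∀ {X : FinGSet G} (a : M X), res (MulActionHom.id G) a = a
  res_comp : ∀ {X Y Z : FinGSet G} (f : X →[G] Y) (g : Y →[G] Z) (a : M Z),
    res (g.comp f) a = res f (res g a)
  tr_id : ∀ {X : FinGSet G} (a : M X), tr (MulActionHom.id G) a = a
  tr_comp : ∀ {X Y Z : FinGSet G} (f : X →[G] Y) (g : Y →[G] Z) (a : M X),
    tr (g.comp f) a = tr g (tr f a)
  base_change : ∀ {P X Y Z : FinGSet G} {p : P →[G] X} {q : P →[G] Y} {f : X →[G] Z}
    {g : Y →[G] Z}, IsCartesian p q f g → ∀ a : M X, res g (tr f a) = tr q (res p a)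
  empty : ∀ X : FinGSet G, IsEmpty X → Subsingleton (M X)
  sum : ∀ X Y : FinGSet G, Function.Bijective
    (fun a : M (X.sum Y) => (res (FinGSet.inl X Y) a, res (FinGSet.inr X Y) a))

namespace MackeyStr

variable {G : Type u} [Group G]

theorem cart_of_injective {X Y : FinGSet G} (i : X →[G] Y) (hi : Function.Injective i) :
    IsCartesian (MulActionHom.id G) (MulActionHom.id G) i i :=
  ⟨fun _ => rfl, fun x _ h => ⟨x, ⟨rfl, hi h⟩, fun _ hw => hw.1⟩⟩

theorem cart_of_bijective {X Y : FinGSet G} (e : X →[G] Y) (he : Function.Bijective e) :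
    IsCartesian e e (MulActionHom.id G) (MulActionHom.id G) :=
  ⟨fun _ => rfl, fun x y h => by
    obtain ⟨w, rfl⟩ := he.2 x
    exact ⟨w, ⟨rfl, h⟩, fun _ hw => he.1 hw.1⟩⟩

theorem cart_inl_inr (X Y : FinGSet G) (k : FinGSet.empty G →[G] X) (l : FinGSet.empty G →[G] Y) :
    IsCartesian k l (FinGSet.inl X Y) (FinGSet.inr X Y) :=
  ⟨fun w => isEmptyElim w, fun _ _ h => (Sum.inl_ne_inr h).elim⟩

/-- The map out of the empty `G`-set. -/
def elimEmpty (X : FinGSet G) : FinGSet.empty G →[G] X :=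
  ⟨fun w => isEmptyElim w, fun _ w => isEmptyElim w⟩

theorem cart_symm {P X Y Z : FinGSet G} {p : P →[G] X} {q : P →[G] Y} {f : X →[G] Z}
    {g : Y →[G] Z} (h : IsCartesian p q f g) : IsCartesian q p g f :=
  ⟨fun w => (h.comm w).symm, fun y x hyx => by
    obtain ⟨w, hw, hu⟩ := h.lift x y hyx.symm
    exact ⟨w, hw.symm, fun w' hw' => hu w' hw'.symm⟩⟩

/-- The restriction maps to the summands of a disjoint union are jointly bijective as soon as
every element is the sum of the transfers of its restrictions. -/
theorem bijective_of_sum {M : FinGSet G → Type v} [∀ X, AddCommGroup (M X)]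
    (res : ∀ {X Y : FinGSet G}, (X →[G] Y) → M Y →+ M X)
    (tr : ∀ {X Y : FinGSet G}, (X →[G] Y) → M X →+ M Y)
    (res_id : ∀ {X : FinGSet G} (a : M X), res (MulActionHom.id G) a = a)
    (tr_id : ∀ {X : FinGSet G} (a : M X), tr (MulActionHom.id G) a = a)
    (base_change : ∀ {P X Y Z : FinGSet G} {p : P →[G] X} {q : P →[G] Y} {f : X →[G] Z}
      {g : Y →[G] Z}, IsCartesian p q f g → ∀ a : M X, res g (tr f a) = tr q (res p a))
    (empty : ∀ X : FinGSet G, IsEmpty X → Subsingleton (M X))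
    (X Y : FinGSet G)
    (sum : ∀ a : M (X.sum Y), tr (FinGSet.inl X Y) (res (FinGSet.inl X Y) a) +
      tr (FinGSet.inr X Y) (res (FinGSet.inr X Y) a) = a) :
    Function.Bijective
      (fun a : M (X.sum Y) => (res (FinGSet.inl X Y) a, res (FinGSet.inr X Y) a)) := by
  have hE : ∀ z : M (FinGSet.empty G), z = 0 := fun z =>
    (empty _ inferInstance).elim _ _
  constructor
  · intro a b hab
    have h1 : res (FinGSet.inl X Y) a = res (FinGSet.inl X Y) b := congrArg Prod.fst hab
    have h2 : res (FinGSet.inr X Y) a = res (FinGSet.inr X Y) b := congrArg Prod.snd hab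
    rw [← sum a, ← sum b, h1, h2]
  · rintro ⟨a, b⟩
    refine ⟨tr (FinGSet.inl X Y) a + tr (FinGSet.inr X Y) b, Prod.ext ?_ ?_⟩
    · dsimp only
      rw [map_add, base_change (cart_of_injective (FinGSet.inl X Y) Sum.inl_injective),
        base_change (cart_symm (cart_inl_inr X Y (elimEmpty _) (elimEmpty _))),
        hE (res (elimEmpty Y) b), map_zero, add_zero, res_id, tr_id]
    · dsimp only
      rw [map_add, base_change (cart_of_injective (FinGSet.inr X Y) Sum.inr_injective),
        base_change (cart_inl_inr X Y (elimEmpty _) (elimEmpty _)),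
        hE (res (elimEmpty X) a), map_zero, zero_add, res_id, tr_id]

variable {M : FinGSet G → Type v} [∀ X, AddCommGroup (M X)] (S : MackeyStr M)

theorem tr_res_of_bijective {X Y : FinGSet G} (e : X →[G] Y) (he : Function.Bijective e)
    (a : M Y) : S.tr e (S.res e a) = a := by
  rw [← S.base_change (cart_of_bijective e he), S.tr_id, S.res_id]

theorem sum_eq (X Y : FinGSet G) (a : M (X.sum Y)) :
    S.tr (FinGSet.inl X Y) (S.res (FinGSet.inl X Y) a) +
      S.tr (FinGSet.inr X Y) (S.res (FinGSet.inr X Y) a) = a := by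
  have hE : ∀ z : M (FinGSet.empty G), z = 0 := fun z =>
    (S.empty _ inferInstance).elim _ _
  apply (S.sum X Y).1
  refine Prod.ext ?_ ?_
  · dsimp only
    rw [map_add, S.base_change (cart_of_injective (FinGSet.inl X Y) Sum.inl_injective),
      S.base_change (cart_symm (cart_inl_inr X Y (elimEmpty _) (elimEmpty _))),
      hE (S.res (elimEmpty Y) _), map_zero, add_zero, S.res_id, S.tr_id]
  · dsimp only
    rw [map_add, S.base_change (cart_of_injective (FinGSet.inr X Y) Sum.inr_injective),
      S.base_change (cart_inl_inr X Y (elimEmpty _) (elimEmpty _)),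
      hE (S.res (elimEmpty X) _), map_zero, zero_add, S.res_id, S.tr_id]

theorem sum_eq_of_bijective {X Y Z : FinGSet G} (i : X →[G] Z) (j : Y →[G] Z)
    (h : Function.Bijective (FinGSet.sumElim i j)) (a : M Z) :
    S.tr i (S.res i a) + S.tr j (S.res j a) = a := by
  have hi : i = (FinGSet.sumElim i j).comp (FinGSet.inl X Y) := rfl
  have hj : j = (FinGSet.sumElim i j).comp (FinGSet.inr X Y) := rfl
  conv_rhs => rw [← S.tr_res_of_bijective _ h a, ← S.sum_eq X Y (S.res _ a), map_add,
    ← S.tr_comp, ← S.tr_comp, ← S.res_comp, ← S.res_comp, ← hi, ← hj]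

end MackeyStr

/-- A commutative `G`-Green functor: a Mackey functor with commutative ring structures on its
values, such that the restrictions are ring homomorphisms and Frobenius reciprocity holds. -/
structure GreenFunctor (G : Type u) [Group G] where
  obj : FinGSet G → Type (u + 1)
  [commRing : ∀ X, CommRing (obj X)]
  mackey : MackeyStr obj
  res_one : ∀ {X Y : FinGSet G} (f : X →[G] Y), mackey.res f (1 : obj Y) = 1
  res_mul : ∀ {X Y : FinGSet G} (f : X →[G] Y) (a b : obj Y),
    mackey.res f (a * b) = mackey.res f a * mackey.res f b
  frobenius : ∀ {X Y : FinGSet G} (f : X →[G] Y) (a : obj Y) (b : obj X),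
    a * mackey.tr f b = mackey.tr f (mackey.res f a * b)

attribute [instance] GreenFunctor.commRing

/-- A morphism of Green functors. -/
structure GreenFunctor.Hom {G : Type u} [Group G] (R S : GreenFunctor G) where
  app : ∀ X : FinGSet G, R.obj X →+* S.obj X
  app_res : ∀ {X Y : FinGSet G} (f : X →[G] Y) (a : R.obj Y),
    app X (R.mackey.res f a) = S.mackey.res f (app Y a)
  app_tr : ∀ {X Y : FinGSet G} (f : X →[G] Y) (a : R.obj X),
    app Y (R.mackey.tr f a) = S.mackey.tr f (app X a)

/-- A module over a Green functor `R`: a Mackey functor with levelwise module structures such that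
the restrictions are semilinear and Frobenius reciprocity holds in both variables. -/
structure GreenModule {G : Type u} [Group G] (R : GreenFunctor G) where
  obj : FinGSet G → Type (u + 1)
  [addCommGroup : ∀ X, AddCommGroup (obj X)]
  [module : ∀ X, Module (R.obj X) (obj X)]
  mackey : MackeyStr obj
  res_smul : ∀ {X Y : FinGSet G} (f : X →[G] Y) (r : R.obj Y) (m : obj Y),
    mackey.res f (r • m) = R.mackey.res f r • mackey.res f m
  smul_tr : ∀ {X Y : FinGSet G} (f : X →[G] Y) (r : R.obj Y) (m : obj X),
    r • mackey.tr f m = mackey.tr f (R.mackey.res f r • m)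
  tr_smul : ∀ {X Y : FinGSet G} (f : X →[G] Y) (r : R.obj X) (m : obj Y),
    R.mackey.tr f r • m = mackey.tr f (r • mackey.res f m)

attribute [instance] GreenModule.addCommGroup GreenModule.module

/-- The target of a morphism of Green functors `R → S` as a module over its source. -/
def GreenFunctor.Hom.toModule {G : Type u} [Group G] {R S : GreenFunctor G}
    (φ : GreenFunctor.Hom R S) : GreenModule R where
  obj := S.obj
  module := fun X => Module.compHom (S.obj X) (φ.app X)
  mackey := S.mackey
  res_smul := fun {X Y} f r m => by
    change S.mackey.res f (φ.app Y r * m) = φ.app X (R.mackey.res f r) * S.mackey.res f m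
    rw [S.res_mul, φ.app_res]
  smul_tr := fun {X Y} f r m => by
    change φ.app Y r * S.mackey.tr f m = S.mackey.tr f (φ.app X (R.mackey.res f r) * m)
    rw [S.frobenius, φ.app_res]
  tr_smul := fun {X Y} f r m => by
    change φ.app Y (R.mackey.tr f r) * m = S.mackey.tr f (φ.app X r * S.mackey.res f m)
    rw [φ.app_tr, mul_comm, S.frobenius, mul_comm]

/-! ### Polynomials with isotropy-preserving exponents -/

/-- A polynomial `G/G ← A → B → X` of finite `G`-sets whose middle map preserves isotropy. As `G/G`
is terminal, its first leg carries no data. -/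
structure Poly {G : Type u} [Group G] (X : FinGSet G) where
  A : FinGSet G
  B : FinGSet G
  q : A →[G] B
  t : B →[G] X
  isotropy : ∀ a : A, MulAction.stabilizer G (q a) = MulAction.stabilizer G a

namespace Poly

open FinGSet

variable {G : Type u} [Group G] {X Y Z : FinGSet G}

/-- Two polynomials are isomorphic if there are equivariant bijections `A ≃ A'`, `B ≃ B'`
commuting with the structure maps. -/
def Iso (P Q : Poly X) : Prop :=
  ∃ (a : P.A →[G] Q.A) (b : P.B →[G] Q.B), Function.Bijective a ∧ Function.Bijective b ∧
    (∀ x, Q.q (a x) = b (P.q x)) ∧ ∀ y, Q.t (b y) = P.t y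

/-- The zero polynomial `G/G ← ∅ → ∅ → X`. -/
def zero (X : FinGSet G) : Poly X where
  A := empty G
  B := empty G
  q := MulActionHom.id G
  t := MackeyStr.elimEmpty X
  isotropy := fun a => isEmptyElim a

/-- The unit polynomial `G/G ← ∅ → X → X`. -/
def one (X : FinGSet G) : Poly X where
  A := empty G
  B := X
  q := MackeyStr.elimEmpty X
  t := MulActionHom.id G
  isotropy := fun a => isEmptyElim a

/-- The sum `G/G ← A ⊔ A' → B ⊔ B' → X`. -/
def add (P Q : Poly X) : Poly X where
  A := P.A.sum Q.A
  B := P.B.sum Q.B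
  q := sumMap P.q Q.q
  t := sumElim P.t Q.t
  isotropy := by
    rintro (a | a)
    · ext g
      have := SetLike.ext_iff.1 (P.isotropy a) g
      exact (Sum.inl_injective.eq_iff).trans (this.trans Sum.inl_injective.eq_iff.symm)
    · ext g
      have := SetLike.ext_iff.1 (Q.isotropy a) g
      exact (Sum.inr_injective.eq_iff).trans (this.trans Sum.inr_injective.eq_iff.symm)

/-- The product `G/G ← (A ×_X B') ⊔ (B ×_X A') → B ×_X B' → X`. -/
def mul (P Q : Poly X) : Poly X where
  A := (pullback (P.t.comp P.q) Q.t).sum (pullback P.t (Q.t.comp Q.q))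
  B := pullback P.t Q.t
  q := sumElim
    (plift (P.q.comp (pfst (P.t.comp P.q) Q.t)) (psnd (P.t.comp P.q) Q.t) fun w => w.2)
    (plift (pfst P.t (Q.t.comp Q.q)) (Q.q.comp (psnd P.t (Q.t.comp Q.q))) fun w => w.2)
  t := P.t.comp (pfst P.t Q.t)
  isotropy := by
    rintro (⟨⟨a, b⟩, h⟩ | ⟨⟨b, a⟩, h⟩)
    · ext g
      have := SetLike.ext_iff.1 (P.isotropy a) g
      simp only [MulAction.mem_stabilizer_iff] at this
      refine (Subtype.ext_iff.trans Prod.ext_iff).trans (Iff.trans ?_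
        (Sum.inl_injective.eq_iff.trans (Subtype.ext_iff.trans Prod.ext_iff)).symm)
      exact and_congr this Iff.rfl
    · ext g
      have := SetLike.ext_iff.1 (Q.isotropy a) g
      simp only [MulAction.mem_stabilizer_iff] at this
      refine (Subtype.ext_iff.trans Prod.ext_iff).trans (Iff.trans ?_
        (Sum.inr_injective.eq_iff.trans (Subtype.ext_iff.trans Prod.ext_iff)).symm)
      exact and_congr Iff.rfl this

/-- The restriction `G/G ← A ×_Y X → B ×_Y X → X` along `f : X → Y`. -/
def res (f : X →[G] Y) (P : Poly Y) : Poly X where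
  A := pullback (P.t.comp P.q) f
  B := pullback P.t f
  q := plift (P.q.comp (pfst (P.t.comp P.q) f)) (psnd (P.t.comp P.q) f) fun w => w.2
  t := psnd P.t f
  isotropy := by
    rintro ⟨⟨a, b⟩, h⟩
    ext g
    have := SetLike.ext_iff.1 (P.isotropy a) g
    simp only [MulAction.mem_stabilizer_iff] at this
    refine (Subtype.ext_iff.trans Prod.ext_iff).trans (Iff.trans ?_
      (Subtype.ext_iff.trans Prod.ext_iff).symm)
    exact and_congr this Iff.rfl

/-- The transfer `G/G ← A → B → X → Y` along `f : X → Y`. -/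
def tr (f : X →[G] Y) (P : Poly X) : Poly Y where
  A := P.A
  B := P.B
  q := P.q
  t := f.comp P.t
  isotropy := P.isotropy

/-- The number of points of `A` over a point of `B`. -/
noncomputable def deg (P : Poly X) (y : P.B) : ℕ := Nat.card {a : P.A // P.q a = y}

theorem Iso.of_deg {P Q : Poly X} (b : P.B →[G] Q.B) (hb : Function.Bijective b)
    (ht : ∀ y, Q.t (b y) = P.t y) (hd : ∀ y, Q.deg (b y) = P.deg y) : Iso P Q := by
  classical
  have hσ : ∀ y : P.B, Nonempty ({a : P.A // P.q a = y} ≃ {a : Q.A // Q.q a = b y}) :=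
    fun y => Finite.card_eq.1 (hd y).symm
  obtain ⟨σ⟩ : Nonempty (∀ y : P.B, {a : P.A // P.q a = y} ≃ {a : Q.A // Q.q a = b y}) :=
    ⟨fun y => (hσ y).some⟩
  let rep : P.B → P.B := fun y => (Quotient.mk (MulAction.orbitRel G P.B) y).out
  have hrep : ∀ y, ∃ g : G, g • rep y = y := fun y => by
    have := Quotient.exact (Quotient.out_eq (Quotient.mk (MulAction.orbitRel G P.B) y))
    exact MulAction.orbitRel_apply.1 ((MulAction.orbitRel G P.B).symm this)
  choose s hs using hrep
  have hrep_smul : ∀ (h : G) (y : P.B), rep (h • y) = rep y := fun h y => by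
    have : Quotient.mk (MulAction.orbitRel G P.B) (h • y)
        = Quotient.mk (MulAction.orbitRel G P.B) y :=
      Quotient.sound (MulAction.orbitRel_apply.2 ⟨h, rfl⟩)
    simp only [rep, this]
  have hmem : ∀ (y : P.B) (a : P.A), P.q a = y → P.q ((s y)⁻¹ • a) = rep y := fun y a h => by
    rw [map_smul, h, inv_smul_eq_iff, hs]
  have hfix : ∀ (R : Poly X) (a : R.A) (g : G), g • R.q a = R.q a → g • a = a :=
    fun R a g h => by
      have := SetLike.ext_iff.1 (R.isotropy a) g
      exact this.1 h
  -- the equivariant extension of the chosen bijections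
  let α : P.A → Q.A := fun a => s (P.q a) • (σ (rep (P.q a)) ⟨(s (P.q a))⁻¹ • a, hmem _ a rfl⟩).1
  have hα : ∀ a, Q.q (α a) = b (P.q a) := fun a => by
    simp only [α, map_smul]
    rw [(σ (rep (P.q a)) _).2, ← map_smul, hs]
  have key : ∀ (r : P.B) (g g' : G) (a : P.A) (h : P.q (g⁻¹ • a) = r) (h' : P.q (g'⁻¹ • a) = r),
      g • (σ r ⟨g⁻¹ • a, h⟩).1 = g' • (σ r ⟨g'⁻¹ • a, h'⟩).1 := by
    intro r g g' a h h'
    have hk : (g'⁻¹ * g) • r = r := by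
      conv_lhs => rw [← h]
      rw [map_smul, ← mul_smul, mul_assoc, mul_inv_cancel, mul_one, ← map_smul, h']
    have e1 : g'⁻¹ • a = g⁻¹ • a := by
      have := hfix P (g⁻¹ • a) (g'⁻¹ * g) (by rw [h, hk])
      rwa [← mul_smul, mul_assoc, mul_inv_cancel, mul_one] at this
    have e2 : (σ r ⟨g'⁻¹ • a, h'⟩) = (σ r ⟨g⁻¹ • a, h⟩) := by
      congr 1
      exact Subtype.ext e1
    have e3 := hfix Q (σ r ⟨g⁻¹ • a, h⟩).1 (g'⁻¹ * g)
      (by rw [(σ r ⟨g⁻¹ • a, h⟩).2, ← map_smul, hk])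
    rw [e2]
    conv_rhs => rw [← e3, mul_smul, smul_inv_smul]
  have gen : ∀ (y r : P.B) (g : G) (a : P.A) (h : P.q (g⁻¹ • a) = r), rep (P.q a) = r →
      α a = g • (σ r ⟨g⁻¹ • a, h⟩).1 := by
    intro _ r g a h hr
    subst hr
    exact key _ _ _ _ _ _
  refine ⟨⟨α, fun h a => ?_⟩, b, ⟨?_, ?_⟩, hb, hα, ht⟩
  · have e : (h * s (P.q a))⁻¹ • (h • a) = (s (P.q a))⁻¹ • a := by
      rw [mul_inv_rev, mul_smul, inv_smul_smul]
    have h1 := gen (P.q a) (rep (P.q a)) (h * s (P.q a)) (h • a)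
      (by rw [e]; exact hmem _ _ rfl) (by rw [map_smul, hrep_smul])
    rw [h1, mul_smul]
    simp only [α, e, id]
  · intro a a' h
    change α a = α a' at h
    have hq : P.q a = P.q a' := hb.1 (by rw [← hα, ← hα, h])
    have h2 := gen (P.q a) (rep (P.q a)) (s (P.q a)) a' (hmem _ _ hq.symm) (by rw [hq])
    rw [h2] at h
    simp only [α] at h
    have h3 := (σ (rep (P.q a))).injective (Subtype.ext (smul_left_cancel _ h))
    exact smul_left_cancel _ (congrArg Subtype.val h3)
  · intro c
    obtain ⟨y, hy⟩ := hb.2 (Q.q c)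
    have hc : Q.q ((s y)⁻¹ • c) = b (rep y) := by
      rw [map_smul, ← hy, ← map_smul]
      congr 1
      rw [inv_smul_eq_iff, hs]
    let w := (σ (rep y)).symm ⟨(s y)⁻¹ • c, hc⟩
    have hw : P.q (s y • w.1) = y := by rw [map_smul, w.2, hs]
    refine ⟨s y • w.1, ?_⟩
    have h1 := gen y (rep y) (s y) (s y • w.1) (by rw [inv_smul_smul]; exact w.2) (by rw [hw])
    change α _ = c
    rw [h1]
    have h2 : (⟨(s y)⁻¹ • s y • w.1, by rw [inv_smul_smul]; exact w.2⟩ :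
        {a : P.A // P.q a = rep y}) = w := Subtype.ext (inv_smul_smul _ _)
    rw [h2, Equiv.apply_symm_apply, smul_inv_smul]

theorem Iso.deg_eq {P Q : Poly X} {a : P.A →[G] Q.A} {b : P.B →[G] Q.B}
    (ha : Function.Bijective a) (hb : Function.Bijective b)
    (hq : ∀ x, Q.q (a x) = b (P.q x)) (y : P.B) : Q.deg (b y) = P.deg y :=
  (Nat.card_congr ((Equiv.ofBijective a ha).subtypeEquiv fun x => by
    change P.q x = y ↔ Q.q (a x) = b y
    rw [hq, hb.1.eq_iff])).symm

theorem Iso.refl (P : Poly X) : Iso P P :=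
  ⟨MulActionHom.id G, MulActionHom.id G, Function.bijective_id, Function.bijective_id,
    fun _ => rfl, fun _ => rfl⟩

theorem Iso.symm {P Q : Poly X} : Iso P Q → Iso Q P := by
  rintro ⟨a, b, ha, hb, hq, ht⟩
  let b' : Q.B →[G] P.B := b.inverse (Equiv.ofBijective b hb).symm
    (Equiv.ofBijective b hb).left_inv (Equiv.ofBijective b hb).right_inv
  have h : ∀ y, b (b' y) = y := (Equiv.ofBijective b hb).right_inv
  refine Iso.of_deg b' (Equiv.ofBijective b hb).symm.bijective (fun y => ?_) fun y => ?_
  · rw [← ht, h]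
  · rw [← Iso.deg_eq ha hb hq, h]

theorem Iso.trans {P Q R : Poly X} : Iso P Q → Iso Q R → Iso P R := by
  rintro ⟨a, b, ha, hb, hq, ht⟩ ⟨a', b', ha', hb', hq', ht'⟩
  refine ⟨a'.comp a, b'.comp b, ha'.comp ha, hb'.comp hb, fun x => ?_, fun y => ?_⟩
  · change R.q (a' (a x)) = b' (b (P.q x))
    rw [hq', hq]
  · change R.t (b' (b y)) = P.t y
    rw [ht', ht]

theorem deg_one (y : X) : (one X).deg y = 0 :=
  haveI : IsEmpty {a : (one X).A // (one X).q a = y} := ⟨fun a => isEmptyElim (α := empty G) a.1⟩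
  Nat.card_of_isEmpty

theorem deg_add_inl (P Q : Poly X) (y : P.B) : (P.add Q).deg (Sum.inl y) = P.deg y :=
  Nat.card_congr
    { toFun := fun a => match a with
        | ⟨Sum.inl a, h⟩ => ⟨a, Sum.inl_injective h⟩
        | ⟨Sum.inr _, h⟩ => (Sum.inr_ne_inl h).elim
      invFun := fun a => ⟨Sum.inl a.1, congrArg Sum.inl a.2⟩
      left_inv := by rintro ⟨a | a, h⟩; exacts [rfl, (Sum.inr_ne_inl h).elim]
      right_inv := fun _ => rfl }

theorem deg_add_inr (P Q : Poly X) (y : Q.B) : (P.add Q).deg (Sum.inr y) = Q.deg y :=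
  Nat.card_congr
    { toFun := fun a => match a with
        | ⟨Sum.inr a, h⟩ => ⟨a, Sum.inr_injective h⟩
        | ⟨Sum.inl _, h⟩ => (Sum.inl_ne_inr h).elim
      invFun := fun a => ⟨Sum.inr a.1, congrArg Sum.inr a.2⟩
      left_inv := by rintro ⟨a | a, h⟩; exacts [(Sum.inl_ne_inr h).elim, rfl]
      right_inv := fun _ => rfl }

theorem deg_mul (P Q : Poly X) (w : pullback P.t Q.t) :
    (P.mul Q).deg w = P.deg w.1.1 + Q.deg w.1.2 := by
  change Nat.card _ = Nat.card _ + Nat.card _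
  rw [← Nat.card_sum]
  refine Nat.card_congr
    { toFun := fun a => match a with
        | ⟨Sum.inl a, h⟩ => Sum.inl ⟨a.1.1, congrArg (fun z => z.1.1) h⟩
        | ⟨Sum.inr a, h⟩ => Sum.inr ⟨a.1.2, congrArg (fun z => z.1.2) h⟩
      invFun := fun a => match a with
        | Sum.inl a => ⟨Sum.inl ⟨(a.1, w.1.2), (congrArg P.t a.2).trans w.2⟩,
            Subtype.ext (Prod.ext a.2 rfl)⟩
        | Sum.inr a => ⟨Sum.inr ⟨(w.1.1, a.1), w.2.trans (congrArg Q.t a.2).symm⟩,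
            Subtype.ext (Prod.ext rfl a.2)⟩
      left_inv := ?_
      right_inv := by rintro (a | a) <;> rfl }
  rintro ⟨⟨⟨a, b⟩, h⟩ | ⟨⟨b, a⟩, h⟩, h'⟩
  · have : w.1.2 = b := congrArg (fun z => z.1.2) h'.symm
    subst this
    rfl
  · have : w.1.1 = b := congrArg (fun z => z.1.1) h'.symm
    subst this
    rfl

theorem deg_res (f : X →[G] Y) (P : Poly Y) (w : pullback P.t f) :
    (P.res f).deg w = P.deg w.1.1 := by
  refine Nat.card_congr
    { toFun := fun a => ⟨a.1.1.1, congrArg (fun z => z.1.1) a.2⟩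
      invFun := fun a => ⟨⟨(a.1, w.1.2), (congrArg P.t a.2).trans w.2⟩,
        Subtype.ext (Prod.ext a.2 rfl)⟩
      left_inv := ?_
      right_inv := fun _ => rfl }
  rintro ⟨⟨⟨a, b⟩, h⟩, h'⟩
  have : w.1.2 = b := congrArg (fun z => z.1.2) h'.symm
  subst this
  rfl

theorem deg_tr (f : X →[G] Y) (P : Poly X) (y : P.B) : (P.tr f).deg y = P.deg y := rfl

section laws

theorem bij_of_inv {α β : Type*} {f : α → β} (g : β → α) (h : ∀ a, g (f a) = a)
    (h' : ∀ b, f (g b) = b) : Function.Bijective f :=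
  Function.bijective_iff_has_inverse.2 ⟨g, h, h'⟩

theorem add_congr {P P' Q Q' : Poly X} : Iso P P' → Iso Q Q' → Iso (P.add Q) (P'.add Q') := by
  rintro ⟨a, b, ha, hb, hq, ht⟩ ⟨a', b', ha', hb', hq', ht'⟩
  refine Iso.of_deg (sumMap b b') (Sum.map_bijective.2 ⟨hb, hb'⟩) ?_ ?_
  · rintro (y | y); exacts [ht y, ht' y]
  · rintro (y | y)
    · exact (deg_add_inl P' Q' (b y)).trans
        ((Iso.deg_eq ha hb hq y).trans (deg_add_inl P Q y).symm)
    · exact (deg_add_inr P' Q' (b' y)).trans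
        ((Iso.deg_eq ha' hb' hq' y).trans (deg_add_inr P Q y).symm)

theorem mul_congr {P P' Q Q' : Poly X} : Iso P P' → Iso Q Q' → Iso (P.mul Q) (P'.mul Q') := by
  rintro ⟨a, b, ha, hb, hq, ht⟩ ⟨a', b', ha', hb', hq', ht'⟩
  refine Iso.of_deg (plift (f := P'.t) (g := Q'.t) (b.comp (pfst P.t Q.t))
    (b'.comp (psnd P.t Q.t)) ?_) ⟨?_, ?_⟩ ?_ ?_
  · intro w
    exact (ht w.1.1).trans (w.2.trans (ht' w.1.2).symm)
  · rintro ⟨⟨y, z⟩, h⟩ ⟨⟨y', z'⟩, h'⟩ e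
    have e1 : b y = b y' := congrArg (fun w => w.1.1) e
    have e2 : b' z = b' z' := congrArg (fun w => w.1.2) e
    exact Subtype.ext (Prod.ext (hb.1 e1) (hb'.1 e2))
  · rintro ⟨⟨y, z⟩, h⟩
    obtain ⟨y, rfl⟩ := hb.2 y
    obtain ⟨z, rfl⟩ := hb'.2 z
    exact ⟨⟨(y, z), (ht y).symm.trans (h.trans (ht' z))⟩, rfl⟩
  · intro w
    exact ht w.1.1
  · intro w
    exact (deg_mul P' Q' _).trans (((congrArg₂ (· + ·) (Iso.deg_eq ha hb hq w.1.1)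
      (Iso.deg_eq ha' hb' hq' w.1.2))).trans (deg_mul P Q w).symm)

theorem res_congr (f : X →[G] Y) {P P' : Poly Y} : Iso P P' → Iso (P.res f) (P'.res f) := by
  rintro ⟨a, b, ha, hb, hq, ht⟩
  refine Iso.of_deg (plift (f := P'.t) (g := f) (b.comp (pfst P.t f)) (psnd P.t f) ?_)
    ⟨?_, ?_⟩ (fun _ => rfl) ?_
  · intro w
    exact (ht w.1.1).trans w.2
  · rintro ⟨⟨y, z⟩, h⟩ ⟨⟨y', z'⟩, h'⟩ e
    have e1 : b y = b y' := congrArg (fun w => w.1.1) e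
    have e2 : z = z' := congrArg (fun w => w.1.2) e
    exact Subtype.ext (Prod.ext (hb.1 e1) e2)
  · rintro ⟨⟨y, z⟩, h⟩
    obtain ⟨y, rfl⟩ := hb.2 y
    exact ⟨⟨(y, z), (ht y).symm.trans h⟩, rfl⟩
  · intro w
    exact (deg_res f P' _).trans ((Iso.deg_eq ha hb hq w.1.1).trans (deg_res f P w).symm)

theorem tr_congr (f : X →[G] Y) {P P' : Poly X} : Iso P P' → Iso (P.tr f) (P'.tr f) := by
  rintro ⟨a, b, ha, hb, hq, ht⟩
  exact ⟨a, b, ha, hb, hq, fun y => congrArg f (ht y)⟩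

theorem add_comm' (P Q : Poly X) : Iso (P.add Q) (Q.add P) :=
  Iso.of_deg (sumElim (inr Q.B P.B) (inl Q.B P.B)) (Equiv.sumComm P.B Q.B).bijective
    (by rintro (y | y) <;> rfl)
    (by
      rintro (y | y)
      · exact (deg_add_inr Q P y).trans (deg_add_inl P Q y).symm
      · exact (deg_add_inl Q P y).trans (deg_add_inr P Q y).symm)

theorem add_assoc' (P Q R : Poly X) : Iso ((P.add Q).add R) (P.add (Q.add R)) :=
  Iso.of_deg (sumElim (sumElim (inl P.B (Q.B.sum R.B)) ((inr _ _).comp (inl Q.B R.B)))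
      ((inr _ _).comp (inr Q.B R.B)))
    (Equiv.sumAssoc P.B Q.B R.B).bijective
    (by rintro ((y | y) | y) <;> rfl)
    (by
      rintro ((y | y) | y)
      · exact (deg_add_inl P (Q.add R) y).trans
          ((deg_add_inl P Q y).symm.trans (deg_add_inl (P.add Q) R (Sum.inl y)).symm)
      · exact (deg_add_inr P (Q.add R) (Sum.inl y)).trans ((deg_add_inl Q R y).trans
          ((deg_add_inr P Q y).symm.trans (deg_add_inl (P.add Q) R (Sum.inr y)).symm))
      · exact (deg_add_inr P (Q.add R) (Sum.inr y)).trans ((deg_add_inr Q R y).trans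
          (deg_add_inr (P.add Q) R y).symm))

theorem zero_add' (P : Poly X) : Iso ((zero X).add P) P :=
  Iso.of_deg (sumElim (MackeyStr.elimEmpty P.B) (MulActionHom.id G))
    (bij_of_inv Sum.inr (by rintro (y | y); exacts [isEmptyElim (α := empty G) y, rfl])
      fun _ => rfl)
    (by rintro (y | y); exacts [isEmptyElim (α := empty G) y, rfl])
    (by
      rintro (y | y)
      · exact isEmptyElim (α := empty G) y
      · exact (deg_add_inr (zero X) P y).symm)

theorem mul_comm' (P Q : Poly X) : Iso (P.mul Q) (Q.mul P) :=
  Iso.of_deg (plift (f := Q.t) (g := P.t) (psnd P.t Q.t) (pfst P.t Q.t) fun w => w.2.symm)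
    (bij_of_inv (fun w => ⟨(w.1.2, w.1.1), w.2.symm⟩) (fun _ => rfl) fun _ => rfl)
    (fun w => w.2.symm)
    (fun w => (deg_mul Q P _).trans ((Nat.add_comm _ _).trans (deg_mul P Q w).symm))

theorem mul_assoc' (P Q R : Poly X) : Iso ((P.mul Q).mul R) (P.mul (Q.mul R)) := by
  refine Iso.of_deg
    (plift (f := P.t) (g := (Q.mul R).t)
      ((pfst P.t Q.t).comp (pfst (P.mul Q).t R.t))
      (plift (f := Q.t) (g := R.t) ((psnd P.t Q.t).comp (pfst (P.mul Q).t R.t))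
        (psnd (P.mul Q).t R.t) fun w => w.1.1.2.symm.trans w.2) fun w => w.1.1.2)
    (bij_of_inv (fun w => ⟨(⟨(w.1.1, w.1.2.1.1), w.2⟩, w.1.2.1.2), w.2.trans w.1.2.2⟩)
      (fun _ => rfl) fun _ => rfl) (fun _ => rfl) fun w => ?_
  refine (deg_mul P (Q.mul R) _).trans (Eq.trans ?_ (deg_mul (P.mul Q) R w).symm)
  refine (congrArg (_ + ·) (deg_mul Q R _)).trans ?_
  exact (Nat.add_assoc _ _ _).symm.trans (congrArg (· + _) (deg_mul P Q _).symm)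

theorem one_mul' (P : Poly X) : Iso ((one X).mul P) P :=
  Iso.of_deg (psnd (one X).t P.t)
    (bij_of_inv (fun y => ⟨(P.t y, y), rfl⟩)
      (fun w => Subtype.ext (Prod.ext w.2.symm rfl)) fun _ => rfl)
    (fun w => w.2.symm)
    (fun w => by
      refine Eq.trans ?_ (deg_mul (one X) P w).symm
      exact (Nat.zero_add _).symm.trans (congrArg (· + _) (deg_one (X := X) _).symm))

theorem zero_mul' (P : Poly X) : Iso ((zero X).mul P) (zero X) :=
  Iso.of_deg (pfst (zero X).t P.t)
    ⟨fun w => isEmptyElim (α := empty G) w.1.1, fun y => isEmptyElim (α := empty G) y⟩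
    (fun w => isEmptyElim (α := empty G) w.1.1) (fun w => isEmptyElim (α := empty G) w.1.1)

theorem mul_add' (P Q R : Poly X) : Iso (P.mul (Q.add R)) ((P.mul Q).add (P.mul R)) := by
  refine Iso.symm (Iso.of_deg
    (plift (f := P.t) (g := (Q.add R).t)
      (sumElim (pfst P.t Q.t) (pfst P.t R.t)) (sumMap (psnd P.t Q.t) (psnd P.t R.t))
      (by rintro (w | w); exacts [w.2, w.2]))
    ⟨?_, ?_⟩ ?_ ?_)
  · rintro (⟨⟨y, z⟩, h⟩ | ⟨⟨y, z⟩, h⟩) (⟨⟨y', z'⟩, h'⟩ | ⟨⟨y', z'⟩, h'⟩) e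
    · have e1 : y = y' := congrArg (fun w => w.1.1) e
      have e2 : z = z' := Sum.inl_injective (congrArg (fun w => w.1.2) e)
      subst e1 e2
      rfl
    · exact (Sum.inl_ne_inr (congrArg (fun w => w.1.2) e)).elim
    · exact (Sum.inr_ne_inl (congrArg (fun w => w.1.2) e)).elim
    · have e1 : y = y' := congrArg (fun w => w.1.1) e
      have e2 : z = z' := Sum.inr_injective (congrArg (fun w => w.1.2) e)
      subst e1 e2
      rfl
  · rintro ⟨⟨y, z | z⟩, h⟩
    exacts [⟨Sum.inl ⟨(y, z), h⟩, rfl⟩, ⟨Sum.inr ⟨(y, z), h⟩, rfl⟩]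
  · rintro (w | w) <;> rfl
  · rintro (w | w)
    · exact (deg_mul P (Q.add R) _).trans ((congrArg (_ + ·) (deg_add_inl Q R _)).trans
        ((deg_mul P Q w).symm.trans (deg_add_inl (P.mul Q) (P.mul R) w).symm))
    · exact (deg_mul P (Q.add R) _).trans ((congrArg (_ + ·) (deg_add_inr Q R _)).trans
        ((deg_mul P R w).symm.trans (deg_add_inr (P.mul Q) (P.mul R) w).symm))

theorem res_zero' (f : X →[G] Y) : Iso ((zero Y).res f) (zero X) :=
  Iso.of_deg (pfst (zero Y).t f)
    ⟨fun w => isEmptyElim (α := empty G) w.1.1, fun y => isEmptyElim (α := empty G) y⟩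
    (fun w => isEmptyElim (α := empty G) w.1.1) (fun w => isEmptyElim (α := empty G) w.1.1)

theorem res_one' (f : X →[G] Y) : Iso ((one Y).res f) (one X) :=
  Iso.of_deg (psnd (one Y).t f)
    (bij_of_inv (fun y => ⟨(f y, y), rfl⟩)
      (fun w => Subtype.ext (Prod.ext w.2.symm rfl)) fun _ => rfl)
    (fun _ => rfl)
    (fun w => by
      refine Eq.trans ?_ (deg_res f (one Y) w).symm
      exact (deg_one (X := X) _).trans (deg_one (X := Y) _).symm)

theorem res_add' (f : X →[G] Y) (P Q : Poly Y) :
    Iso ((P.add Q).res f) ((P.res f).add (Q.res f)) := by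
  refine Iso.symm (Iso.of_deg
    (plift (f := (P.add Q).t) (g := f)
      (sumMap (pfst P.t f) (pfst Q.t f)) (sumElim (psnd P.t f) (psnd Q.t f))
      (by rintro (w | w); exacts [w.2, w.2]))
    ⟨?_, ?_⟩ ?_ ?_)
  · rintro (⟨⟨y, z⟩, h⟩ | ⟨⟨y, z⟩, h⟩) (⟨⟨y', z'⟩, h'⟩ | ⟨⟨y', z'⟩, h'⟩) e
    · have e1 : y = y' := Sum.inl_injective (congrArg (fun w => w.1.1) e)
      have e2 : z = z' := congrArg (fun w => w.1.2) e
      subst e1 e2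
      rfl
    · exact (Sum.inl_ne_inr (congrArg (fun w => w.1.1) e)).elim
    · exact (Sum.inr_ne_inl (congrArg (fun w => w.1.1) e)).elim
    · have e1 : y = y' := Sum.inr_injective (congrArg (fun w => w.1.1) e)
      have e2 : z = z' := congrArg (fun w => w.1.2) e
      subst e1 e2
      rfl
  · rintro ⟨⟨z | z, y⟩, h⟩
    exacts [⟨Sum.inl ⟨(z, y), h⟩, rfl⟩, ⟨Sum.inr ⟨(z, y), h⟩, rfl⟩]
  · rintro (w | w) <;> rfl
  · rintro (w | w)
    · exact (deg_res f (P.add Q) _).trans ((deg_add_inl P Q _).trans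
        ((deg_res f P w).symm.trans (deg_add_inl (P.res f) (Q.res f) w).symm))
    · exact (deg_res f (P.add Q) _).trans ((deg_add_inr P Q _).trans
        ((deg_res f Q w).symm.trans (deg_add_inr (P.res f) (Q.res f) w).symm))

theorem res_mul' (f : X →[G] Y) (P Q : Poly Y) :
    Iso ((P.mul Q).res f) ((P.res f).mul (Q.res f)) := by
  refine Iso.of_deg
    (plift (f := (P.res f).t) (g := (Q.res f).t)
      (plift (f := P.t) (g := f) ((pfst P.t Q.t).comp (pfst (P.mul Q).t f))
        (psnd (P.mul Q).t f) fun w => w.2)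
      (plift (f := Q.t) (g := f) ((psnd P.t Q.t).comp (pfst (P.mul Q).t f))
        (psnd (P.mul Q).t f) fun w => w.1.1.2.symm.trans w.2) fun _ => rfl)
    (bij_of_inv (fun w => ⟨(⟨(w.1.1.1.1, w.1.2.1.1), by
        have h : w.1.1.1.2 = w.1.2.1.2 := w.2
        have h1 : P.t w.1.1.1.1 = f w.1.1.1.2 := w.1.1.2
        have h2 : Q.t w.1.2.1.1 = f w.1.2.1.2 := w.1.2.2
        rw [h1, h2, h]⟩, w.1.1.1.2), w.1.1.2⟩)
      (fun _ => rfl) ?_) (fun _ => rfl) fun w => ?_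
  · rintro ⟨⟨⟨⟨y, x⟩, h⟩, ⟨⟨z, x'⟩, h'⟩⟩, e⟩
    have e' : x = x' := e
    subst e'
    rfl
  · refine (deg_mul (P.res f) (Q.res f) _).trans (Eq.trans ?_ (deg_res f (P.mul Q) w).symm)
    exact (congrArg₂ (· + ·) (deg_res f P _) (deg_res f Q _)).trans (deg_mul P Q _).symm

theorem res_id' (P : Poly X) : Iso (P.res (MulActionHom.id G)) P :=
  Iso.of_deg (pfst P.t (MulActionHom.id G))
    (bij_of_inv (fun y => ⟨(y, P.t y), rfl⟩)
      (fun w => Subtype.ext (Prod.ext rfl w.2)) fun _ => rfl)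
    (fun w => w.2) (fun w => (deg_res _ P w).symm)

theorem res_comp' (f : X →[G] Y) (g : Y →[G] Z) (P : Poly Z) :
    Iso (P.res (g.comp f)) ((P.res g).res f) := by
  refine Iso.of_deg
    (plift (f := (P.res g).t) (g := f)
      (plift (f := P.t) (g := g) (pfst P.t (g.comp f)) (f.comp (psnd P.t (g.comp f)))
        fun w => w.2) (psnd P.t (g.comp f)) fun _ => rfl)
    (bij_of_inv (fun w => ⟨(w.1.1.1.1, w.1.2), w.1.1.2.trans (congrArg g w.2)⟩)
      (fun _ => rfl) ?_) (fun _ => rfl) fun w => ?_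
  · rintro ⟨⟨⟨⟨y, x⟩, h⟩, z⟩, e⟩
    have e' : x = f z := e
    subst e'
    rfl
  · exact (deg_res f (P.res g) _).trans ((deg_res g P _).trans (deg_res (g.comp f) P w).symm)

theorem tr_zero' (f : X →[G] Y) : Iso ((zero X).tr f) (zero Y) :=
  ⟨MulActionHom.id G, MulActionHom.id G, Function.bijective_id, Function.bijective_id,
    fun _ => rfl, fun y => isEmptyElim (α := empty G) y⟩

theorem tr_add' (f : X →[G] Y) (P Q : Poly X) :
    Iso ((P.add Q).tr f) ((P.tr f).add (Q.tr f)) :=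
  ⟨MulActionHom.id G, MulActionHom.id G, Function.bijective_id, Function.bijective_id,
    fun _ => rfl, by rintro (y | y) <;> rfl⟩

theorem base_change' {W : FinGSet G} {p : W →[G] X} {q : W →[G] Y} {f : X →[G] Z} {g : Y →[G] Z}
    (h : IsCartesian p q f g) (P : Poly X) : Iso ((P.res p).tr q) ((P.tr f).res g) := by
  refine Iso.of_deg
    (plift (f := (P.tr f).t) (g := g) (pfst P.t p) (q.comp (psnd P.t p))
      fun w => (congrArg f w.2).trans (h.comm _)) ⟨?_, ?_⟩ (fun _ => rfl) fun w => ?_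
  · rintro ⟨⟨y, z⟩, e⟩ ⟨⟨y', z'⟩, e'⟩ k
    have k1 : y = y' := congrArg (fun w => w.1.1) k
    have k2 : q z = q z' := congrArg (fun w => w.1.2) k
    subst k1
    have e1 : P.t y = p z := e
    have e2 : P.t y = p z' := e'
    obtain ⟨v, _, hu⟩ := h.lift (p z) (q z) (h.comm z)
    have : z = z' := (hu z ⟨rfl, rfl⟩).trans (hu z' ⟨e2.symm.trans e1, k2.symm⟩).symm
    subst this
    rfl
  · rintro ⟨⟨y, z⟩, e⟩
    obtain ⟨v, ⟨h1, h2⟩, _⟩ := h.lift (P.t y) z e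
    exact ⟨⟨(y, v), h1.symm⟩, Subtype.ext (Prod.ext rfl h2)⟩
  · exact (deg_res g (P.tr f) _).trans ((deg_tr f P _).trans (deg_res p P w).symm)

theorem frobenius' (f : X →[G] Y) (P : Poly Y) (Q : Poly X) :
    Iso (P.mul (Q.tr f)) (((P.res f).mul Q).tr f) := by
  refine Iso.of_deg
    (plift (f := (P.res f).t) (g := Q.t)
      (plift (f := P.t) (g := f) (pfst P.t (Q.tr f).t) (Q.t.comp (psnd P.t (Q.tr f).t))
        fun w => w.2) (psnd P.t (Q.tr f).t) fun _ => rfl)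
    (bij_of_inv (fun w => ⟨(w.1.1.1.1, w.1.2), w.1.1.2.trans (congrArg f w.2)⟩)
      (fun _ => rfl) ?_) (fun w => w.2.symm) fun w => ?_
  · rintro ⟨⟨⟨⟨y, x⟩, h⟩, z⟩, e⟩
    have e' : x = Q.t z := e
    subst e'
    rfl
  · refine (deg_mul (P.res f) Q _).trans (Eq.trans ?_ (deg_mul P (Q.tr f) w).symm)
    exact congrArg₂ (· + ·) (deg_res f P _) rfl

theorem sum' (P : Poly (X.sum Y)) :
    Iso (((P.res (inl X Y)).tr (inl X Y)).add ((P.res (inr X Y)).tr (inr X Y))) P := by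
  refine Iso.of_deg (sumElim (pfst P.t (inl X Y)) (pfst P.t (inr X Y))) ⟨?_, ?_⟩ ?_ ?_
  · rintro (⟨⟨y, z⟩, h⟩ | ⟨⟨y, z⟩, h⟩) (⟨⟨y', z'⟩, h'⟩ | ⟨⟨y', z'⟩, h'⟩) e
    all_goals
      have e1 : y = y' := e
      subst e1
    · have e2 : z = z' := Sum.inl_injective (h.symm.trans h')
      subst e2
      rfl
    · exact (Sum.inl_ne_inr (h.symm.trans h')).elim
    · exact (Sum.inr_ne_inl (h.symm.trans h')).elim
    · have e2 : z = z' := Sum.inr_injective (h.symm.trans h')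
      subst e2
      rfl
  · intro y
    rcases h : P.t y with z | z
    · exact ⟨Sum.inl ⟨(y, z), h⟩, rfl⟩
    · exact ⟨Sum.inr ⟨(y, z), h⟩, rfl⟩
  · rintro (w | w)
    exacts [w.2, w.2]
  · rintro (w | w)
    · exact ((deg_add_inl ((P.res (inl X Y)).tr (inl X Y))
        ((P.res (inr X Y)).tr (inr X Y)) w).trans (deg_res (inl X Y) P w)).symm
    · exact ((deg_add_inr ((P.res (inl X Y)).tr (inl X Y))
        ((P.res (inr X Y)).tr (inr X Y)) w).trans (deg_res (inr X Y) P w)).symm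

theorem empty' (hX : IsEmpty X) (P : Poly X) : Iso P (zero X) := by
  refine Iso.symm (Iso.of_deg (MackeyStr.elimEmpty P.B)
    ⟨fun y => isEmptyElim (α := empty G) y, fun y => (hX.false (P.t y)).elim⟩
    (fun y => isEmptyElim (α := empty G) y) (fun y => isEmptyElim (α := empty G) y))

end laws

end Poly

/-! ### Group completion -/

/-- The ring obtained from a commutative semiring by group completing its addition. -/
def Completion (S : Type v) [CommSemiring S] : Type v := Algebra.GrothendieckAddGroup S

namespace Completion

variable {S T U : Type v} [CommSemiring S] [CommSemiring T] [CommSemiring U]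

instance : AddCommGroup (Completion S) :=
  inferInstanceAs (AddCommGroup (Algebra.GrothendieckAddGroup S))

/-- The canonical map to the completion. -/
def of : S →+ Completion S := Algebra.GrothendieckAddGroup.of

/-- Additive maps to abelian groups extend to the completion. -/
noncomputable def lift {A : Type*} [AddCommGroup A] (f : S →+ A) : Completion S →+ A :=
  Algebra.GrothendieckAddGroup.lift f

theorem lift_of {A : Type*} [AddCommGroup A] (f : S →+ A) (s : S) : lift f (of s) = f s :=
  DFunLike.congr_fun (Algebra.GrothendieckAddGroup.lift.symm_apply_apply f) s

theorem hom_ext {A : Type*} [AddCommGroup A] {f g : Completion S →+ A}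
    (h : ∀ s, f (of s) = g (of s)) : f = g :=
  Algebra.GrothendieckAddGroup.lift.symm.injective (AddMonoidHom.ext h)

/-- The biadditive extension of the multiplication. -/
noncomputable def mulHom : Completion S →+ Completion S →+ Completion S :=
  lift
    { toFun := fun s => lift (of.comp (AddMonoidHom.mulLeft s))
      map_zero' := hom_ext fun t => by simp [lift_of]
      map_add' := fun s s' => hom_ext fun t => by simp [lift_of, add_mul] }

theorem mulHom_of (s t : S) : mulHom (of s) (of t) = of (s * t) := by
  unfold mulHom
  rw [lift_of]
  exact lift_of _ _

noncomputable instance : Mul (Completion S) := ⟨fun a b => mulHom a b⟩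

instance : One (Completion S) := ⟨of 1⟩

theorem mul_def (a b : Completion S) : a * b = mulHom a b := rfl

theorem one_def : (1 : Completion S) = of 1 := rfl

theorem of_mul (s t : S) : of s * of t = of (s * t) := mulHom_of s t

theorem mul_comm' (a b : Completion S) : a * b = b * a := by
  have : (mulHom : Completion S →+ Completion S →+ Completion S) = mulHom.flip :=
    hom_ext fun s => hom_ext fun t => by
      rw [AddMonoidHom.flip_apply, mulHom_of, mulHom_of, mul_comm]
  exact DFunLike.congr_fun (DFunLike.congr_fun this a) b

theorem one_mul' (a : Completion S) : 1 * a = a := by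
  have : mulHom (1 : Completion S) = AddMonoidHom.id _ :=
    hom_ext fun s => by rw [one_def, mulHom_of, one_mul, AddMonoidHom.id_apply]
  exact DFunLike.congr_fun this a

theorem mul_assoc' (a b c : Completion S) : a * b * c = a * (b * c) := by
  have h3 : ∀ s t : S, mulHom (mulHom (of s) (of t)) = (mulHom (of s)).comp (mulHom (of t)) :=
    fun s t => hom_ext fun r => by
      rw [AddMonoidHom.comp_apply, mulHom_of, mulHom_of, mulHom_of, mulHom_of, mul_assoc]
  have h2 : ∀ s : S, (mulHom (S := S)).comp (mulHom (of s)) =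
      (AddMonoidHom.compHom (mulHom (of s))).comp mulHom :=
    fun s => hom_ext fun t => h3 s t
  have h1 : mulHom.flip (mulHom b c) = (mulHom.flip c).comp (mulHom.flip b) :=
    hom_ext fun s => (DFunLike.congr_fun (DFunLike.congr_fun (h2 s) b) c).symm
  exact (DFunLike.congr_fun h1 a).symm

noncomputable instance : CommRing (Completion S) :=
  { (inferInstance : AddCommGroup (Completion S)) with
    mul_assoc := mul_assoc'
    one_mul := one_mul'
    mul_one := fun a => (mul_comm' a 1).trans (one_mul' a)
    mul_comm := mul_comm'
    left_distrib := fun a b c => map_add (mulHom a) b c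
    right_distrib := fun a b c => DFunLike.congr_fun (map_add mulHom a b) c
    zero_mul := fun a => DFunLike.congr_fun (map_zero mulHom) a
    mul_zero := fun a => map_zero (mulHom a) }

/-- Functoriality of the completion for additive maps. -/
noncomputable def map (f : S →+ T) : Completion S →+ Completion T := lift (of.comp f)

theorem map_of (f : S →+ T) (s : S) : map f (of s) = of (f s) := lift_of _ _

theorem map_mul (f : S →+* T) (a b : Completion S) :
    map (f : S →+ T) (a * b) = map (f : S →+ T) a * map (f : S →+ T) b := by
  have h : (AddMonoidHom.compHom (map (f : S →+ T))).comp mulHom =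
      ((mulHom.comp (map (f : S →+ T))).flip.comp (map (f : S →+ T))).flip :=
    hom_ext fun s => hom_ext fun t => by
      change map (f : S →+ T) (mulHom (of s) (of t)) =
        mulHom (map (f : S →+ T) (of s)) (map (f : S →+ T) (of t))
      rw [mulHom_of, map_of, map_of, map_of, mulHom_of]
      exact congrArg of (f.map_mul s t)
  exact DFunLike.congr_fun (DFunLike.congr_fun h a) b

theorem map_one (f : S →+* T) : map (f : S →+ T) 1 = 1 := by
  rw [one_def, map_of]
  exact congrArg of f.map_one

end Completion

/-- The analogue of a Green functor with values in commutative semirings. -/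
structure SemiGreenFunctor (G : Type u) [Group G] where
  obj : FinGSet G → Type (u + 1)
  [semiring : ∀ X, CommSemiring (obj X)]
  res : ∀ {X Y : FinGSet G}, (X →[G] Y) → obj Y →+* obj X
  tr : ∀ {X Y : FinGSet G}, (X →[G] Y) → obj X →+ obj Y
  res_id : ∀ {X : FinGSet G} (a : obj X), res (MulActionHom.id G) a = a
  res_comp : ∀ {X Y Z : FinGSet G} (f : X →[G] Y) (g : Y →[G] Z) (a : obj Z),
    res (g.comp f) a = res f (res g a)
  tr_id : ∀ {X : FinGSet G} (a : obj X), tr (MulActionHom.id G) a = a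
  tr_comp : ∀ {X Y Z : FinGSet G} (f : X →[G] Y) (g : Y →[G] Z) (a : obj X),
    tr (g.comp f) a = tr g (tr f a)
  base_change : ∀ {P X Y Z : FinGSet G} {p : P →[G] X} {q : P →[G] Y} {f : X →[G] Z}
    {g : Y →[G] Z}, IsCartesian p q f g → ∀ a : obj X, res g (tr f a) = tr q (res p a)
  empty : ∀ X : FinGSet G, IsEmpty X → ∀ a : obj X, a = 0
  sum : ∀ (X Y : FinGSet G) (a : obj (X.sum Y)),
    tr (FinGSet.inl X Y) (res (FinGSet.inl X Y) a) +
      tr (FinGSet.inr X Y) (res (FinGSet.inr X Y) a) = a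
  frobenius : ∀ {X Y : FinGSet G} (f : X →[G] Y) (a : obj Y) (b : obj X),
    a * tr f b = tr f (res f a * b)

attribute [instance] SemiGreenFunctor.semiring

namespace SemiGreenFunctor

variable {G : Type u} [Group G]

/-- The Mackey functor obtained by levelwise group completion. -/
noncomputable def mackey (S : SemiGreenFunctor G) : MackeyStr fun X => Completion (S.obj X) :=
  let res : ∀ {X Y : FinGSet G}, (X →[G] Y) → Completion (S.obj Y) →+ Completion (S.obj X) :=
    fun f => Completion.map (S.res f : _ →+ _)
  let tr : ∀ {X Y : FinGSet G}, (X →[G] Y) → Completion (S.obj X) →+ Completion (S.obj Y) :=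
    fun f => Completion.map (S.tr f)
  have hr : ∀ {X Y : FinGSet G} (f : X →[G] Y) (s : S.obj Y),
    res f (Completion.of s) = Completion.of (S.res f s) := fun _ _ => Completion.map_of _ _
  have ht : ∀ {X Y : FinGSet G} (f : X →[G] Y) (s : S.obj X),
    tr f (Completion.of s) = Completion.of (S.tr f s) := fun _ _ => Completion.map_of _ _
  have res_id : ∀ {X : FinGSet G} (a : Completion (S.obj X)), res (MulActionHom.id G) a = a :=
    fun {X} => DFunLike.congr_fun (show res (MulActionHom.id G) = AddMonoidHom.id _ from
      Completion.hom_ext fun s => by rw [hr, S.res_id]; rfl)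
  have tr_id : ∀ {X : FinGSet G} (a : Completion (S.obj X)), tr (MulActionHom.id G) a = a :=
    fun {X} => DFunLike.congr_fun (show tr (MulActionHom.id G) = AddMonoidHom.id _ from
      Completion.hom_ext fun s => by rw [ht, S.tr_id]; rfl)
  have base_change : ∀ {P X Y Z : FinGSet G} {p : P →[G] X} {q : P →[G] Y} {f : X →[G] Z}
      {g : Y →[G] Z}, IsCartesian p q f g → ∀ a : Completion (S.obj X),
      res g (tr f a) = tr q (res p a) := fun {P X Y Z p q f g} h =>
    DFunLike.congr_fun (show (res g).comp (tr f) = (tr q).comp (res p) from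
      Completion.hom_ext fun s => by
        rw [AddMonoidHom.comp_apply, AddMonoidHom.comp_apply, ht, hr, hr, ht, S.base_change h])
  have empty : ∀ X : FinGSet G, IsEmpty X → Subsingleton (Completion (S.obj X)) :=
    fun X hX => subsingleton_of_forall_eq 0 (DFunLike.congr_fun
      (show AddMonoidHom.id (Completion (S.obj X)) = 0 from
        Completion.hom_ext fun s => by rw [S.empty X hX s, map_zero, map_zero, map_zero]))
  { res := res
    tr := tr
    res_id := res_id
    res_comp := fun {X Y Z} f g => DFunLike.congr_fun
      (show res (g.comp f) = (res f).comp (res g) from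
        Completion.hom_ext fun s => by rw [AddMonoidHom.comp_apply, hr, hr, hr, S.res_comp])
    tr_id := tr_id
    tr_comp := fun {X Y Z} f g => DFunLike.congr_fun
      (show tr (g.comp f) = (tr g).comp (tr f) from
        Completion.hom_ext fun s => by rw [AddMonoidHom.comp_apply, ht, ht, ht, S.tr_comp])
    base_change := base_change
    empty := empty
    sum := fun X Y => MackeyStr.bijective_of_sum res tr res_id tr_id base_change empty X Y
      (DFunLike.congr_fun (show (tr (FinGSet.inl X Y)).comp (res (FinGSet.inl X Y)) +
          (tr (FinGSet.inr X Y)).comp (res (FinGSet.inr X Y)) = AddMonoidHom.id _ from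
        Completion.hom_ext fun s => by
          rw [AddMonoidHom.add_apply, AddMonoidHom.comp_apply, AddMonoidHom.comp_apply, hr, hr, ht,
            ht, ← map_add, S.sum, AddMonoidHom.id_apply])) }

theorem mackey_res (S : SemiGreenFunctor G) {X Y : FinGSet G} (f : X →[G] Y) (s : S.obj Y) :
    S.mackey.res f (Completion.of s) = Completion.of (S.res f s) := Completion.map_of _ _

theorem mackey_tr (S : SemiGreenFunctor G) {X Y : FinGSet G} (f : X →[G] Y) (s : S.obj X) :
    S.mackey.tr f (Completion.of s) = Completion.of (S.tr f s) := Completion.map_of _ _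

/-- The Green functor obtained by levelwise group completion. -/
noncomputable def completion (S : SemiGreenFunctor G) : GreenFunctor G where
  obj X := Completion (S.obj X)
  mackey := S.mackey
  res_one f := Completion.map_one (S.res f)
  res_mul f := Completion.map_mul (S.res f)
  frobenius {X Y} f a b := by
    have h : (Completion.mulHom.flip.comp (S.mackey.tr f)).flip =
        (AddMonoidHom.compHom (S.mackey.tr f)).comp
          (Completion.mulHom.comp (S.mackey.res f)) :=
      Completion.hom_ext fun s => Completion.hom_ext fun t => by
        change Completion.mulHom (Completion.of s) (S.mackey.tr f (Completion.of t)) =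
          S.mackey.tr f (Completion.mulHom (S.mackey.res f (Completion.of s)) (Completion.of t))
        rw [mackey_tr, mackey_res, Completion.mulHom_of, Completion.mulHom_of, mackey_tr,
          S.frobenius]
    exact DFunLike.congr_fun (DFunLike.congr_fun h a) b

end SemiGreenFunctor

/-! ### The Burnside Green functor and the free Green functor on a fixed generator -/

namespace Poly

open FinGSet

variable {G : Type u} [Group G]

instance setoid (X : FinGSet G) : Setoid (Poly X) := ⟨Iso, Iso.refl, Iso.symm, Iso.trans⟩

/-- Isomorphism classes of polynomials. -/
def Class (X : FinGSet G) : Type (u + 1) := Quotient (setoid X)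

instance (X : FinGSet G) : Add (Class X) :=
  ⟨Quotient.map₂ add fun _ _ h _ _ h' => add_congr h h'⟩
instance (X : FinGSet G) : Mul (Class X) :=
  ⟨Quotient.map₂ mul fun _ _ h _ _ h' => mul_congr h h'⟩
instance (X : FinGSet G) : Zero (Class X) := ⟨Quotient.mk _ (zero X)⟩
instance (X : FinGSet G) : One (Class X) := ⟨Quotient.mk _ (one X)⟩

theorem Class.mul_comm' {X : FinGSet G} (a b : Class X) : a * b = b * a :=
  Quotient.inductionOn₂ a b fun P Q => Quotient.sound (Poly.mul_comm' P Q)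

theorem Class.add_comm' {X : FinGSet G} (a b : Class X) : a + b = b + a :=
  Quotient.inductionOn₂ a b fun P Q => Quotient.sound (Poly.add_comm' P Q)

theorem Class.zero_add' {X : FinGSet G} (a : Class X) : 0 + a = a :=
  Quotient.inductionOn a fun P => Quotient.sound (Poly.zero_add' P)

theorem Class.one_mul' {X : FinGSet G} (a : Class X) : 1 * a = a :=
  Quotient.inductionOn a fun P => Quotient.sound (Poly.one_mul' P)

theorem Class.zero_mul' {X : FinGSet G} (a : Class X) : 0 * a = 0 :=
  Quotient.inductionOn a fun P => Quotient.sound (Poly.zero_mul' P)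

theorem Class.mul_add' {X : FinGSet G} (a b c : Class X) : a * (b + c) = a * b + a * c :=
  Quotient.inductionOn₃ a b c fun P Q R => Quotient.sound (Poly.mul_add' P Q R)

instance (X : FinGSet G) : CommSemiring (Class X) where
  add_assoc a b c := Quotient.inductionOn₃ a b c fun P Q R => Quotient.sound (add_assoc' P Q R)
  zero_add := Class.zero_add'
  add_zero a := (Class.add_comm' a 0).trans (Class.zero_add' a)
  add_comm := Class.add_comm'
  nsmul := nsmulRec
  mul_assoc a b c := Quotient.inductionOn₃ a b c fun P Q R => Quotient.sound (mul_assoc' P Q R)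
  one_mul := Class.one_mul'
  mul_one a := (Class.mul_comm' a 1).trans (Class.one_mul' a)
  mul_comm := Class.mul_comm'
  zero_mul := Class.zero_mul'
  mul_zero a := (Class.mul_comm' a 0).trans (Class.zero_mul' a)
  left_distrib := Class.mul_add'
  right_distrib a b c := by
    rw [Class.mul_comm', Class.mul_add', Class.mul_comm' c a, Class.mul_comm' c b]

end Poly

/-- The polynomials `G/G ← A → B → X` with isotropy-preserving `A → B`, up to isomorphism. -/
def polySemiGreen (G : Type u) [Group G] : SemiGreenFunctor G where
  obj X := Poly.Class X
  res f :=
    { toFun := Quotient.map (Poly.res f) fun _ _ h => Poly.res_congr f h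
      map_one' := Quotient.sound (Poly.res_one' f)
      map_zero' := Quotient.sound (Poly.res_zero' f)
      map_mul' := fun a b => Quotient.inductionOn₂ a b fun P Q =>
        Quotient.sound (Poly.res_mul' f P Q)
      map_add' := fun a b => Quotient.inductionOn₂ a b fun P Q =>
        Quotient.sound (Poly.res_add' f P Q) }
  tr f :=
    { toFun := Quotient.map (Poly.tr f) fun _ _ h => Poly.tr_congr f h
      map_zero' := Quotient.sound (Poly.tr_zero' f)
      map_add' := fun a b => Quotient.inductionOn₂ a b fun P Q =>
        Quotient.sound (Poly.tr_add' f P Q) }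
  res_id a := Quotient.inductionOn a fun P => Quotient.sound (Poly.res_id' P)
  res_comp f g a := Quotient.inductionOn a fun P => Quotient.sound (Poly.res_comp' f g P)
  tr_id a := Quotient.inductionOn a fun _ => rfl
  tr_comp _ _ a := Quotient.inductionOn a fun _ => rfl
  base_change h a := Quotient.inductionOn a fun P =>
    Quotient.sound ((Poly.base_change' h P).symm)
  empty _ hX a := Quotient.inductionOn a fun P => Quotient.sound (Poly.empty' hX P)
  sum _ _ a := Quotient.inductionOn a fun P => Quotient.sound (Poly.sum' P)
  frobenius f a b := Quotient.inductionOn₂ a b fun P Q => Quotient.sound (Poly.frobenius' f P Q)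

/-- The free Green functor on a generator at level `G/G`: the group completion of the functor
represented by `G/G` on the category of polynomials with isotropy-preserving exponents. -/
noncomputable def freeGreen (G : Type u) [Group G] : GreenFunctor G := (polySemiGreen G).completion

/-- The generator `x` of the free Green functor: the class of `G/G ← G/G → G/G → G/G`. -/
noncomputable def freeGreenGen (G : Type u) [Group G] : (freeGreen G).obj (FinGSet.pt G) :=
  Completion.of (Quotient.mk _
    { A := FinGSet.pt G
      B := FinGSet.pt G
      q := MulActionHom.id G
      t := MulActionHom.id G
      isotropy := fun _ => rfl })

/-- A finite `G`-set over `X`. -/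
structure GSetOver {G : Type u} [Group G] (X : FinGSet G) where
  B : FinGSet G
  t : B →[G] X

namespace GSetOver

open FinGSet

variable {G : Type u} [Group G] {X Y : FinGSet G}

/-- Two finite `G`-sets over `X` are isomorphic if there is an equivariant bijection over `X`. -/
def Iso (P Q : GSetOver X) : Prop :=
  ∃ b : P.B →[G] Q.B, Function.Bijective b ∧ ∀ y, Q.t (b y) = P.t y

/-- A finite `G`-set over `X` as a polynomial with empty exponent. -/
def toPoly (P : GSetOver X) : Poly X where
  A := FinGSet.empty G
  B := P.B
  q := MackeyStr.elimEmpty P.B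
  t := P.t
  isotropy := fun a => isEmptyElim a

theorem deg_toPoly (P : GSetOver X) (y : P.B) : P.toPoly.deg y = 0 :=
  haveI : IsEmpty {a : P.toPoly.A // P.toPoly.q a = y} :=
    ⟨fun a => isEmptyElim (α := FinGSet.empty G) a.1⟩
  Nat.card_of_isEmpty

theorem iso_toPoly {P Q : GSetOver X} : Poly.Iso P.toPoly Q.toPoly ↔ Iso P Q :=
  ⟨fun ⟨_, b, _, hb, _, ht⟩ => ⟨b, hb, ht⟩, fun ⟨b, hb, ht⟩ => Poly.Iso.of_deg b hb ht
    fun y => (deg_toPoly Q (b y)).trans (deg_toPoly P y).symm⟩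

theorem Iso.symm {P Q : GSetOver X} (h : Iso P Q) : Iso Q P :=
  iso_toPoly.1 (iso_toPoly.2 h).symm

instance setoid (X : FinGSet G) : Setoid (GSetOver X) where
  r := Iso
  iseqv :=
    ⟨fun _ => iso_toPoly.1 (Poly.Iso.refl _), fun h => h.symm,
      fun h h' => iso_toPoly.1 ((iso_toPoly.2 h).trans (iso_toPoly.2 h'))⟩

/-- The empty `G`-set. -/
def zero (X : FinGSet G) : GSetOver X := ⟨FinGSet.empty G, MackeyStr.elimEmpty X⟩

/-- The identity of `X`. -/
def one (X : FinGSet G) : GSetOver X := ⟨X, MulActionHom.id G⟩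

/-- The disjoint union. -/
def add (P Q : GSetOver X) : GSetOver X := ⟨P.B.sum Q.B, sumElim P.t Q.t⟩

/-- The fibre product over `X`. -/
def mul (P Q : GSetOver X) : GSetOver X := ⟨pullback P.t Q.t, P.t.comp (pfst P.t Q.t)⟩

/-- The base change along `f : X → Y`. -/
def res (f : X →[G] Y) (P : GSetOver Y) : GSetOver X := ⟨pullback P.t f, psnd P.t f⟩

/-- The composition with `f : X → Y`. -/
def tr (f : X →[G] Y) (P : GSetOver X) : GSetOver Y := ⟨P.B, f.comp P.t⟩

theorem toPoly_zero : Poly.Iso (zero X).toPoly (Poly.zero X) :=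
  Poly.Iso.of_deg (MulActionHom.id G) Function.bijective_id
    (fun y => isEmptyElim (α := empty G) y) (fun y => isEmptyElim (α := empty G) y)

theorem toPoly_one : Poly.Iso (one X).toPoly (Poly.one X) := Poly.Iso.refl _

theorem toPoly_add (P Q : GSetOver X) : Poly.Iso (P.add Q).toPoly (P.toPoly.add Q.toPoly) :=
  Poly.Iso.of_deg (MulActionHom.id G) Function.bijective_id (fun _ => rfl) (by
    rintro (y | y)
    · exact (Poly.deg_add_inl P.toPoly Q.toPoly y).trans
        ((deg_toPoly P y).trans (deg_toPoly (P.add Q) (Sum.inl y)).symm)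
    · exact (Poly.deg_add_inr P.toPoly Q.toPoly y).trans
        ((deg_toPoly Q y).trans (deg_toPoly (P.add Q) (Sum.inr y)).symm))

theorem toPoly_mul (P Q : GSetOver X) : Poly.Iso (P.mul Q).toPoly (P.toPoly.mul Q.toPoly) :=
  Poly.Iso.of_deg (MulActionHom.id G) Function.bijective_id (fun _ => rfl) fun w =>
    (Poly.deg_mul P.toPoly Q.toPoly w).trans ((congrArg₂ (· + ·) (deg_toPoly P _)
      (deg_toPoly Q _)).trans (deg_toPoly (P.mul Q) w).symm)

theorem toPoly_res (f : X →[G] Y) (P : GSetOver Y) :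
    Poly.Iso (P.res f).toPoly (P.toPoly.res f) :=
  Poly.Iso.of_deg (MulActionHom.id G) Function.bijective_id (fun _ => rfl) fun w =>
    (Poly.deg_res f P.toPoly w).trans ((deg_toPoly P _).trans (deg_toPoly (P.res f) w).symm)

/-- Isomorphism classes of finite `G`-sets over `X`. -/
def Class (X : FinGSet G) : Type (u + 1) := Quotient (setoid X)

/-- The injection into the classes of polynomials. -/
def Class.toPoly : Class X → Poly.Class X :=
  Quotient.map GSetOver.toPoly fun _ _ h => iso_toPoly.2 h

theorem Class.toPoly_injective : Function.Injective (Class.toPoly (X := X)) := fun a b =>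
  Quotient.inductionOn₂ a b fun _ _ h => Quotient.sound (iso_toPoly.1 (Quotient.exact h))

theorem add_congr {P P' Q Q' : GSetOver X} (h : Iso P P') (h' : Iso Q Q') :
    Iso (P.add Q) (P'.add Q') :=
  iso_toPoly.1 (((toPoly_add P Q).trans (Poly.add_congr (iso_toPoly.2 h) (iso_toPoly.2 h'))).trans
    (toPoly_add P' Q').symm)

theorem mul_congr {P P' Q Q' : GSetOver X} (h : Iso P P') (h' : Iso Q Q') :
    Iso (P.mul Q) (P'.mul Q') :=
  iso_toPoly.1 (((toPoly_mul P Q).trans (Poly.mul_congr (iso_toPoly.2 h) (iso_toPoly.2 h'))).trans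
    (toPoly_mul P' Q').symm)

theorem res_congr (f : X →[G] Y) {P P' : GSetOver Y} (h : Iso P P') : Iso (P.res f) (P'.res f) :=
  iso_toPoly.1 (((toPoly_res f P).trans (Poly.res_congr f (iso_toPoly.2 h))).trans
    (toPoly_res f P').symm)

theorem tr_congr (f : X →[G] Y) {P P' : GSetOver X} (h : Iso P P') : Iso (P.tr f) (P'.tr f) :=
  iso_toPoly.1 (Poly.tr_congr f (iso_toPoly.2 h))

instance (X : FinGSet G) : Add (Class X) :=
  ⟨Quotient.map₂ add fun _ _ h _ _ h' => add_congr h h'⟩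
instance (X : FinGSet G) : Mul (Class X) :=
  ⟨Quotient.map₂ mul fun _ _ h _ _ h' => mul_congr h h'⟩
instance (X : FinGSet G) : Zero (Class X) := ⟨Quotient.mk _ (zero X)⟩
instance (X : FinGSet G) : One (Class X) := ⟨Quotient.mk _ (one X)⟩

theorem Class.zero' : (0 : Class X).toPoly = 0 := Quotient.sound toPoly_zero
theorem Class.one' : (1 : Class X).toPoly = 1 := Quotient.sound toPoly_one
theorem Class.add' (a b : Class X) : (a + b).toPoly = a.toPoly + b.toPoly :=
  Quotient.inductionOn₂ a b fun P Q => Quotient.sound (toPoly_add P Q)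
theorem Class.mul' (a b : Class X) : (a * b).toPoly = a.toPoly * b.toPoly :=
  Quotient.inductionOn₂ a b fun P Q => Quotient.sound (toPoly_mul P Q)

instance (X : FinGSet G) : CommSemiring (Class X) where
  add_assoc a b c := Class.toPoly_injective (by simp only [Class.add', add_assoc])
  zero_add a := Class.toPoly_injective (by rw [Class.add', Class.zero', zero_add])
  add_zero a := Class.toPoly_injective (by rw [Class.add', Class.zero', add_zero])
  add_comm a b := Class.toPoly_injective (by rw [Class.add', Class.add', add_comm])
  nsmul := nsmulRec
  mul_assoc a b c := Class.toPoly_injective (by simp only [Class.mul', mul_assoc])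
  one_mul a := Class.toPoly_injective (by rw [Class.mul', Class.one', one_mul])
  mul_one a := Class.toPoly_injective (by rw [Class.mul', Class.one', mul_one])
  mul_comm a b := Class.toPoly_injective (by rw [Class.mul', Class.mul', mul_comm])
  zero_mul a := Class.toPoly_injective (by rw [Class.mul', Class.zero', zero_mul])
  mul_zero a := Class.toPoly_injective (by rw [Class.mul', Class.zero', mul_zero])
  left_distrib a b c := Class.toPoly_injective (by simp only [Class.mul', Class.add', mul_add])
  right_distrib a b c := Class.toPoly_injective (by simp only [Class.mul', Class.add', add_mul])

end GSetOver

/-- Finite `G`-sets over `X` up to isomorphism, with disjoint unions, fibre products, base change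
and composition. -/
def gsetSemiGreen (G : Type u) [Group G] : SemiGreenFunctor G :=
  let res : ∀ {X Y : FinGSet G}, (X →[G] Y) → GSetOver.Class Y → GSetOver.Class X :=
    fun f => Quotient.map (GSetOver.res f) fun _ _ h => GSetOver.res_congr f h
  let tr : ∀ {X Y : FinGSet G}, (X →[G] Y) → GSetOver.Class X → GSetOver.Class Y :=
    fun f => Quotient.map (GSetOver.tr f) fun _ _ h => GSetOver.tr_congr f h
  have hr : ∀ {X Y : FinGSet G} (f : X →[G] Y) (a : GSetOver.Class Y),
      (res f a).toPoly = (polySemiGreen G).res f a.toPoly := fun f a =>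
    Quotient.inductionOn a fun P => Quotient.sound (GSetOver.toPoly_res f P)
  have ht : ∀ {X Y : FinGSet G} (f : X →[G] Y) (a : GSetOver.Class X),
      (tr f a).toPoly = (polySemiGreen G).tr f a.toPoly := fun f a =>
    Quotient.inductionOn a fun _ => rfl
  { obj := fun X => GSetOver.Class X
    res := fun f =>
      { toFun := res f
        map_one' := GSetOver.Class.toPoly_injective ((hr f 1).trans
          ((congrArg _ GSetOver.Class.one').trans
            ((map_one ((polySemiGreen G).res f)).trans GSetOver.Class.one'.symm)))
        map_zero' := GSetOver.Class.toPoly_injective ((hr f 0).trans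
          ((congrArg _ GSetOver.Class.zero').trans
            ((map_zero ((polySemiGreen G).res f)).trans GSetOver.Class.zero'.symm)))
        map_mul' := fun a b => GSetOver.Class.toPoly_injective ((hr f (a * b)).trans
          ((congrArg _ (GSetOver.Class.mul' a b)).trans
            ((map_mul ((polySemiGreen G).res f) a.toPoly b.toPoly).trans
              ((GSetOver.Class.mul' _ _).trans
                (congrArg₂ (· * ·) (hr f a) (hr f b))).symm)))
        map_add' := fun a b => GSetOver.Class.toPoly_injective ((hr f (a + b)).trans
          ((congrArg _ (GSetOver.Class.add' a b)).trans
            ((map_add ((polySemiGreen G).res f) a.toPoly b.toPoly).trans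
              ((GSetOver.Class.add' _ _).trans
                (congrArg₂ (· + ·) (hr f a) (hr f b))).symm))) }
    tr := fun f =>
      { toFun := tr f
        map_zero' := GSetOver.Class.toPoly_injective ((ht f 0).trans
          ((congrArg _ GSetOver.Class.zero').trans
            ((map_zero ((polySemiGreen G).tr f)).trans GSetOver.Class.zero'.symm)))
        map_add' := fun a b => GSetOver.Class.toPoly_injective ((ht f (a + b)).trans
          ((congrArg _ (GSetOver.Class.add' a b)).trans
            ((map_add ((polySemiGreen G).tr f) a.toPoly b.toPoly).trans
              ((GSetOver.Class.add' _ _).trans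
                (congrArg₂ (· + ·) (ht f a) (ht f b))).symm))) }
    res_id := fun a => GSetOver.Class.toPoly_injective
      ((hr _ _).trans ((polySemiGreen G).res_id _))
    res_comp := fun f g a => GSetOver.Class.toPoly_injective
      ((hr _ _).trans (((polySemiGreen G).res_comp f g _).trans
        (((hr f _).trans (congrArg _ (hr g a))).symm)))
    tr_id := fun a => Quotient.inductionOn a fun _ => rfl
    tr_comp := fun _ _ a => Quotient.inductionOn a fun _ => rfl
    base_change := fun {P X Y Z p q f g} h a => GSetOver.Class.toPoly_injective
      (((hr g _).trans (congrArg _ (ht f a))).trans (((polySemiGreen G).base_change h _).trans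
        ((ht q _).trans (congrArg _ (hr p a))).symm))
    empty := fun X hX a => GSetOver.Class.toPoly_injective
      (((polySemiGreen G).empty X hX _).trans GSetOver.Class.zero'.symm)
    sum := fun X Y a => GSetOver.Class.toPoly_injective
      ((GSetOver.Class.add' _ _).trans (Eq.trans (congrArg₂ (· + ·)
        ((ht _ _).trans (congrArg _ (hr _ a))) ((ht _ _).trans (congrArg _ (hr _ a))))
          ((polySemiGreen G).sum X Y _)))
    frobenius := fun f a b => GSetOver.Class.toPoly_injective
      (((GSetOver.Class.mul' _ _).trans (congrArg _ (ht f b))).trans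
        (((polySemiGreen G).frobenius f _ _).trans ((ht f _).trans (congrArg _
          ((GSetOver.Class.mul' _ _).trans (congrArg (· * _) (hr f a))))).symm)) }

/-- The Burnside Green functor: its value at `X` is the Grothendieck ring of finite `G`-sets
over `X`. -/
noncomputable def burnside (G : Type u) [Group G] : GreenFunctor G := (gsetSemiGreen G).completion

/-! ### The augmentation -/

/-- The morphism of Green functors induced on group completions by semiring homomorphisms
compatible with restrictions and transfers. -/
noncomputable def SemiGreenFunctor.completionHom {G : Type u} [Group G] {S T : SemiGreenFunctor G}
    (φ : ∀ X : FinGSet G, S.obj X →+* T.obj X)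
    (hres : ∀ {X Y : FinGSet G} (f : X →[G] Y) (a : S.obj Y), φ X (S.res f a) = T.res f (φ Y a))
    (htr : ∀ {X Y : FinGSet G} (f : X →[G] Y) (a : S.obj X), φ Y (S.tr f a) = T.tr f (φ X a)) :
    GreenFunctor.Hom S.completion T.completion where
  app X :=
    { Completion.map (φ X : S.obj X →+ T.obj X) with
      map_one' := Completion.map_one (φ X)
      map_mul' := Completion.map_mul (φ X) }
  app_res {X Y} f := DFunLike.congr_fun
    (show (Completion.map (φ X : S.obj X →+ T.obj X)).comp (S.mackey.res f) =
        (T.mackey.res f).comp (Completion.map (φ Y : S.obj Y →+ T.obj Y)) from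
      Completion.hom_ext fun s => by
        rw [AddMonoidHom.comp_apply, AddMonoidHom.comp_apply, S.mackey_res, Completion.map_of,
          Completion.map_of, T.mackey_res]
        exact congrArg Completion.of (hres f s))
  app_tr {X Y} f := DFunLike.congr_fun
    (show (Completion.map (φ Y : S.obj Y →+ T.obj Y)).comp (S.mackey.tr f) =
        (T.mackey.tr f).comp (Completion.map (φ X : S.obj X →+ T.obj X)) from
      Completion.hom_ext fun s => by
        rw [AddMonoidHom.comp_apply, AddMonoidHom.comp_apply, S.mackey_tr, Completion.map_of,
          Completion.map_of, T.mackey_tr]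
        exact congrArg Completion.of (htr f s))

namespace Poly

open FinGSet

variable {G : Type u} [Group G] {X Y : FinGSet G}

/-- The `G`-set of points of `B` outside the image of `A → B`. -/
def compl (P : Poly X) : FinGSet G :=
  letI : MulAction G {y : P.B // ∀ a, P.q a ≠ y} :=
    { smul := fun g y => ⟨g • y.1, fun a h => y.2 (g⁻¹ • a) (by
        rw [map_smul, h, inv_smul_smul])⟩
      one_smul := fun y => Subtype.ext (one_smul G y.1)
      mul_smul := fun g h y => Subtype.ext (mul_smul g h y.1) }
  ⟨{y : P.B // ∀ a, P.q a ≠ y}⟩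

/-- The evaluation at `x = 0` of a polynomial: only the points of `B` with empty exponent
contribute. -/
def aug (P : Poly X) : GSetOver X where
  B := P.compl
  t := ⟨fun y => P.t y.1, fun g y => map_smul P.t g y.1⟩

theorem aug_congr {P Q : Poly X} : Iso P Q → GSetOver.Iso P.aug Q.aug := by
  rintro ⟨a, b, ha, hb, hq, ht⟩
  refine ⟨⟨fun y => ⟨b y.1, fun c h => ?_⟩, fun g y => Subtype.ext (map_smul b g y.1)⟩,
    ⟨fun y z h => Subtype.ext (hb.1 (congrArg Subtype.val h)), fun y => ?_⟩, fun y => ht y.1⟩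
  · obtain ⟨c, rfl⟩ := ha.2 c
    exact y.2 c (hb.1 ((hq c).symm.trans h))
  · obtain ⟨z, hz⟩ := hb.2 y.1
    exact ⟨⟨z, fun c h => y.2 (a c) ((hq c).trans ((congrArg b h).trans hz))⟩, Subtype.ext hz⟩

theorem aug_zero : GSetOver.Iso (zero X).aug (GSetOver.zero X) :=
  ⟨⟨fun y => y.1, fun _ _ => rfl⟩, ⟨fun y => isEmptyElim (α := empty G) y.1,
    fun y => isEmptyElim (α := empty G) y⟩, fun _ => rfl⟩

theorem aug_one : GSetOver.Iso (one X).aug (GSetOver.one X) :=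
  ⟨⟨fun y => y.1, fun _ _ => rfl⟩, ⟨fun _ _ h => Subtype.ext h,
    fun y => ⟨⟨y, fun a => isEmptyElim (α := empty G) a⟩, rfl⟩⟩, fun _ => rfl⟩

theorem aug_add (P Q : Poly X) : GSetOver.Iso (P.add Q).aug (P.aug.add Q.aug) := by
  refine GSetOver.Iso.symm (⟨⟨fun y => match y with
      | Sum.inl y => ⟨Sum.inl y.1, ?_⟩
      | Sum.inr y => ⟨Sum.inr y.1, ?_⟩, ?_⟩, ⟨?_, ?_⟩, ?_⟩ :
    GSetOver.Iso (P.aug.add Q.aug) (P.add Q).aug)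
  · rintro (a | a) h
    exacts [y.2 a (Sum.inl_injective h), Sum.inr_ne_inl h]
  · rintro (a | a) h
    exacts [Sum.inl_ne_inr h, y.2 a (Sum.inr_injective h)]
  · rintro g (y | y) <;> rfl
  · rintro (y | y) (z | z) h
    · exact congrArg Sum.inl (Subtype.ext (Sum.inl_injective (congrArg Subtype.val h)))
    · exact (Sum.inl_ne_inr (congrArg Subtype.val h)).elim
    · exact (Sum.inr_ne_inl (congrArg Subtype.val h)).elim
    · exact congrArg Sum.inr (Subtype.ext (Sum.inr_injective (congrArg Subtype.val h)))
  · rintro ⟨y | y, h⟩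
    · exact ⟨Sum.inl ⟨y, fun a e => h (Sum.inl a) (congrArg Sum.inl e)⟩, rfl⟩
    · exact ⟨Sum.inr ⟨y, fun a e => h (Sum.inr a) (congrArg Sum.inr e)⟩, rfl⟩
  · rintro (y | y) <;> rfl

theorem aug_mul (P Q : Poly X) : GSetOver.Iso (P.mul Q).aug (P.aug.mul Q.aug) := by
  refine GSetOver.Iso.symm (⟨⟨fun w => ⟨⟨(w.1.1.1, w.1.2.1), w.2⟩, ?_⟩, fun _ _ => rfl⟩, ⟨?_, ?_⟩,
    fun _ => rfl⟩ : GSetOver.Iso (P.aug.mul Q.aug) (P.mul Q).aug)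
  · rintro (a | a) h
    · exact w.1.1.2 a.1.1 (congrArg (fun z => z.1.1) h)
    · exact w.1.2.2 a.1.2 (congrArg (fun z => z.1.2) h)
  · intro w w' h
    exact Subtype.ext (Prod.ext (Subtype.ext (congrArg (fun z => z.1.1.1) h))
      (Subtype.ext (congrArg (fun z => z.1.1.2) h)))
  · rintro ⟨⟨⟨y, z⟩, e⟩, h⟩
    refine ⟨⟨(⟨y, fun a ha => ?_⟩, ⟨z, fun a ha => ?_⟩), e⟩, rfl⟩
    · exact h (Sum.inl ⟨(a, z), (congrArg P.t ha).trans e⟩) (Subtype.ext (Prod.ext ha rfl))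
    · exact h (Sum.inr ⟨(y, a), e.trans (congrArg Q.t ha).symm⟩) (Subtype.ext (Prod.ext rfl ha))

theorem aug_res (f : X →[G] Y) (P : Poly Y) : GSetOver.Iso (P.res f).aug (P.aug.res f) := by
  refine GSetOver.Iso.symm (⟨⟨fun w => ⟨⟨(w.1.1.1, w.1.2), w.2⟩, ?_⟩, fun _ _ => rfl⟩, ⟨?_, ?_⟩,
    fun _ => rfl⟩ : GSetOver.Iso (P.aug.res f) (P.res f).aug)
  · intro a h
    exact w.1.1.2 a.1.1 (congrArg (fun z => z.1.1) h)
  · intro w w' h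
    exact Subtype.ext (Prod.ext (Subtype.ext (congrArg (fun z => z.1.1.1) h))
      (congrArg (fun z => z.1.1.2) h))
  · rintro ⟨⟨⟨y, z⟩, e⟩, h⟩
    refine ⟨⟨(⟨y, fun a ha => ?_⟩, z), e⟩, rfl⟩
    exact h ⟨(a, z), (congrArg P.t ha).trans e⟩ (Subtype.ext (Prod.ext ha rfl))

/-- The evaluation at `x = 0` on classes. -/
def augHom (X : FinGSet G) : (polySemiGreen G).obj X →+* (gsetSemiGreen G).obj X where
  toFun := Quotient.map aug fun _ _ h => aug_congr h
  map_zero' := Quotient.sound aug_zero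
  map_one' := Quotient.sound aug_one
  map_add' a b := Quotient.inductionOn₂ a b fun P Q => Quotient.sound (aug_add P Q)
  map_mul' a b := Quotient.inductionOn₂ a b fun P Q => Quotient.sound (aug_mul P Q)

end Poly

/-- The augmentation `x ↦ 0` from the free Green functor to the Burnside functor. -/
noncomputable def augmentation (G : Type u) [Group G] :
    GreenFunctor.Hom (freeGreen G) (burnside G) :=
  SemiGreenFunctor.completionHom Poly.augHom
    (fun f a => Quotient.inductionOn a fun P => Quotient.sound (Poly.aug_res f P))
    (fun _ a => Quotient.inductionOn a fun _ => rfl)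

theorem augmentation_gen (G : Type u) [Group G] :
    (augmentation G).app (FinGSet.pt G) (freeGreenGen G) = 0 := by
  refine (Completion.map_of _ _).trans (Eq.trans (congrArg _ ?_) (map_zero Completion.of))
  refine Quotient.sound ⟨⟨fun y => (y.2 y.1 rfl).elim, fun _ y => (y.2 y.1 rfl).elim⟩,
    ⟨fun y => (y.2 y.1 rfl).elim, fun y => isEmptyElim (α := FinGSet.empty G) y⟩,
    fun y => (y.2 y.1 rfl).elim⟩

/-- The Burnside functor as a module over the free Green functor, the generator acting by zero. -/
noncomputable def burnsideModule (G : Type u) [Group G] : GreenModule (freeGreen G) :=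
  (augmentation G).toModule

/-! ### The abelian category of modules over a Green functor -/

namespace GreenModule

open CategoryTheory CategoryTheory.Limits

variable {G : Type u} [Group G] {R : GreenFunctor G}

/-- A morphism of modules over a Green functor. -/
@[ext]
structure Hom (M N : GreenModule R) where
  app : ∀ X : FinGSet G, M.obj X →ₗ[R.obj X] N.obj X
  app_res : ∀ {X Y : FinGSet G} (f : X →[G] Y) (m : M.obj Y),
    app X (M.mackey.res f m) = N.mackey.res f (app Y m)
  app_tr : ∀ {X Y : FinGSet G} (f : X →[G] Y) (m : M.obj X),
    app Y (M.mackey.tr f m) = N.mackey.tr f (app X m)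

instance : Category.{u + 1} (GreenModule R) where
  Hom := Hom
  id M := ⟨fun _ => LinearMap.id, fun _ _ => rfl, fun _ _ => rfl⟩
  comp φ ψ := ⟨fun X => ψ.app X ∘ₗ φ.app X,
    fun f m => (congrArg (ψ.app _) (φ.app_res f m)).trans (ψ.app_res f _),
    fun f m => (congrArg (ψ.app _) (φ.app_tr f m)).trans (ψ.app_tr f _)⟩

variable {M N P : GreenModule R}

@[ext]
theorem hom_ext {φ ψ : M ⟶ N} (h : ∀ X m, φ.app X m = ψ.app X m) : φ = ψ :=
  Hom.ext (funext fun X => LinearMap.ext (h X))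

theorem id_app (X : FinGSet G) (m : M.obj X) : Hom.app (𝟙 M) X m = m := rfl

theorem comp_app (φ : M ⟶ N) (ψ : N ⟶ P) (X : FinGSet G) (m : M.obj X) :
    Hom.app (φ ≫ ψ) X m = ψ.app X (φ.app X m) := rfl

instance : Zero (M ⟶ N) := ⟨⟨fun _ => 0, fun f _ => (map_zero (N.mackey.res f)).symm,
  fun f _ => (map_zero (N.mackey.tr f)).symm⟩⟩

instance : Add (M ⟶ N) := ⟨fun φ ψ => ⟨fun X => φ.app X + ψ.app X,
  fun f m => by simp [φ.app_res, ψ.app_res], fun f m => by simp [φ.app_tr, ψ.app_tr]⟩⟩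

instance : Neg (M ⟶ N) := ⟨fun φ => ⟨fun X => -φ.app X,
  fun f m => by simp [φ.app_res], fun f m => by simp [φ.app_tr]⟩⟩

theorem zero_app (X : FinGSet G) (m : M.obj X) : Hom.app (0 : M ⟶ N) X m = 0 := rfl

theorem add_app (φ ψ : M ⟶ N) (X : FinGSet G) (m : M.obj X) :
    Hom.app (φ + ψ) X m = φ.app X m + ψ.app X m := rfl

theorem neg_app (φ : M ⟶ N) (X : FinGSet G) (m : M.obj X) : Hom.app (-φ) X m = -φ.app X m := rfl

instance : AddCommGroup (M ⟶ N) where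
  add_assoc _ _ _ := hom_ext fun _ _ => add_assoc _ _ _
  zero_add _ := hom_ext fun _ _ => zero_add _
  add_zero _ := hom_ext fun _ _ => add_zero _
  add_comm _ _ := hom_ext fun _ _ => add_comm _ _
  neg_add_cancel _ := hom_ext fun _ _ => neg_add_cancel _
  nsmul := nsmulRec
  zsmul := zsmulRec

instance : Preadditive (GreenModule R) where
  add_comp _ _ _ φ φ' ψ := hom_ext fun X m => map_add (ψ.app X) (φ.app X m) (φ'.app X m)
  comp_add _ _ _ _ _ _ := rfl

section sub

variable (S : ∀ X, Submodule (R.obj X) (M.obj X))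
  (hres : ∀ {X Y : FinGSet G} (f : X →[G] Y), ∀ m ∈ S Y, M.mackey.res f m ∈ S X)
  (htr : ∀ {X Y : FinGSet G} (f : X →[G] Y), ∀ m ∈ S X, M.mackey.tr f m ∈ S Y)

/-- A submodule of a module over a Green functor. -/
def sub : GreenModule R where
  obj X := S X
  mackey :=
    let res : ∀ {X Y : FinGSet G}, (X →[G] Y) → S Y →+ S X := fun {X Y} f =>
      { toFun := fun m => ⟨M.mackey.res f m.1, hres f m.1 m.2⟩
        map_zero' := Subtype.ext (map_zero (M.mackey.res f))
        map_add' := fun a b => Subtype.ext (map_add (M.mackey.res f) a.1 b.1) }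
    let tr : ∀ {X Y : FinGSet G}, (X →[G] Y) → S X →+ S Y := fun {X Y} f =>
      { toFun := fun m => ⟨M.mackey.tr f m.1, htr f m.1 m.2⟩
        map_zero' := Subtype.ext (map_zero (M.mackey.tr f))
        map_add' := fun a b => Subtype.ext (map_add (M.mackey.tr f) a.1 b.1) }
    { res := res
      tr := tr
      res_id := fun a => Subtype.ext (M.mackey.res_id a.1)
      res_comp := fun f g a => Subtype.ext (M.mackey.res_comp f g a.1)
      tr_id := fun a => Subtype.ext (M.mackey.tr_id a.1)
      tr_comp := fun f g a => Subtype.ext (M.mackey.tr_comp f g a.1)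
      base_change := fun h a => Subtype.ext (M.mackey.base_change h a.1)
      empty := fun X hX => ⟨fun a b => Subtype.ext ((M.mackey.empty X hX).elim a.1 b.1)⟩
      sum := fun X Y => MackeyStr.bijective_of_sum res tr
        (fun a => Subtype.ext (M.mackey.res_id a.1)) (fun a => Subtype.ext (M.mackey.tr_id a.1))
        (fun h a => Subtype.ext (M.mackey.base_change h a.1))
        (fun X hX => ⟨fun a b => Subtype.ext ((M.mackey.empty X hX).elim a.1 b.1)⟩) X Y
        (fun a => Subtype.ext (M.mackey.sum_eq X Y a.1)) }
  res_smul f r m := Subtype.ext (M.res_smul f r m.1)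
  smul_tr f r m := Subtype.ext (M.smul_tr f r m.1)
  tr_smul f r m := Subtype.ext (M.tr_smul f r m.1)

/-- The quotient of a module over a Green functor by a submodule. -/
def quot : GreenModule R where
  obj X := M.obj X ⧸ S X
  mackey :=
    let res : ∀ {X Y : FinGSet G}, (X →[G] Y) → (M.obj Y ⧸ S Y) →+ (M.obj X ⧸ S X) :=
      fun {X Y} f => QuotientAddGroup.lift (S Y).toAddSubgroup
        ((S X).mkQ.toAddMonoidHom.comp (M.mackey.res f)) fun m hm =>
          (Submodule.Quotient.mk_eq_zero (S X)).2 (hres f m hm)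
    let tr : ∀ {X Y : FinGSet G}, (X →[G] Y) → (M.obj X ⧸ S X) →+ (M.obj Y ⧸ S Y) :=
      fun {X Y} f => QuotientAddGroup.lift (S X).toAddSubgroup
        ((S Y).mkQ.toAddMonoidHom.comp (M.mackey.tr f)) fun m hm =>
          (Submodule.Quotient.mk_eq_zero (S Y)).2 (htr f m hm)
    have res_id : ∀ {X : FinGSet G} (a : M.obj X ⧸ S X), res (MulActionHom.id G) a = a :=
      fun {X} a => Submodule.Quotient.induction_on (S X) a fun m =>
        congrArg (S X).mkQ (M.mackey.res_id m)
    have tr_id : ∀ {X : FinGSet G} (a : M.obj X ⧸ S X), tr (MulActionHom.id G) a = a :=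
      fun {X} a => Submodule.Quotient.induction_on (S X) a fun m =>
        congrArg (S X).mkQ (M.mackey.tr_id m)
    have base_change : ∀ {P X Y Z : FinGSet G} {p : P →[G] X} {q : P →[G] Y} {f : X →[G] Z}
        {g : Y →[G] Z}, IsCartesian p q f g → ∀ a : M.obj X ⧸ S X,
        res g (tr f a) = tr q (res p a) :=
      fun {P X Y Z p q f g} h a => Submodule.Quotient.induction_on (S X) a fun m =>
        congrArg (S Y).mkQ (M.mackey.base_change h m)
    have empty : ∀ X : FinGSet G, IsEmpty X → Subsingleton (M.obj X ⧸ S X) := fun X hX =>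
      haveI := M.mackey.empty X hX
      (Submodule.mkQ_surjective (S X)).subsingleton
    { res := res
      tr := tr
      res_id := res_id
      res_comp := fun {X Y Z} f g a => Submodule.Quotient.induction_on (S Z) a fun m =>
        congrArg (S X).mkQ (M.mackey.res_comp f g m)
      tr_id := tr_id
      tr_comp := fun {X Y Z} f g a => Submodule.Quotient.induction_on (S X) a fun m =>
        congrArg (S Z).mkQ (M.mackey.tr_comp f g m)
      base_change := base_change
      empty := empty
      sum := fun X Y => MackeyStr.bijective_of_sum res tr res_id tr_id base_change empty X Y
        (fun a => Submodule.Quotient.induction_on (S (X.sum Y)) a fun m =>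
          congrArg (S (X.sum Y)).mkQ (M.mackey.sum_eq X Y m)) }
  res_smul {X Y} f r a := Submodule.Quotient.induction_on (S Y) a fun m =>
    congrArg (S X).mkQ (M.res_smul f r m)
  smul_tr {X Y} f r a := Submodule.Quotient.induction_on (S X) a fun m =>
    congrArg (S Y).mkQ (M.smul_tr f r m)
  tr_smul {X Y} f r a := Submodule.Quotient.induction_on (S Y) a fun m =>
    congrArg (S Y).mkQ (M.tr_smul f r m)

end sub

/-- The kernel of a morphism. -/
def ker (φ : M ⟶ N) : GreenModule R :=
  sub (fun X => LinearMap.ker (φ.app X))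
    (fun f m hm => by rw [LinearMap.mem_ker] at hm ⊢; rw [φ.app_res, hm, map_zero])
    (fun f m hm => by rw [LinearMap.mem_ker] at hm ⊢; rw [φ.app_tr, hm, map_zero])

/-- The inclusion of the kernel. -/
def kerι (φ : M ⟶ N) : ker φ ⟶ M :=
  ⟨fun X => (LinearMap.ker (φ.app X)).subtype, fun _ _ => rfl, fun _ _ => rfl⟩

theorem kerι_comp (φ : M ⟶ N) : kerι φ ≫ φ = 0 := hom_ext fun _ m => m.2

/-- The cokernel of a morphism. -/
def coker (φ : M ⟶ N) : GreenModule R :=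
  quot (fun X => LinearMap.range (φ.app X))
    (by rintro X Y f _ ⟨m, rfl⟩; exact ⟨_, φ.app_res f m⟩)
    (by rintro X Y f _ ⟨m, rfl⟩; exact ⟨_, φ.app_tr f m⟩)

/-- The projection to the cokernel. -/
def cokerπ (φ : M ⟶ N) : N ⟶ coker φ :=
  ⟨fun X => (LinearMap.range (φ.app X)).mkQ, fun _ _ => rfl, fun _ _ => rfl⟩

theorem comp_cokerπ (φ : M ⟶ N) : φ ≫ cokerπ φ = 0 :=
  hom_ext fun X m => (Submodule.Quotient.mk_eq_zero _).2 ⟨m, rfl⟩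

theorem injective_of_mono (φ : M ⟶ N) [Mono φ] (X : FinGSet G) :
    Function.Injective (φ.app X) := by
  have h : kerι φ = 0 := (cancel_mono φ).1 ((kerι_comp φ).trans zero_comp.symm)
  rw [injective_iff_map_eq_zero]
  intro m hm
  exact congrArg (fun ψ : ker φ ⟶ M => ψ.app X ⟨m, hm⟩) h

theorem surjective_of_epi (φ : M ⟶ N) [Epi φ] (X : FinGSet G) :
    Function.Surjective (φ.app X) := by
  have h : cokerπ φ = 0 := (cancel_epi φ).1 ((comp_cokerπ φ).trans comp_zero.symm)
  intro n
  exact (Submodule.Quotient.mk_eq_zero (LinearMap.range (φ.app X))).1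
    (congrArg (fun ψ : N ⟶ coker φ => ψ.app X n) h)

/-- Factorisation through a levelwise injective morphism. -/
noncomputable def liftOfInjective (φ : M ⟶ N) (hφ : ∀ X, Function.Injective (φ.app X)) (k : P ⟶ N)
    (hk : ∀ X m, k.app X m ∈ LinearMap.range (φ.app X)) : {l : P ⟶ M // l ≫ φ = k} :=
  let e := fun X => LinearEquiv.ofInjective (φ.app X) (hφ X)
  let l : ∀ X, P.obj X →ₗ[R.obj X] M.obj X := fun X =>
    (e X).symm.toLinearMap ∘ₗ (k.app X).codRestrict _ (hk X)
  have hl : ∀ X p, φ.app X (l X p) = k.app X p := fun X p =>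
    congrArg Subtype.val ((e X).apply_symm_apply ⟨k.app X p, hk X p⟩)
  ⟨⟨l, fun {X Y} f p => hφ X ((hl X _).trans ((k.app_res f p).trans
      ((φ.app_res f _).trans (congrArg _ (hl Y p))).symm)),
    fun {X Y} f p => hφ Y ((hl Y _).trans ((k.app_tr f p).trans
      ((φ.app_tr f _).trans (congrArg _ (hl X p))).symm))⟩, hom_ext hl⟩

/-- Factorisation through a levelwise surjective morphism. -/
noncomputable def descOfSurjective (φ : M ⟶ N) (hφ : ∀ X, Function.Surjective (φ.app X))
    (k : M ⟶ P) (hk : ∀ X m, φ.app X m = 0 → k.app X m = 0) : {l : N ⟶ P // φ ≫ l = k} :=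
  let e := fun X => (φ.app X).quotKerEquivOfSurjective (hφ X)
  let l : ∀ X, N.obj X →ₗ[R.obj X] P.obj X := fun X =>
    (LinearMap.ker (φ.app X)).liftQ (k.app X) (hk X) ∘ₗ (e X).symm.toLinearMap
  have hl : ∀ X m, l X (φ.app X m) = k.app X m := fun X m => by
    have : (e X).symm (φ.app X m) = (LinearMap.ker (φ.app X)).mkQ m :=
      (e X).symm_apply_eq.2 rfl
    simp only [l, LinearMap.comp_apply, LinearEquiv.coe_coe, this]
    exact (LinearMap.ker (φ.app X)).liftQ_apply (k.app X) m
  ⟨⟨l, fun {X Y} f n => by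
      obtain ⟨m, rfl⟩ := hφ Y n
      rw [← φ.app_res, hl, hl, k.app_res], fun {X Y} f n => by
      obtain ⟨m, rfl⟩ := hφ X n
      rw [← φ.app_tr, hl, hl, k.app_tr]⟩, hom_ext hl⟩

theorem mono_of_injective (φ : M ⟶ N) (h : ∀ X, Function.Injective (φ.app X)) : Mono φ :=
  ⟨fun a b hab => hom_ext fun X m => h X (congrArg (fun ψ : _ ⟶ N => ψ.app X m) hab)⟩

theorem epi_of_surjective (φ : M ⟶ N) (h : ∀ X, Function.Surjective (φ.app X)) : Epi φ :=
  ⟨fun a b hab => hom_ext fun X n => by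
    obtain ⟨m, rfl⟩ := h X n
    exact congrArg (fun ψ : M ⟶ _ => ψ.app X m) hab⟩

instance (φ : M ⟶ N) : Mono (kerι φ) := mono_of_injective _ fun _ => Subtype.val_injective

instance (φ : M ⟶ N) : Epi (cokerπ φ) := epi_of_surjective _ fun _ => Submodule.mkQ_surjective _

instance : HasKernels (GreenModule R) where
  has_limit {M N} φ := ⟨⟨⟨KernelFork.ofι (kerι φ) (kerι_comp φ),
    KernelFork.IsLimit.ofι' _ _ fun {P} k hk =>
      liftOfInjective (kerι φ) (fun _ => Subtype.val_injective) k fun X p =>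
        ⟨⟨k.app X p, congrArg (fun ψ : P ⟶ N => ψ.app X p) hk⟩, rfl⟩⟩⟩⟩

instance : HasCokernels (GreenModule R) where
  has_colimit {M N} φ := ⟨⟨⟨CokernelCofork.ofπ (cokerπ φ) (comp_cokerπ φ),
    CokernelCofork.IsColimit.ofπ' _ _ fun {P} k hk =>
      descOfSurjective (cokerπ φ) (fun _ => Submodule.mkQ_surjective _) k fun X n hn => by
        obtain ⟨m, rfl⟩ := (Submodule.Quotient.mk_eq_zero _).1 hn
        exact congrArg (fun ψ : M ⟶ P => ψ.app X m) hk⟩⟩⟩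

instance : IsNormalMonoCategory (GreenModule R) where
  normalMonoOfMono {M N} φ _ := ⟨
    { Z := coker φ
      g := cokerπ φ
      w := comp_cokerπ φ
      isLimit := KernelFork.IsLimit.ofι' _ _ fun {P} k hk =>
        liftOfInjective φ (injective_of_mono φ) k fun X p =>
          (Submodule.Quotient.mk_eq_zero _).1
            (congrArg (fun ψ : P ⟶ coker φ => ψ.app X p) hk) }⟩

instance : IsNormalEpiCategory (GreenModule R) where
  normalEpiOfEpi {M N} φ _ := ⟨
    { W := ker φ
      g := kerι φ
      w := kerι_comp φ
      isColimit := CokernelCofork.IsColimit.ofπ' _ _ fun {P} k hk =>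
        descOfSurjective φ (surjective_of_epi φ) k fun X m hm =>
          congrArg (fun ψ : ker φ ⟶ P => ψ.app X ⟨m, hm⟩) hk }⟩

section directSum

variable {ι : Type (u + 1)} (F : ι → GreenModule R)

open scoped DirectSum

/-- The direct sum of a family of modules over a Green functor. -/
noncomputable def directSum : GreenModule R where
  obj X := ⨁ i, (F i).obj X
  mackey :=
    let res : ∀ {X Y : FinGSet G}, (X →[G] Y) → (⨁ i, (F i).obj Y) →+ ⨁ i, (F i).obj X :=
      fun f => DirectSum.map fun i => (F i).mackey.res f
    let tr : ∀ {X Y : FinGSet G}, (X →[G] Y) → (⨁ i, (F i).obj X) →+ ⨁ i, (F i).obj Y :=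
      fun f => DirectSum.map fun i => (F i).mackey.tr f
    have res_id : ∀ {X : FinGSet G} (a : ⨁ i, (F i).obj X), res (MulActionHom.id G) a = a :=
      fun a => DFinsupp.ext fun i => (F i).mackey.res_id (a i)
    have tr_id : ∀ {X : FinGSet G} (a : ⨁ i, (F i).obj X), tr (MulActionHom.id G) a = a :=
      fun a => DFinsupp.ext fun i => (F i).mackey.tr_id (a i)
    have base_change : ∀ {P X Y Z : FinGSet G} {p : P →[G] X} {q : P →[G] Y} {f : X →[G] Z}
        {g : Y →[G] Z}, IsCartesian p q f g → ∀ a : ⨁ i, (F i).obj X,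
        res g (tr f a) = tr q (res p a) :=
      fun h a => DFinsupp.ext fun i => (F i).mackey.base_change h (a i)
    have empty : ∀ X : FinGSet G, IsEmpty X → Subsingleton (⨁ i, (F i).obj X) :=
      fun X hX => ⟨fun a b => DFinsupp.ext fun i => ((F i).mackey.empty X hX).elim (a i) (b i)⟩
    { res := res
      tr := tr
      res_id := res_id
      res_comp := fun f g a => DFinsupp.ext fun i => (F i).mackey.res_comp f g (a i)
      tr_id := tr_id
      tr_comp := fun f g a => DFinsupp.ext fun i => (F i).mackey.tr_comp f g (a i)
      base_change := base_change
      empty := empty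
      sum := fun X Y => MackeyStr.bijective_of_sum res tr res_id tr_id base_change empty X Y
        fun a => DFinsupp.ext fun i => (F i).mackey.sum_eq X Y (a i) }
  res_smul f r a := DFinsupp.ext fun i => (F i).res_smul f r (a i)
  smul_tr f r a := DFinsupp.ext fun i => (F i).smul_tr f r (a i)
  tr_smul f r a := DFinsupp.ext fun i => (F i).tr_smul f r (a i)

open Classical in
/-- The inclusion of a summand. -/
noncomputable def directSumι (i : ι) : F i ⟶ directSum F where
  app X := DirectSum.lof (R.obj X) ι (fun i => (F i).obj X) i
  app_res {X Y} f m := (DirectSum.map_of (fun i => (F i).mackey.res f) i m).symm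
  app_tr {X Y} f m := (DirectSum.map_of (fun i => (F i).mackey.tr f) i m).symm

variable {F}

open Classical in
theorem directSum_hom_ext {φ ψ : directSum F ⟶ M}
    (h : ∀ i, directSumι F i ≫ φ = directSumι F i ≫ ψ) : φ = ψ :=
  Hom.ext (funext fun X => DirectSum.linearMap_ext (R.obj X) fun i =>
    LinearMap.ext fun m => congrArg (fun χ : F i ⟶ M => χ.app X m) (h i))

open Classical in
/-- The levels of a morphism out of a direct sum. -/
noncomputable def directSumDescApp (φ : ∀ i, F i ⟶ M) (X : FinGSet G) :
    (⨁ i, (F i).obj X) →ₗ[R.obj X] M.obj X :=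
  DirectSum.toModule (R.obj X) ι (M.obj X) fun i => (φ i).app X

open Classical in
theorem directSumDescApp_of (φ : ∀ i, F i ⟶ M) (X : FinGSet G) (i : ι) (m : (F i).obj X) :
    directSumDescApp φ X (DirectSum.of (fun i => (F i).obj X) i m) = (φ i).app X m :=
  DirectSum.toModule_lof (φ := fun i => (φ i).app X) (R.obj X) i m

/-- The morphism out of a direct sum given by morphisms out of the summands. -/
noncomputable def directSumDesc (φ : ∀ i, F i ⟶ M) : directSum F ⟶ M where
  app X := directSumDescApp φ X
  app_res {X Y} f := DFunLike.congr_fun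
    (show (directSumDescApp φ X).toAddMonoidHom.comp (DirectSum.map fun i => (F i).mackey.res f) =
        (M.mackey.res f).comp (directSumDescApp φ Y).toAddMonoidHom by
      classical
      refine DirectSum.addHom_ext fun i m => ?_
      rw [AddMonoidHom.comp_apply, DirectSum.map_of]
      exact (directSumDescApp_of φ X i _).trans (((φ i).app_res f m).trans
        (congrArg _ (directSumDescApp_of φ Y i m)).symm))
  app_tr {X Y} f := DFunLike.congr_fun
    (show (directSumDescApp φ Y).toAddMonoidHom.comp (DirectSum.map fun i => (F i).mackey.tr f) =
        (M.mackey.tr f).comp (directSumDescApp φ X).toAddMonoidHom by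
      classical
      refine DirectSum.addHom_ext fun i m => ?_
      rw [AddMonoidHom.comp_apply, DirectSum.map_of]
      exact (directSumDescApp_of φ Y i _).trans (((φ i).app_tr f m).trans
        (congrArg _ (directSumDescApp_of φ X i m)).symm))

theorem directSumι_desc (φ : ∀ i, F i ⟶ M) (i : ι) : directSumι F i ≫ directSumDesc φ = φ i :=
  hom_ext fun X m => directSumDescApp_of φ X i m

end directSum

instance : HasCoproducts.{u + 1} (GreenModule R) :=
  hasCoproducts_of_colimit_cofans (fun F => Cofan.mk (directSum F) (directSumι F)) fun F =>
    Cofan.IsColimit.mk _ (fun s => directSumDesc s.inj) (fun s i => directSumι_desc _ i)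
      (fun s m h => directSum_hom_ext fun i => (h i).trans (directSumι_desc _ i).symm)

noncomputable instance : Abelian (GreenModule R) :=
  haveI : HasFiniteCoproducts (GreenModule R) := hasFiniteCoproducts_of_hasCoproducts.{u + 1} _
  haveI : HasFiniteBiproducts (GreenModule R) := HasFiniteBiproducts.of_hasFiniteCoproducts
  {}

end GreenModule

namespace GreenModule

open CategoryTheory CategoryTheory.Limits FinGSet

variable {G : Type u} [Group G] {R : GreenFunctor G}

theorem cart_prodMap (U : FinGSet G) {P X Y Z : FinGSet G} {p : P →[G] X} {q : P →[G] Y}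
    {f : X →[G] Z} {g : Y →[G] Z} (h : IsCartesian p q f g) :
    IsCartesian (prodMap U p) (prodMap U q) (prodMap U f) (prodMap U g) :=
  ⟨fun w => Prod.ext rfl (h.comm w.2), fun x y hxy => by
    obtain ⟨w, ⟨h1, h2⟩, hu⟩ := h.lift x.2 y.2 (congrArg Prod.snd hxy)
    have e : x.1 = y.1 := congrArg Prod.fst hxy
    refine ⟨(x.1, w), ⟨Prod.ext rfl h1, Prod.ext e h2⟩, fun v hv => Prod.ext ?_ ?_⟩
    · have h3 := congrArg Prod.fst hv.1
      exact h3
    · exact hu v.2 ⟨congrArg Prod.snd hv.1, congrArg Prod.snd hv.2⟩⟩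

theorem cart_snd (U : FinGSet G) {X Y : FinGSet G} (f : X →[G] Y) :
    IsCartesian (snd U X) (prodMap U f) f (snd U Y) :=
  ⟨fun _ => rfl, fun x y h => ⟨(y.1, x), ⟨rfl, Prod.ext rfl h⟩,
    fun _ hv => by
      have h1 := congrArg Prod.fst hv.2
      exact Prod.ext h1 hv.1⟩⟩

theorem bijective_prodMap_sum (U X Y : FinGSet G) :
    Function.Bijective (sumElim (prodMap U (inl X Y)) (prodMap U (inr X Y))) := by
  constructor
  · rintro (a | a) (b | b) h
    · have h1 := congrArg Prod.fst h
      have h2 := Sum.inl_injective (congrArg Prod.snd h)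
      exact congrArg Sum.inl (Prod.ext h1 h2)
    · exact (Sum.inl_ne_inr (congrArg Prod.snd h)).elim
    · exact (Sum.inr_ne_inl (congrArg Prod.snd h)).elim
    · have h1 := congrArg Prod.fst h
      have h2 := Sum.inr_injective (congrArg Prod.snd h)
      exact congrArg Sum.inr (Prod.ext h1 h2)
  · rintro ⟨a, b | b⟩
    exacts [⟨Sum.inl (a, b), rfl⟩, ⟨Sum.inr (a, b), rfl⟩]

variable (R) in
/-- The restrictions of a Green functor as ring homomorphisms. -/
def resHom {X Y : FinGSet G} (f : X →[G] Y) : R.obj Y →+* R.obj X :=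
  { R.mackey.res f with
    map_one' := R.res_one f
    map_mul' := R.res_mul f }

variable (R) in
/-- The free `R`-module on a generator at level `U`, whose value at `X` is `R(U × X)`. -/
def free (U : FinGSet G) : GreenModule R where
  obj X := R.obj (U.prod X)
  module X := Module.compHom (R.obj (U.prod X)) (resHom R (snd U X))
  mackey :=
    { res := fun f => R.mackey.res (prodMap U f)
      tr := fun f => R.mackey.tr (prodMap U f)
      res_id := R.mackey.res_id
      res_comp := fun f g => R.mackey.res_comp (prodMap U f) (prodMap U g)
      tr_id := R.mackey.tr_id
      tr_comp := fun f g => R.mackey.tr_comp (prodMap U f) (prodMap U g)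
      base_change := fun h => R.mackey.base_change (cart_prodMap U h)
      empty := fun _ hX => R.mackey.empty _ ⟨fun w => hX.false w.2⟩
      sum := fun X Y => MackeyStr.bijective_of_sum (M := fun X => R.obj (U.prod X))
        (fun f => R.mackey.res (prodMap U f)) (fun f => R.mackey.tr (prodMap U f))
        R.mackey.res_id R.mackey.tr_id (fun h => R.mackey.base_change (cart_prodMap U h))
        (fun _ hX => R.mackey.empty _ ⟨fun w => hX.false w.2⟩) X Y
        (R.mackey.sum_eq_of_bijective _ _ (bijective_prodMap_sum U X Y)) }
  res_smul {X Y} f r m := by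
    change R.mackey.res (prodMap U f) (R.mackey.res (snd U Y) r * m) =
      R.mackey.res (snd U X) (R.mackey.res f r) * R.mackey.res (prodMap U f) m
    rw [R.res_mul, ← R.mackey.res_comp, ← R.mackey.res_comp]
    rfl
  smul_tr {X Y} f r m := by
    change R.mackey.res (snd U Y) r * R.mackey.tr (prodMap U f) m =
      R.mackey.tr (prodMap U f) (R.mackey.res (snd U X) (R.mackey.res f r) * m)
    rw [R.frobenius, ← R.mackey.res_comp, ← R.mackey.res_comp]
    rfl
  tr_smul {X Y} f r m := by
    change R.mackey.res (snd U Y) (R.mackey.tr f r) * m =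
      R.mackey.tr (prodMap U f) (R.mackey.res (snd U X) r * R.mackey.res (prodMap U f) m)
    rw [R.mackey.base_change (cart_snd U f), mul_comm, R.frobenius, mul_comm]

/-- The generator of the free module: the transfer of `1` along the diagonal. -/
def gen (U : FinGSet G) : (free R U).obj U :=
  R.mackey.tr (prodLift (MulActionHom.id G) (MulActionHom.id G)) (1 : R.obj U)

variable {M N : GreenModule R}

/-- The morphism from a free module determined by the image of the generator. -/
def freeDesc {U : FinGSet G} (m : M.obj U) : free R U ⟶ M where
  app X :=
    { toFun := fun a : R.obj (U.prod X) => M.mackey.tr (snd U X) (a • M.mackey.res (fst U X) m)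
      map_add' := fun a b => by
        rw [← map_add]
        exact congrArg _ (add_smul (R := R.obj (U.prod X)) a b _)
      map_smul' := fun r a => by
        rw [RingHom.id_apply, M.smul_tr]
        exact congrArg _ (mul_smul (α := R.obj (U.prod X)) _ _ _) }
  app_res := fun {X Y} f (a : R.obj (U.prod Y)) => by
    change M.mackey.tr (snd U X) (R.mackey.res (prodMap U f) a • M.mackey.res (fst U X) m) =
      M.mackey.res f (M.mackey.tr (snd U Y) (a • M.mackey.res (fst U Y) m))
    rw [M.mackey.base_change (MackeyStr.cart_symm (cart_snd U f)), M.res_smul,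
      ← M.mackey.res_comp]
    rfl
  app_tr := fun {X Y} f (a : R.obj (U.prod X)) => by
    change M.mackey.tr (snd U Y) (R.mackey.tr (prodMap U f) a • M.mackey.res (fst U Y) m) =
      M.mackey.tr f (M.mackey.tr (snd U X) (a • M.mackey.res (fst U X) m))
    rw [M.tr_smul, ← M.mackey.res_comp, ← M.mackey.tr_comp, ← M.mackey.tr_comp]
    rfl

theorem freeDesc_app {U : FinGSet G} (m : M.obj U) (X : FinGSet G) (a : R.obj (U.prod X)) :
    Hom.app (freeDesc m) X a = M.mackey.tr (snd U X) (a • M.mackey.res (fst U X) m) := rfl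

theorem freeDesc_gen {U : FinGSet G} (m : M.obj U) : Hom.app (freeDesc m) U (gen U) = m := by
  refine (freeDesc_app m U _).trans ?_
  unfold gen
  rw [M.tr_smul, one_smul, ← M.mackey.tr_comp, ← M.mackey.res_comp]
  exact (M.mackey.tr_id _).trans (M.mackey.res_id _)

theorem eq_tr_smul_gen {U X : FinGSet G} (a : R.obj (U.prod X)) :
    (free R U).mackey.tr (snd U X) (a • (free R U).mackey.res (fst U X) (gen U)) = a := by
  have hc : IsCartesian (fst U X) (prodLift (fst U X) (MulActionHom.id G))
      (prodLift (MulActionHom.id G) (MulActionHom.id G)) (prodMap U (fst U X)) :=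
    ⟨fun _ => rfl, fun x y h => by
      have h1 : x = y.1 := congrArg Prod.fst h
      have h2 : x = y.2.1 := congrArg Prod.snd h
      exact ⟨y.2, ⟨h2.symm, Prod.ext (h2.symm.trans h1) rfl⟩,
        fun v hv => congrArg Prod.snd hv.2⟩⟩
  have h1 : (free R U).mackey.res (fst U X) (gen U) =
      R.mackey.tr (prodLift (fst U X) (MulActionHom.id G)) (1 : R.obj (U.prod X)) :=
    (R.mackey.base_change hc 1).trans (congrArg _ (R.res_one _))
  rw [h1]
  change R.mackey.tr (prodMap U (snd U X)) (R.mackey.res (snd U (U.prod X)) a *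
    R.mackey.tr (prodLift (fst U X) (MulActionHom.id G)) 1) = a
  rw [R.frobenius, mul_one, ← R.mackey.tr_comp, ← R.mackey.res_comp]
  exact (R.mackey.tr_id _).trans (R.mackey.res_id _)

theorem freeDesc_comp_eq {U : FinGSet G} (m : M.obj U) (e : M ⟶ N) (f : free R U ⟶ N)
    (h : e.app U m = f.app U (gen U)) : freeDesc m ≫ e = f :=
  hom_ext fun X (a : R.obj (U.prod X)) => by
    refine Eq.trans ?_ (congrArg (f.app X) (eq_tr_smul_gen (R := R) (U := U) (X := X) a))
    have hs : f.app (U.prod X) (a • (free R U).mackey.res (fst U X) (gen U)) =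
        a • f.app (U.prod X) ((free R U).mackey.res (fst U X) (gen U)) := map_smul _ _ _
    change e.app X (M.mackey.tr (snd U X) (a • M.mackey.res (fst U X) m)) = _
    rw [e.app_tr, map_smul, e.app_res, h, ← f.app_res, ← hs, ← f.app_tr]

theorem projective_directSum_free {ι : Type (u + 1)} (U : ι → FinGSet G) :
    Projective (directSum fun i => free R (U i)) where
  factors {E N} f e _ := by
    choose m hm using fun i => surjective_of_epi e (U i)
      ((directSumι (fun i => free R (U i)) i ≫ f).app (U i) (gen (U i)))
    refine ⟨directSumDesc fun i => freeDesc (m i), directSum_hom_ext fun i => ?_⟩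
    rw [← Category.assoc, directSumι_desc]
    exact freeDesc_comp_eq (m i) e _ (hm i)

instance : EnoughProjectives (GreenModule R) where
  presentation M := ⟨
    { p := directSum fun i : Σ U : FinGSet G, M.obj U => free R i.1
      projective := projective_directSum_free _
      f := directSumDesc fun i => freeDesc i.2
      epi := epi_of_surjective _ fun X m =>
        ⟨(directSumι (fun i : Σ U : FinGSet G, M.obj U => free R i.1) ⟨X, m⟩).app X (gen X), by
          rw [← comp_app, directSumι_desc]
          exact freeDesc_gen m⟩ }⟩

end GreenModule

/-! ### The relative box product and Tor -/

namespace GreenModule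

open CategoryTheory CategoryTheory.Limits FinGSet

variable {G : Type u} [Group G] {R : GreenFunctor G}

/-- The generators `[f, m, n]` of the level `X` of the box product of `M` and `N`:
a map `f : Y → X` of finite `G`-sets and elements `m ∈ M(Y)`, `n ∈ N(Y)`. -/
structure BoxGen (M N : GreenModule R) (X : FinGSet G) where
  Y : FinGSet G
  f : Y →[G] X
  m : M.obj Y
  n : N.obj Y

/-- The relations of the level `X` of the box product over `R`: biadditivity, Frobenius relations
for both factors (these define the box product of Mackey functors), and `R`-balancedness. -/
inductive BoxRel (M N : GreenModule R) (X : FinGSet G) : FreeAbelianGroup (BoxGen M N X) → Prop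
  | add_left (Y : FinGSet G) (f : Y →[G] X) (m m' : M.obj Y) (n : N.obj Y) :
      BoxRel M N X (FreeAbelianGroup.of ⟨Y, f, m + m', n⟩ -
        (FreeAbelianGroup.of ⟨Y, f, m, n⟩ + FreeAbelianGroup.of ⟨Y, f, m', n⟩))
  | add_right (Y : FinGSet G) (f : Y →[G] X) (m : M.obj Y) (n n' : N.obj Y) :
      BoxRel M N X (FreeAbelianGroup.of ⟨Y, f, m, n + n'⟩ -
        (FreeAbelianGroup.of ⟨Y, f, m, n⟩ + FreeAbelianGroup.of ⟨Y, f, m, n'⟩))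
  | tr_left (Y Z : FinGSet G) (h : Z →[G] Y) (f : Y →[G] X) (m : M.obj Z) (n : N.obj Y) :
      BoxRel M N X (FreeAbelianGroup.of ⟨Y, f, M.mackey.tr h m, n⟩ -
        FreeAbelianGroup.of ⟨Z, f.comp h, m, N.mackey.res h n⟩)
  | tr_right (Y Z : FinGSet G) (h : Z →[G] Y) (f : Y →[G] X) (m : M.obj Y) (n : N.obj Z) :
      BoxRel M N X (FreeAbelianGroup.of ⟨Y, f, m, N.mackey.tr h n⟩ -
        FreeAbelianGroup.of ⟨Z, f.comp h, M.mackey.res h m, n⟩)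
  | balanced (Y : FinGSet G) (f : Y →[G] X) (r : R.obj Y) (m : M.obj Y) (n : N.obj Y) :
      BoxRel M N X (FreeAbelianGroup.of ⟨Y, f, r • m, n⟩ - FreeAbelianGroup.of ⟨Y, f, m, r • n⟩)

/-- The level `X` of the box product of `M` and `N` over `R`. -/
def BoxObj (M N : GreenModule R) (X : FinGSet G) : Type (u + 1) :=
  FreeAbelianGroup (BoxGen M N X) ⧸ AddSubgroup.closure {a | BoxRel M N X a}

namespace BoxObj

instance (M N : GreenModule R) (X : FinGSet G) : AddCommGroup (BoxObj M N X) :=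
  inferInstanceAs (AddCommGroup
    (FreeAbelianGroup (BoxGen M N X) ⧸ AddSubgroup.closure {a | BoxRel M N X a}))

variable {M N P : GreenModule R} {X Y Z : FinGSet G}

/-- The class of a generator. -/
def mk (f : Y →[G] X) (m : M.obj Y) (n : N.obj Y) : BoxObj M N X :=
  QuotientAddGroup.mk (FreeAbelianGroup.of ⟨Y, f, m, n⟩)

theorem eq_of_rel {a b : FreeAbelianGroup (BoxGen M N X)} (h : BoxRel M N X (a - b)) :
    (QuotientAddGroup.mk a : BoxObj M N X) = QuotientAddGroup.mk b :=
  (QuotientAddGroup.eq_iff_sub_mem).2 (AddSubgroup.subset_closure h)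

theorem mk_add_left (f : Y →[G] X) (m m' : M.obj Y) (n : N.obj Y) :
    mk f (m + m') n = mk f m n + mk f m' n := eq_of_rel (.add_left Y f m m' n)

theorem mk_add_right (f : Y →[G] X) (m : M.obj Y) (n n' : N.obj Y) :
    mk f m (n + n') = mk f m n + mk f m n' := eq_of_rel (.add_right Y f m n n')

theorem mk_tr_left (h : Z →[G] Y) (f : Y →[G] X) (m : M.obj Z) (n : N.obj Y) :
    mk f (M.mackey.tr h m) n = mk (f.comp h) m (N.mackey.res h n) :=
  eq_of_rel (.tr_left Y Z h f m n)

theorem mk_tr_right (h : Z →[G] Y) (f : Y →[G] X) (m : M.obj Y) (n : N.obj Z) :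
    mk f m (N.mackey.tr h n) = mk (f.comp h) (M.mackey.res h m) n :=
  eq_of_rel (.tr_right Y Z h f m n)

theorem mk_balanced (f : Y →[G] X) (r : R.obj Y) (m : M.obj Y) (n : N.obj Y) :
    mk f (r • m) n = mk f m (r • n) := eq_of_rel (.balanced Y f r m n)

theorem mk_zero_left (f : Y →[G] X) (n : N.obj Y) : mk f (0 : M.obj Y) n = 0 := by
  have := mk_add_left f (0 : M.obj Y) 0 n
  rwa [add_zero, left_eq_add] at this

/-- The generators can be transported along isomorphisms. -/
theorem mk_bijective (e : Z →[G] Y) (he : Function.Bijective e) (f : Y →[G] X) (m : M.obj Y)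
    (n : N.obj Y) : mk (f.comp e) (M.mackey.res e m) (N.mackey.res e n) = mk f m n := by
  rw [← mk_tr_left, M.mackey.tr_res_of_bijective e he]

theorem hom_ext {A : Type*} [AddCommGroup A] {φ ψ : BoxObj M N X →+ A}
    (h : ∀ (Y : FinGSet G) (f : Y →[G] X) (m : M.obj Y) (n : N.obj Y),
      φ (mk f m n) = ψ (mk f m n)) : φ = ψ := by
  refine QuotientAddGroup.addMonoidHom_ext _ (FreeAbelianGroup.lift_ext _ _ fun g => ?_)
  exact h g.Y g.f g.m g.n

/-- Maps out of the box product are given by maps on generators respecting the relations. -/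
def lift {A : Type*} [AddCommGroup A]
    (φ : ∀ {Y : FinGSet G}, (Y →[G] X) → M.obj Y → N.obj Y → A)
    (add_left : ∀ {Y : FinGSet G} (f : Y →[G] X) (m m' : M.obj Y) (n : N.obj Y),
      φ f (m + m') n = φ f m n + φ f m' n)
    (add_right : ∀ {Y : FinGSet G} (f : Y →[G] X) (m : M.obj Y) (n n' : N.obj Y),
      φ f m (n + n') = φ f m n + φ f m n')
    (tr_left : ∀ {Y Z : FinGSet G} (h : Z →[G] Y) (f : Y →[G] X) (m : M.obj Z) (n : N.obj Y),
      φ f (M.mackey.tr h m) n = φ (f.comp h) m (N.mackey.res h n))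
    (tr_right : ∀ {Y Z : FinGSet G} (h : Z →[G] Y) (f : Y →[G] X) (m : M.obj Y) (n : N.obj Z),
      φ f m (N.mackey.tr h n) = φ (f.comp h) (M.mackey.res h m) n)
    (balanced : ∀ {Y : FinGSet G} (f : Y →[G] X) (r : R.obj Y) (m : M.obj Y) (n : N.obj Y),
      φ f (r • m) n = φ f m (r • n)) : BoxObj M N X →+ A :=
  QuotientAddGroup.lift _ (FreeAbelianGroup.lift fun g => φ g.f g.m g.n) (by
    rw [AddSubgroup.closure_le]
    intro a ha
    change FreeAbelianGroup.lift (fun g : BoxGen M N X => φ g.f g.m g.n) a = 0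
    cases ha with
    | add_left Y f m m' n =>
      simp only [map_sub, map_add, FreeAbelianGroup.lift_apply_of, add_left, sub_self]
    | add_right Y f m n n' =>
      simp only [map_sub, map_add, FreeAbelianGroup.lift_apply_of, add_right, sub_self]
    | tr_left Y Z h f m n =>
      simp only [map_sub, FreeAbelianGroup.lift_apply_of, tr_left, sub_self]
    | tr_right Y Z h f m n =>
      simp only [map_sub, FreeAbelianGroup.lift_apply_of, tr_right, sub_self]
    | balanced Y f r m n =>
      simp only [map_sub, FreeAbelianGroup.lift_apply_of, balanced, sub_self])

/-- The action of `R(X)` on the level `X`: `r • [f, m, n] = [f, f^* r • m, n]`. -/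
def smulHom (r : R.obj X) : BoxObj M N X →+ BoxObj M N X :=
  lift (fun f m n => mk f (R.mackey.res f r • m) n)
    (fun f m m' n => by rw [smul_add, mk_add_left])
    (fun f m n n' => mk_add_right _ _ _ _)
    (fun h f m n => by rw [M.smul_tr, mk_tr_left, R.mackey.res_comp])
    (fun h f m n => by rw [mk_tr_right, M.res_smul, R.mackey.res_comp])
    (fun f s m n => by rw [smul_comm, mk_balanced])

theorem smulHom_mk (r : R.obj X) (f : Y →[G] X) (m : M.obj Y) (n : N.obj Y) :
    smulHom r (mk f m n) = mk f (R.mackey.res f r • m) n :=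
  FreeAbelianGroup.lift_apply_of _ _

instance : SMul (R.obj X) (BoxObj M N X) := ⟨fun r a => smulHom r a⟩

theorem smul_mk (r : R.obj X) (f : Y →[G] X) (m : M.obj Y) (n : N.obj Y) :
    r • (mk f m n : BoxObj M N X) = mk f (R.mackey.res f r • m) n := smulHom_mk r f m n

instance : Module (R.obj X) (BoxObj M N X) where
  one_smul := DFunLike.congr_fun (show smulHom (1 : R.obj X) = AddMonoidHom.id (BoxObj M N X) from
    hom_ext fun Y f m n => by rw [smulHom_mk, R.res_one, one_smul, AddMonoidHom.id_apply])
  mul_smul r s := DFunLike.congr_fun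
    (show smulHom (r * s) = (smulHom r).comp (smulHom s : BoxObj M N X →+ _) from
      hom_ext fun Y f m n => by
        rw [AddMonoidHom.comp_apply, smulHom_mk, smulHom_mk, smulHom_mk, R.res_mul, mul_smul])
  smul_zero r := map_zero (smulHom r)
  smul_add r := map_add (smulHom r)
  add_smul r s := DFunLike.congr_fun
    (show smulHom (r + s) = smulHom r + (smulHom s : BoxObj M N X →+ _) from
      hom_ext fun Y f m n => by
        rw [AddMonoidHom.add_apply, smulHom_mk, smulHom_mk, smulHom_mk, map_add, add_smul,
          mk_add_left])
  zero_smul := DFunLike.congr_fun (show smulHom (0 : R.obj X) = (0 : BoxObj M N X →+ _) from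
    hom_ext fun Y f m n => by
      rw [AddMonoidHom.zero_apply, smulHom_mk, map_zero, zero_smul, mk_zero_left])

/-- The transfer of the box product: `h_* [f, m, n] = [h ∘ f, m, n]`. -/
def tr (h : X →[G] Z) : BoxObj M N X →+ BoxObj M N Z :=
  lift (fun f m n => mk (h.comp f) m n) (fun _ _ _ _ => mk_add_left _ _ _ _)
    (fun _ _ _ _ => mk_add_right _ _ _ _) (fun _ _ _ _ => mk_tr_left _ _ _ _)
    (fun _ _ _ _ => mk_tr_right _ _ _ _) (fun _ _ _ _ => mk_balanced _ _ _ _)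

theorem tr_mk (h : X →[G] Z) (f : Y →[G] X) (m : M.obj Y) (n : N.obj Y) :
    tr h (mk f m n) = mk (h.comp f) m n :=
  FreeAbelianGroup.lift_apply_of _ _

/-- The base change of `k` along the first projection of a fibre product. -/
theorem cart_pullback {W : FinGSet G} (k : W →[G] Y) (f : Y →[G] X) (h : Z →[G] X) :
    IsCartesian (pfst (f.comp k) h)
      (plift (f := f) (g := h) (k.comp (pfst (f.comp k) h)) (psnd (f.comp k) h) fun w => w.2)
      k (pfst f h) :=
  ⟨fun _ => rfl, fun x y hxy => ⟨⟨(x, y.1.2), (congrArg f hxy).trans y.2⟩,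
    ⟨rfl, Subtype.ext (Prod.ext hxy rfl)⟩, fun v hv => Subtype.ext (Prod.ext hv.1 (by
      have h1 := congrArg (fun z => z.1.2) hv.2
      exact h1))⟩⟩

/-- The restriction of the box product: `h^* [f, m, n]` is the restriction of `m` and `n` to the
fibre product of `f` and `h`. -/
def res (h : Z →[G] X) : BoxObj M N X →+ BoxObj M N Z :=
  lift (fun f m n => mk (psnd f h) (M.mackey.res (pfst f h) m) (N.mackey.res (pfst f h) n))
    (fun _ _ _ _ => by rw [map_add, mk_add_left])
    (fun _ _ _ _ => by rw [map_add, mk_add_right])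
    (fun k f m n => by
      rw [M.mackey.base_change (cart_pullback k f h), mk_tr_left, ← N.mackey.res_comp,
        ← N.mackey.res_comp]
      rfl)
    (fun k f m n => by
      rw [N.mackey.base_change (cart_pullback k f h), mk_tr_right, ← M.mackey.res_comp,
        ← M.mackey.res_comp]
      rfl)
    (fun f r m n => by rw [M.res_smul, mk_balanced, N.res_smul])

theorem res_mk (h : Z →[G] X) (f : Y →[G] X) (m : M.obj Y) (n : N.obj Y) :
    res h (mk f m n) = mk (psnd f h) (M.mackey.res (pfst f h) m) (N.mackey.res (pfst f h) n) :=
  FreeAbelianGroup.lift_apply_of _ _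

/-- The restriction can be computed with any pullback square. -/
theorem res_mk_of_cart {W : FinGSet G} {p : W →[G] Y} {q : W →[G] Z} {f : Y →[G] X} {h : Z →[G] X}
    (hc : IsCartesian p q f h) (m : M.obj Y) (n : N.obj Y) :
    res h (mk f m n) = mk q (M.mackey.res p m) (N.mackey.res p n) := by
  rw [res_mk]
  have hb : Function.Bijective (plift (f := f) (g := h) p q hc.comm) := by
    constructor
    · intro a b hab
      have h1 : p a = p b := congrArg (fun z => z.1.1) hab
      have h2 : q a = q b := congrArg (fun z => z.1.2) hab
      obtain ⟨v, _, hu⟩ := hc.lift (p a) (q a) (hc.comm a)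
      exact (hu a ⟨rfl, rfl⟩).trans (hu b ⟨h1.symm, h2.symm⟩).symm
    · rintro ⟨⟨y, z⟩, e⟩
      obtain ⟨w, ⟨h1, h2⟩, _⟩ := hc.lift y z e
      exact ⟨w, Subtype.ext (Prod.ext h1 h2)⟩
  rw [← mk_bijective _ hb, ← M.mackey.res_comp, ← N.mackey.res_comp]
  rfl

theorem cart_paste {A B C D E F : FinGSet G} {p : A →[G] B} {q : A →[G] C} {f : B →[G] D}
    {g : C →[G] D} {p' : E →[G] A} {q' : E →[G] F} {g' : F →[G] C} (h : IsCartesian p q f g)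
    (h' : IsCartesian p' q' q g') : IsCartesian (p.comp p') q' f (g.comp g') :=
  ⟨fun w => (h.comm _).trans (congrArg g (h'.comm w)), fun x y hxy => by
    obtain ⟨a, ⟨h1, h2⟩, hu⟩ := h.lift x (g' y) hxy
    obtain ⟨e, ⟨h3, h4⟩, hu'⟩ := h'.lift a y h2
    refine ⟨e, ⟨(congrArg p h3).trans h1, h4⟩, fun v hv => hu' v ⟨hu _ ⟨hv.1, ?_⟩, hv.2⟩⟩
    exact (h'.comm v).trans (congrArg g' hv.2)⟩

/-- The Mackey structure of the box product. -/
def mackey (M N : GreenModule R) : MackeyStr (BoxObj M N) :=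
  have res_id : ∀ {X : FinGSet G} (a : BoxObj M N X), res (MulActionHom.id G) a = a := fun {X} =>
    DFunLike.congr_fun (show res (MulActionHom.id G) = AddMonoidHom.id (BoxObj M N X) from
      hom_ext fun Y f m n => by
        have hc : IsCartesian (MulActionHom.id G : Y →[G] Y) f f (MulActionHom.id G) :=
          ⟨fun _ => rfl, fun x y hxy => ⟨x, ⟨rfl, hxy⟩, fun v hv => hv.1⟩⟩
        rw [res_mk_of_cart hc, M.mackey.res_id, N.mackey.res_id, AddMonoidHom.id_apply])
  have tr_id : ∀ {X : FinGSet G} (a : BoxObj M N X), tr (MulActionHom.id G) a = a := fun {X} =>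
    DFunLike.congr_fun (show tr (MulActionHom.id G) = AddMonoidHom.id (BoxObj M N X) from
      hom_ext fun Y f m n => (tr_mk _ f m n))
  have base_change : ∀ {P X Y Z : FinGSet G} {p : P →[G] X} {q : P →[G] Y} {f : X →[G] Z}
      {g : Y →[G] Z}, IsCartesian p q f g → ∀ a : BoxObj M N X,
      res g (tr f a) = tr q (res p a) := fun {P X Y Z p q f g} h =>
    DFunLike.congr_fun (show (res g).comp (tr f) = (tr q).comp (res p : BoxObj M N X →+ _) from
      hom_ext fun W k m n => by
        rw [AddMonoidHom.comp_apply, AddMonoidHom.comp_apply, tr_mk f, res_mk p, tr_mk q]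
        exact res_mk_of_cart (MackeyStr.cart_symm (cart_paste (MackeyStr.cart_symm h)
          (MackeyStr.cart_symm (isCartesian_pullback k p)))) m n)
  have empty : ∀ X : FinGSet G, IsEmpty X → Subsingleton (BoxObj M N X) := fun X hX =>
    subsingleton_of_forall_eq 0 (DFunLike.congr_fun
      (show AddMonoidHom.id (BoxObj M N X) = 0 from hom_ext fun Y f m n => by
        have hm : m = 0 := (M.mackey.empty Y ⟨fun y => hX.false (f y)⟩).elim _ _
        rw [AddMonoidHom.id_apply, AddMonoidHom.zero_apply, hm, mk_zero_left]))
  { res := res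
    tr := tr
    res_id := res_id
    res_comp := fun {X Y Z} f g => DFunLike.congr_fun
      (show res (g.comp f) = (res f).comp (res g : BoxObj M N Z →+ _) from
        hom_ext fun W k m n => by
          rw [AddMonoidHom.comp_apply, res_mk g, res_mk f, ← M.mackey.res_comp,
            ← N.mackey.res_comp]
          exact res_mk_of_cart (cart_paste (isCartesian_pullback k g)
            (isCartesian_pullback (psnd k g) f)) m n)
    tr_id := tr_id
    tr_comp := fun {X Y Z} f g => DFunLike.congr_fun
      (show tr (g.comp f) = (tr g).comp (tr f : BoxObj M N X →+ _) from
        hom_ext fun W k m n => by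
          rw [AddMonoidHom.comp_apply, tr_mk, tr_mk, tr_mk]
          rfl)
    base_change := base_change
    empty := empty
    sum := fun X Y => MackeyStr.bijective_of_sum res tr res_id tr_id base_change empty X Y
      (DFunLike.congr_fun (show (tr (inl X Y)).comp (res (inl X Y)) +
          (tr (inr X Y)).comp (res (inr X Y)) = AddMonoidHom.id (BoxObj M N (X.sum Y)) from
        hom_ext fun W k m n => by
          rw [AddMonoidHom.add_apply, AddMonoidHom.comp_apply, AddMonoidHom.comp_apply,
            AddMonoidHom.id_apply, res_mk, res_mk, tr_mk, tr_mk]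
          have hl : (inl X Y).comp (psnd k (inl X Y)) = k.comp (pfst k (inl X Y)) :=
            DFunLike.ext _ _ fun w => w.2.symm
          have hr : (inr X Y).comp (psnd k (inr X Y)) = k.comp (pfst k (inr X Y)) :=
            DFunLike.ext _ _ fun w => w.2.symm
          rw [hl, hr, ← mk_tr_left, ← mk_tr_left, ← mk_add_left, M.mackey.sum_eq_of_bijective]
          constructor
          · rintro (⟨⟨y, z⟩, h⟩ | ⟨⟨y, z⟩, h⟩) (⟨⟨y', z'⟩, h'⟩ | ⟨⟨y', z'⟩, h'⟩) e
            all_goals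
              have e1 : y = y' := e
              subst e1
            · have e2 : z = z' := Sum.inl_injective (h.symm.trans h')
              subst e2
              rfl
            · exact (Sum.inl_ne_inr (h.symm.trans h')).elim
            · exact (Sum.inr_ne_inl (h.symm.trans h')).elim
            · have e2 : z = z' := Sum.inr_injective (h.symm.trans h')
              subst e2
              rfl
          · intro y
            rcases h : k y with z | z
            · exact ⟨Sum.inl ⟨(y, z), h⟩, rfl⟩
            · exact ⟨Sum.inr ⟨(y, z), h⟩, rfl⟩)) }

/-- Functoriality of the box product in the second variable. -/
def map (M : GreenModule R) (φ : N ⟶ P) (X : FinGSet G) : BoxObj M N X →+ BoxObj M P X :=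
  lift (fun {Y} f m n => mk f m (φ.app Y n)) (fun _ _ _ _ => mk_add_left _ _ _ _)
    (fun _ _ _ _ => by rw [_root_.map_add, mk_add_right])
    (fun _ _ _ _ => by rw [mk_tr_left, φ.app_res]) (fun _ _ _ _ => by rw [φ.app_tr, mk_tr_right])
    (fun _ _ _ _ => by rw [_root_.map_smul, mk_balanced])

theorem map_mk (φ : N ⟶ P) (f : Y →[G] X) (m : M.obj Y) (n : N.obj Y) :
    map M φ X (mk f m n) = mk f m (φ.app Y n) :=
  FreeAbelianGroup.lift_apply_of _ _

end BoxObj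

open BoxObj in
/-- The box product `M ⊠_R N` of modules over a commutative Green functor `R`. -/
def box (M N : GreenModule R) : GreenModule R where
  obj := BoxObj M N
  mackey := BoxObj.mackey M N
  res_smul {Z X} h r := DFunLike.congr_fun
    (show (res h).comp (smulHom r) = (smulHom (R.mackey.res h r)).comp (res h : BoxObj M N X →+ _)
      from BoxObj.hom_ext fun Y f m n => by
        rw [AddMonoidHom.comp_apply, AddMonoidHom.comp_apply, smulHom_mk, res_mk, res_mk,
          smulHom_mk, M.res_smul, ← R.mackey.res_comp, ← R.mackey.res_comp]
        have e : f.comp (pfst f h) = h.comp (psnd f h) := DFunLike.ext _ _ fun w => w.2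
        rw [e])
  smul_tr {X Z} h r := DFunLike.congr_fun
    (show (smulHom r).comp (tr h) = (tr h).comp
        (smulHom (R.mackey.res h r) : BoxObj M N X →+ _) from
      BoxObj.hom_ext fun Y f m n => by
        rw [AddMonoidHom.comp_apply, AddMonoidHom.comp_apply, tr_mk, smulHom_mk, smulHom_mk, tr_mk,
          R.mackey.res_comp])
  tr_smul {X Z} h r := DFunLike.congr_fun
    (show smulHom (R.mackey.tr h r) = (tr h).comp
        ((smulHom r).comp (res h : BoxObj M N Z →+ _)) from
      BoxObj.hom_ext fun Y f m n => by
        rw [AddMonoidHom.comp_apply, AddMonoidHom.comp_apply, smulHom_mk, res_mk, smulHom_mk, tr_mk,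
          R.mackey.base_change (MackeyStr.cart_symm (isCartesian_pullback f h)), M.tr_smul,
          mk_tr_left]
        have e : f.comp (pfst f h) = h.comp (psnd f h) := DFunLike.ext _ _ fun w => w.2
        rw [e])

open BoxObj in
/-- The functor `M ⊠_R -`. -/
def boxFunctor (M : GreenModule R) : GreenModule R ⥤ GreenModule R where
  obj N := box M N
  map {N P} φ :=
    { app := fun X =>
        { BoxObj.map M φ X with
          map_smul' := fun r => DFunLike.congr_fun
            (show (BoxObj.map M φ X).comp (smulHom r) = (smulHom r).comp (BoxObj.map M φ X) from
              BoxObj.hom_ext fun Y f m n => by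
                rw [AddMonoidHom.comp_apply, AddMonoidHom.comp_apply, smulHom_mk, map_mk, map_mk,
                  smulHom_mk]) }
      app_res := fun {Z X} h => DFunLike.congr_fun
        (show (BoxObj.map M φ Z).comp (res h) = (res h).comp (BoxObj.map M φ X) from
          BoxObj.hom_ext fun Y f m n => by
            rw [AddMonoidHom.comp_apply, AddMonoidHom.comp_apply, res_mk, map_mk, map_mk, res_mk,
              φ.app_res])
      app_tr := fun {X Z} h => DFunLike.congr_fun
        (show (BoxObj.map M φ Z).comp (tr h) = (tr h).comp (BoxObj.map M φ X) from
          BoxObj.hom_ext fun Y f m n => by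
            rw [AddMonoidHom.comp_apply, AddMonoidHom.comp_apply, tr_mk, map_mk, map_mk, tr_mk]) }
  map_id N := GreenModule.hom_ext fun X a => by
    have h : BoxObj.map M (𝟙 N) X = AddMonoidHom.id _ :=
      BoxObj.hom_ext fun Y f m n => map_mk _ f m n
    exact DFunLike.congr_fun h a
  map_comp {N P Q} φ ψ := GreenModule.hom_ext fun X a => by
    have h : BoxObj.map M (φ ≫ ψ) X = (BoxObj.map M ψ X).comp (BoxObj.map M φ X) :=
      BoxObj.hom_ext fun Y f m n => by
        rw [AddMonoidHom.comp_apply, map_mk, map_mk, map_mk]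
        rfl
    exact DFunLike.congr_fun h a

instance (M : GreenModule R) : (boxFunctor M).Additive where
  map_add {N P φ ψ} := GreenModule.hom_ext fun X a => by
    have h : BoxObj.map M (φ + ψ) X = BoxObj.map M φ X + BoxObj.map M ψ X :=
      BoxObj.hom_ext fun Y f m n => by
        rw [AddMonoidHom.add_apply, BoxObj.map_mk, BoxObj.map_mk, BoxObj.map_mk]
        exact BoxObj.mk_add_right _ _ _ _
    exact DFunLike.congr_fun h a

/-- `Tor_n^R(M, N)`: the `n`-th left derived functor of `M ⊠_R -`, evaluated at `N`. -/
noncomputable def tor (M N : GreenModule R) (n : ℕ) : GreenModule R :=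
  ((boxFunctor M).leftDerived n).obj N

end GreenModule

end Equivariant

/-!
Since an isotropy-preserving map `q : A → B` is determined up to isomorphism by the function
sending `b` to the number of points of `A` over `b` (`Poly.Iso.of_deg`), the free Green functor `R`
is a polynomial ring `A[x]` over the Burnside functor: the coefficient of `x ^ n` of a polynomial
`A → B → X` is the part of `B` of degree `n`. Only a small part of this is needed, namely that every
polynomial is its constant term plus a multiple of `x` (`Poly.aug_add_divX_mul_var`), and that it can
be recovered from its product with `x` by lowering degrees (`Poly.divX_mul_var`). Both operations
are additive, so these identities pass to the group completion, where they say that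
`0 → R → R → A → 0`, with the multiplication by `x` and the augmentation, is short exact
(`GreenModule.koszul_shortExact`).

The module `R` over itself is projective, because morphisms out of it are elements at the terminal
`G`-set `G/G`. Hence the sequence is a projective resolution of the Burnside module, and the Tor
groups are the homology of the complex obtained by applying `A ⊠_R -`. As `R` is a right unit for
the box product (`GreenModule.boxRegularIso`), this complex has `A` in degrees `0` and `1`; as `x`
acts by zero on `A`, its differential vanishes (`GreenModule.boxFunctor_map_mulVar`).
-/

namespace Equivariant

/-! ### Derived functors from a projective resolution of length one -/

section LengthOne

open CategoryTheory CategoryTheory.Limits HomologicalComplex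

variable {C D : Type*} [Category* C] [Category* D] [Abelian C] [Abelian D]

theorem down_rel_one_zero : (ComplexShape.down ℕ).Rel 1 0 := rfl

/-- A short exact sequence `0 → P₁ → P₀ → Z → 0` with `P₁` and `P₀` projective, as a projective
resolution of `Z`: the complex has `P₁` and `P₀` in degrees `1` and `0`. -/
noncomputable def projectiveResolutionOfShortExact {S : ShortComplex C} (hS : S.ShortExact)
    [Projective S.X₁] [Projective S.X₂] : ProjectiveResolution S.X₃ where
  complex := double S.f down_rel_one_zero
  projective n := by
    obtain _ | _ | n := n
    · exact Projective.of_iso (doubleXIso₁ S.f down_rel_one_zero one_ne_zero).symm inferInstance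
    · exact Projective.of_iso (doubleXIso₀ S.f down_rel_one_zero).symm inferInstance
    · exact (isZero_double_X _ _ _ (by omega) (by omega)).projective
  π := (ChainComplex.toSingle₀Equiv _ _).symm
    ⟨(doubleXIso₁ S.f down_rel_one_zero one_ne_zero).hom ≫ S.g, by
      rw [double_d S.f down_rel_one_zero one_ne_zero]
      simp⟩
  quasiIso := ⟨fun n => by
    have := hS.mono_f
    have := hS.epi_g
    obtain _ | _ | n := n
    -- In degree `0`, the condition is exactness of `P₁ → P₀ → Z → 0`.
    · rw [ChainComplex.quasiIsoAt₀_iff, ShortComplex.quasiIso_iff_of_zeros' _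
        ((double S.f down_rel_one_zero).shape _ _ (by simp)) rfl rfl]
      refine (ShortComplex.exact_and_epi_g_iff_of_iso ?_).2 ⟨hS.exact, hS.epi_g⟩
      refine ShortComplex.isoMk (doubleXIso₀ S.f down_rel_one_zero)
        (doubleXIso₁ S.f down_rel_one_zero one_ne_zero) (Iso.refl _) ?_ ?_
      · change (doubleXIso₀ S.f down_rel_one_zero).hom ≫ S.f =
          (double S.f down_rel_one_zero).d 1 0 ≫
            (doubleXIso₁ S.f down_rel_one_zero one_ne_zero).hom
        rw [double_d S.f down_rel_one_zero one_ne_zero]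
        simp
      · exact (ChainComplex.toSingle₀Equiv_symm_apply_f_zero
          (C := double S.f down_rel_one_zero) (X := S.X₃) _ _).symm.trans (Category.comp_id _).symm
    -- In degree `1`, exactness means that `S.f` is a monomorphism.
    · rw [quasiIsoAt_iff_exactAt' _ _ (ChainComplex.exactAt_succ_single_obj _ _),
        exactAt_iff' _ 2 1 0 (by simp) (by simp),
        ShortComplex.exact_iff_mono _ (double_d_eq_zero₀ S.f down_rel_one_zero _ _ (by omega))]
      change Mono ((double S.f down_rel_one_zero).d 1 0)
      rw [double_d S.f down_rel_one_zero one_ne_zero]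
      infer_instance
    · rw [quasiIsoAt_iff_exactAt' _ _ (ChainComplex.exactAt_succ_single_obj _ _)]
      exact ShortComplex.exact_of_isZero_X₂ _
        (isZero_double_X S.f down_rel_one_zero _ (by omega) (by omega))⟩

variable [EnoughProjectives C]

/-- If `F` kills the map `P₁ → P₀` of a resolution of length one, then applying `F` gives a complex
with zero differentials, which is therefore its own homology. -/
noncomputable def leftDerivedIsoOfMapEqZero {S : ShortComplex C} (hS : S.ShortExact)
    [Projective S.X₁] [Projective S.X₂] (F : C ⥤ D) [F.Additive] (hF : F.map S.f = 0) (n : ℕ) :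
    (F.leftDerived n).obj S.X₃ ≅ F.obj ((double S.f down_rel_one_zero).X n) :=
  have hd (i j : ℕ) : F.map ((projectiveResolutionOfShortExact hS).complex.d i j) = 0 := by
    change F.map ((double S.f down_rel_one_zero).d i j) = 0
    by_cases hi : i = 1
    · by_cases hj : j = 0
      · subst hi hj
        rw [double_d S.f down_rel_one_zero one_ne_zero, F.map_comp, F.map_comp, hF, zero_comp,
          comp_zero]
      · rw [double_d_eq_zero₁ _ _ _ _ hj, F.map_zero]
    · rw [double_d_eq_zero₀ _ _ _ _ hi, F.map_zero]
  let P := projectiveResolutionOfShortExact hS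
  P.isoLeftDerivedObj F n ≪≫ (ShortComplex.LeftHomologyData.ofZeros
    (((F.mapHomologicalComplex _).obj P.complex).sc n)
    (hd ((ComplexShape.down ℕ).prev n) n) (hd n ((ComplexShape.down ℕ).next n))).homologyIso

end LengthOne

open FinGSet

/-! ### Division of polynomials by the variable -/

namespace Poly

variable {G : Type u} [Group G] {X Y : FinGSet G}

/-- The degree is constant on orbits. -/
theorem deg_smul (P : Poly X) (g : G) (y : P.B) : P.deg (g • y) = P.deg y :=
  Nat.card_congr ((MulAction.toPerm g : Equiv.Perm P.A).subtypeEquiv fun a => by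
    rw [MulAction.toPerm_apply, map_smul, smul_left_cancel_iff]).symm

/-- The `G`-set of points of `B` inside the image of `A → B`, that is, of positive degree. -/
def supp (P : Poly X) : FinGSet G :=
  letI : MulAction G {y : P.B // P.deg y ≠ 0} :=
    { smul := fun g y => ⟨g • y.1, by rw [deg_smul]; exact y.2⟩
      one_smul := fun y => Subtype.ext (one_smul G y.1)
      mul_smul := fun g h y => Subtype.ext (mul_smul g h y.1) }
  ⟨{y : P.B // P.deg y ≠ 0}⟩

/-- The action on `⨿ b, {0, …, d b - 1}` for an invariant function `d` on a finite `G`-set: the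
second coordinate of a point `(b, i)` is not moved. -/
abbrev degAction (B : FinGSet G) (d : B → ℕ) (hd : ∀ (g : G) b, d (g • b) = d b) :
    MulAction G (Σ b : B, Fin (d b)) where
  smul g a := ⟨g • a.1, Fin.cast (hd g a.1).symm a.2⟩
  one_smul a := Sigma.ext (one_smul G a.1)
    ((Fin.heq_ext_iff (congrArg d (one_smul G a.1))).2 rfl)
  mul_smul g h a := Sigma.ext (mul_smul g h a.1)
    ((Fin.heq_ext_iff (congrArg d (mul_smul g h a.1))).2 rfl)

/-- The polynomial `⨿ b, {0, …, d b - 1} → B → X` attached to a degree function `d` on `B`. The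
projection to `B` preserves isotropy because the group does not move the second coordinates. -/
def ofDeg (B : FinGSet G) (t : B →[G] X) (d : B → ℕ) (hd : ∀ (g : G) b, d (g • b) = d b) :
    Poly X where
  A :=
    letI : MulAction G (Σ b : B, Fin (d b)) := degAction B d hd
    ⟨Σ b : B, Fin (d b)⟩
  B := B
  q :=
    letI : MulAction G (Σ b : B, Fin (d b)) := degAction B d hd
    ⟨Sigma.fst, fun _ _ => rfl⟩
  t := t
  isotropy := fun a => by
    ext g
    refine ⟨fun h => Sigma.ext h ((Fin.heq_ext_iff ?_).2 rfl), fun h => congrArg Sigma.fst h⟩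
    exact congrArg d h

theorem deg_ofDeg (B : FinGSet G) (t : B →[G] X) (d : B → ℕ) (hd : ∀ (g : G) b, d (g • b) = d b)
    (b : B) : (ofDeg B t d hd).deg b = d b :=
  (Nat.card_congr (Equiv.sigmaSubtype (β := fun b => Fin (d b)) b)).trans (Nat.card_fin (d b))

/-- The quotient of a polynomial by the variable: the constant terms are dropped and all other
degrees are lowered by one. -/
noncomputable def divX (P : Poly X) : Poly X :=
  ofDeg P.supp ⟨fun y => P.t y.1, fun g y => map_smul P.t g y.1⟩ (fun y => P.deg y.1 - 1)
    fun g y => congrArg (· - 1) (deg_smul P g y.1)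

theorem deg_divX (P : Poly X) (y : P.supp) : P.divX.deg y = P.deg y.1 - 1 := deg_ofDeg _ _ _ _ y

/-- The variable over `X`: the polynomial `G/G ← X → X → X`. -/
def var (X : FinGSet G) : Poly X := ⟨X, X, MulActionHom.id G, MulActionHom.id G, fun _ => rfl⟩

theorem deg_var (y : X) : (var X).deg y = 1 :=
  (Nat.card_congr (Equiv.subtypeEquivRight fun _ => Iff.rfl)).trans
    (Nat.card_unique (α := {a // a = y}))

theorem deg_eq_zero_iff (P : Poly X) (y : P.B) : P.deg y = 0 ↔ ∀ a, P.q a ≠ y := by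
  unfold deg
  rw [Finite.card_eq_zero_iff, isEmpty_subtype]

theorem res_var (f : X →[G] Y) : Iso ((var Y).res f) (var X) :=
  Iso.of_deg (psnd (var Y).t f)
    (bij_of_inv (fun y => ⟨(f y, y), rfl⟩)
      (fun w => Subtype.ext (Prod.ext w.2.symm rfl)) fun _ => rfl)
    (fun _ => rfl)
    (fun w => (deg_var (X := X) _).trans ((deg_res f (var Y) w).trans (deg_var (X := Y) _)).symm)

theorem divX_congr {P Q : Poly X} : Iso P Q → Iso P.divX Q.divX := by
  rintro ⟨a, b, ha, hb, hq, ht⟩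
  have hd := Iso.deg_eq ha hb hq
  refine Iso.of_deg (⟨fun y => ⟨b y.1, by rw [hd]; exact y.2⟩,
      fun g y => Subtype.ext (map_smul b g y.1)⟩ : P.supp →[G] Q.supp)
    ⟨fun y z h => Subtype.ext (hb.1 (congrArg Subtype.val h)), fun y => ?_⟩ (fun y => ht y.1)
    fun y => ?_
  · obtain ⟨z, hz⟩ := hb.2 y.1
    exact ⟨⟨z, by rw [← hd, hz]; exact y.2⟩, Subtype.ext hz⟩
  · exact (deg_divX Q _).trans ((congrArg (· - 1) (hd y.1)).trans (deg_divX P y).symm)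

theorem divX_zero : Iso (zero X).divX (zero X) :=
  Iso.of_deg (⟨fun y => y.1, fun _ _ => rfl⟩ : (zero X).supp →[G] empty G)
    ⟨fun y => isEmptyElim (α := empty G) y.1, fun y => isEmptyElim (α := empty G) y⟩
    (fun _ => rfl) fun y => isEmptyElim (α := empty G) y.1

theorem divX_add (P Q : Poly X) : Iso (P.add Q).divX (P.divX.add Q.divX) := by
  refine Iso.symm (Iso.of_deg (⟨fun y => match y with
      | Sum.inl y => ⟨Sum.inl y.1, by rw [deg_add_inl]; exact y.2⟩
      | Sum.inr y => ⟨Sum.inr y.1, by rw [deg_add_inr]; exact y.2⟩, ?_⟩ :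
        P.supp.sum Q.supp →[G] (P.add Q).supp) ⟨?_, ?_⟩ ?_ ?_)
  · rintro g (y | y) <;> rfl
  · rintro (y | y) (z | z) h
    · exact congrArg Sum.inl (Subtype.ext (Sum.inl_injective (congrArg Subtype.val h)))
    · exact (Sum.inl_ne_inr (congrArg Subtype.val h)).elim
    · exact (Sum.inr_ne_inl (congrArg Subtype.val h)).elim
    · exact congrArg Sum.inr (Subtype.ext (Sum.inr_injective (congrArg Subtype.val h)))
  · rintro ⟨y | y, h⟩
    · exact ⟨Sum.inl ⟨y, by rwa [deg_add_inl] at h⟩, rfl⟩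
    · exact ⟨Sum.inr ⟨y, by rwa [deg_add_inr] at h⟩, rfl⟩
  · rintro (y | y) <;> rfl
  · rintro (y | y)
    · exact (deg_divX (P.add Q) _).trans ((congrArg (· - 1) (deg_add_inl P Q y.1)).trans
        ((deg_divX P y).symm.trans (deg_add_inl P.divX Q.divX y).symm))
    · exact (deg_divX (P.add Q) _).trans ((congrArg (· - 1) (deg_add_inr P Q y.1)).trans
        ((deg_divX Q y).symm.trans (deg_add_inr P.divX Q.divX y).symm))

theorem deg_mul_var (P : Poly X) (w : (P.mul (var X)).B) :
    (P.mul (var X)).deg w = P.deg w.1.1 + 1 :=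
  (deg_mul P (var X) w).trans (congrArg (_ + ·) (deg_var (X := X) _))

/-- Multiplication by the variable raises all degrees by one, and division lowers them again. -/
theorem divX_mul_var (P : Poly X) : Iso (P.mul (var X)).divX P := by
  refine Iso.of_deg (⟨fun w => w.1.1.1, fun _ _ => rfl⟩ : (P.mul (var X)).supp →[G] P.B)
    (bij_of_inv (fun y => ⟨⟨(y, P.t y), rfl⟩,
        (deg_mul_var P _).trans_ne (Nat.succ_ne_zero _)⟩)
      (fun w => Subtype.ext (Subtype.ext (Prod.ext rfl w.1.2))) fun _ => rfl)
    (fun _ => rfl) fun w => ?_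
  refine Eq.symm ((deg_divX _ w).trans ((congrArg (· - 1) (deg_mul_var P w.1)).trans ?_))
  exact Nat.add_sub_cancel ..

/-- A polynomial is the sum of its constant term and a multiple of the variable: the points of `B`
are separated into those of degree zero and those of positive degree. -/
theorem aug_add_divX_mul_var (P : Poly X) : Iso (P.aug.toPoly.add (P.divX.mul (var X))) P := by
  refine Iso.of_deg (⟨fun y => match y with
      | Sum.inl y => y.1
      | Sum.inr w => w.1.1.1, ?_⟩ : P.compl.sum (pullback P.divX.t (var X).t) →[G] P.B)
    ⟨?_, ?_⟩ ?_ ?_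
  · rintro g (y | y) <;> rfl
  · rintro (y | ⟨⟨y, x⟩, e⟩) (z | ⟨⟨z, x'⟩, e'⟩) h
    · exact congrArg Sum.inl (Subtype.ext h)
    · have h' : y.1 = z.1 := h
      exact (z.2 ((deg_eq_zero_iff P z.1).2 (h' ▸ y.2))).elim
    · have h' : y.1 = z.1 := h
      exact (y.2 ((deg_eq_zero_iff P y.1).2 (h' ▸ z.2))).elim
    · obtain rfl : y = z := Subtype.ext h
      obtain rfl : x = x' := e.symm.trans e'
      rfl
  · intro y
    by_cases h : P.deg y = 0
    · exact ⟨Sum.inl ⟨y, (deg_eq_zero_iff P y).1 h⟩, rfl⟩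
    · exact ⟨Sum.inr ⟨(⟨y, h⟩, P.t y), rfl⟩, rfl⟩
  · rintro (y | y) <;> rfl
  · rintro (y | w)
    · exact ((deg_eq_zero_iff P y.1).2 y.2).trans
        ((deg_add_inl P.aug.toPoly (P.divX.mul (var X)) y).trans (P.aug.deg_toPoly y)).symm
    · refine Eq.symm ((deg_add_inr P.aug.toPoly (P.divX.mul (var X)) w).trans
        ((deg_mul_var P.divX w).trans ((congrArg (· + 1) (deg_divX P w.1.1)).trans ?_)))
      exact Nat.sub_add_cancel (Nat.one_le_iff_ne_zero.2 w.1.1.2)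

theorem aug_toPoly (P : GSetOver X) : GSetOver.Iso P.toPoly.aug P :=
  ⟨⟨fun y => y.1, fun _ _ => rfl⟩, ⟨fun _ _ h => Subtype.ext h,
    fun y => ⟨⟨y, fun a => isEmptyElim (α := empty G) a⟩, rfl⟩⟩, fun _ => rfl⟩

/-- The class of the variable over `X`. -/
def varClass (X : FinGSet G) : (polySemiGreen G).obj X := Quotient.mk (setoid X) (var X)

/-- The division by the variable on classes. -/
noncomputable def divXHom (X : FinGSet G) : (polySemiGreen G).obj X →+ (polySemiGreen G).obj X where
  toFun := Quotient.map divX fun _ _ h => divX_congr h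
  map_zero' := Quotient.sound divX_zero
  map_add' a b := Quotient.inductionOn₂ a b fun P Q => Quotient.sound (divX_add P Q)

end Poly

/-- The inclusion of the constant polynomials. -/
def GSetOver.toPolyHom {G : Type u} [Group G] (X : FinGSet G) :
    (gsetSemiGreen G).obj X →+ (polySemiGreen G).obj X where
  toFun := GSetOver.Class.toPoly
  map_zero' := GSetOver.Class.zero'
  map_add' := GSetOver.Class.add'

theorem Poly.augHom_toPolyHom {G : Type u} [Group G] (X : FinGSet G)
    (s : (gsetSemiGreen G).obj X) : augHom X (GSetOver.toPolyHom X s) = s :=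
  Quotient.inductionOn s fun P => show (Quotient.mk _ P.toPoly.aug : GSetOver.Class X) =
    Quotient.mk _ P from Quotient.sound (aug_toPoly P)

theorem Poly.divXHom_mul_varClass {G : Type u} [Group G] (X : FinGSet G)
    (s : (polySemiGreen G).obj X) : divXHom X (s * varClass X) = s :=
  Quotient.inductionOn s fun P => show (Quotient.mk _ (P.mul (var X)).divX : Class X) =
    Quotient.mk _ P from Quotient.sound (divX_mul_var P)

theorem Poly.constant_add_divXHom_mul_varClass {G : Type u} [Group G] (X : FinGSet G)
    (s : (polySemiGreen G).obj X) :
    GSetOver.toPolyHom X (augHom X s) + divXHom X s * varClass X = s :=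
  Quotient.inductionOn s fun P => show
    (Quotient.mk _ (P.aug.toPoly.add (P.divX.mul (var X))) : Class X) = Quotient.mk _ P from
      Quotient.sound (aug_add_divX_mul_var P)

/-! ### Completing the division by the variable -/

namespace Completion

variable {S T : Type v} [CommSemiring S] [CommSemiring T]

theorem map_map_eq_self (e : S →+* T) (i : T →+ S) (h : ∀ t, e (i t) = t) (a : Completion T) :
    map (e : S →+ T) (map i a) = a :=
  DFunLike.congr_fun (show (map (e : S →+ T)).comp (map i) = AddMonoidHom.id _ from
    hom_ext fun s => by
      rw [AddMonoidHom.comp_apply, map_of, map_of, AddMonoidHom.id_apply]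
      exact congrArg of (h s)) a

theorem map_mul_of {d : S →+ S} {x : S} (h : ∀ s, d (s * x) = s) (a : Completion S) :
    map d (a * of x) = a :=
  DFunLike.congr_fun (show (map d).comp (AddMonoidHom.mulRight (of x)) = AddMonoidHom.id _ from
    hom_ext fun s => by
      rw [AddMonoidHom.comp_apply, AddMonoidHom.mulRight_apply, of_mul, map_of, h,
        AddMonoidHom.id_apply]) a

theorem map_add_map_mul_of (e : S →+* T) (i : T →+ S) (d : S →+ S) (x : S)
    (h : ∀ s, i (e s) + d s * x = s) (a : Completion S) :
    map i (map (e : S →+ T) a) + map d a * of x = a :=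
  DFunLike.congr_fun (show (map i).comp (map (e : S →+ T)) +
      (AddMonoidHom.mulRight (of x)).comp (map d) = AddMonoidHom.id _ from hom_ext fun s => by
    rw [AddMonoidHom.add_apply, AddMonoidHom.comp_apply, AddMonoidHom.comp_apply,
      AddMonoidHom.mulRight_apply, map_of, map_of, map_of, of_mul, ← map_add]
    exact congrArg of (h s)) a

end Completion

/-! ### The kernel of the augmentation -/

section Variable

variable {G : Type u} [Group G]

/-- The map to the one-point `G`-set. -/
def toPt (X : FinGSet G) : X →[G] pt G := ⟨fun _ => PUnit.unit, fun _ _ => rfl⟩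

/-- The restriction to `X` of the generator of the free Green functor. -/
noncomputable def varAt (X : FinGSet G) : (freeGreen G).obj X :=
  (freeGreen G).mackey.res (toPt X) (freeGreenGen G)

theorem varAt_eq (X : FinGSet G) : varAt X = Completion.of (Poly.varClass X) :=
  ((polySemiGreen G).mackey_res (toPt X) (Poly.varClass (pt G))).trans
    (congrArg Completion.of (Quotient.sound (s := Poly.setoid X) (Poly.res_var (toPt X))))

theorem augmentation_varAt (X : FinGSet G) : (augmentation G).app X (varAt X) = 0 := by
  unfold varAt
  rw [(augmentation G).app_res, augmentation_gen, map_zero]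

theorem augmentation_app (X : FinGSet G) (a : Completion ((polySemiGreen G).obj X)) :
    (augmentation G).app X a =
      Completion.map (Poly.augHom X : (polySemiGreen G).obj X →+ (gsetSemiGreen G).obj X) a := rfl

theorem augmentation_surjective (X : FinGSet G) :
    Function.Surjective ((augmentation G).app X) := fun a =>
  ⟨Completion.map (GSetOver.toPolyHom X) a, (augmentation_app X _).trans
    (Completion.map_map_eq_self (Poly.augHom X) (GSetOver.toPolyHom X)
      (Poly.augHom_toPolyHom X) a)⟩

/-- The variable is not a zero divisor, as division by it is an additive left inverse. -/
theorem mul_varAt_injective (X : FinGSet G) :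
    Function.Injective fun a : (freeGreen G).obj X => a * varAt X := by
  rw [varAt_eq]
  exact (show Function.LeftInverse (Completion.map (Poly.divXHom X)) _ from
    Completion.map_mul_of (Poly.divXHom_mul_varClass X)).injective

/-- The kernel of the augmentation is generated by the variable. -/
theorem exists_mul_varAt_eq (X : FinGSet G) (a : (freeGreen G).obj X)
    (ha : (augmentation G).app X a = 0) : ∃ b : (freeGreen G).obj X, b * varAt X = a := by
  have h := Completion.map_add_map_mul_of (Poly.augHom X) (GSetOver.toPolyHom X) (Poly.divXHom X)
    (Poly.varClass X) (Poly.constant_add_divXHom_mul_varClass X) a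
  have ha' : Completion.map (Poly.augHom X : (polySemiGreen G).obj X →+ (gsetSemiGreen G).obj X) a =
      0 := ha
  rw [ha', map_zero, zero_add] at h
  rw [varAt_eq]
  exact ⟨_, h⟩

end Variable

/-! ### The regular module -/

namespace GreenModule

open CategoryTheory CategoryTheory.Limits

variable {G : Type u} [Group G] {R : GreenFunctor G}

variable (R) in
/-- A Green functor as a module over itself. It is reducible, so that elements of its levels are
seen to be elements of the ring. -/
abbrev regular : GreenModule R where
  obj := R.obj
  mackey := R.mackey
  res_smul := R.res_mul
  smul_tr := R.frobenius
  tr_smul f r m := by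
    rw [smul_eq_mul, smul_eq_mul, mul_comm, R.frobenius, mul_comm]

variable {M N : GreenModule R}

/-- The morphism from the regular module determined by the image of `1` at the level `G/G`. -/
def regularDesc (m : M.obj (pt G)) : regular R ⟶ M where
  app X :=
    { toFun := fun a : R.obj X => a • M.mackey.res (toPt X) m
      map_add' := fun a b => add_smul (R := R.obj X) a b _
      map_smul' := fun r a => mul_smul (α := R.obj X) r a _ }
  app_res := fun {X Y} f (a : R.obj Y) => by
    change R.mackey.res f a • M.mackey.res ((toPt Y).comp f) m = _
    rw [M.mackey.res_comp]
    exact (M.res_smul f a _).symm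
  app_tr := fun {X Y} f (a : R.obj X) => by
    change R.mackey.tr f a • M.mackey.res (toPt Y) m =
      M.mackey.tr f (a • M.mackey.res ((toPt Y).comp f) m)
    rw [M.mackey.res_comp]
    exact M.tr_smul f a _

theorem regularDesc_app (m : M.obj (pt G)) (X : FinGSet G) (a : R.obj X) :
    (regularDesc m).app X a = a • M.mackey.res (toPt X) m := rfl

theorem regularDesc_comp (m : M.obj (pt G)) (e : M ⟶ N) (f : regular R ⟶ N)
    (h : e.app (pt G) m = f.app (pt G) (1 : R.obj (pt G))) : regularDesc m ≫ e = f :=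
  hom_ext fun X (a : R.obj X) => by
    have h1 : f.app X (a • (1 : R.obj X)) = a • f.app X (1 : R.obj X) := map_smul (f.app X) a _
    rw [comp_app, regularDesc_app, map_smul, e.app_res, h, ← f.app_res]
    refine Eq.trans (congrArg (a • f.app X ·) (R.res_one (toPt X))) (h1.symm.trans ?_)
    exact congrArg (f.app X) (mul_one a)

/-- The regular module is free on `1 ∈ R(G/G)`, since `G/G` is terminal. -/
instance : Projective (regular R) where
  factors {E N} f e _ := by
    obtain ⟨m, hm⟩ := surjective_of_epi e (pt G) (f.app (pt G) (1 : R.obj (pt G)))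
    exact ⟨regularDesc m, regularDesc_comp m e f hm⟩

/-- The action `M ⊠_R R → M`, which sends `[f, m, r]` to `f_* (r • m)`. -/
def boxRegularHom (M : GreenModule R) (X : FinGSet G) : BoxObj M (regular R) X →+ M.obj X :=
  BoxObj.lift (fun {Y} f m (r : R.obj Y) => M.mackey.tr f (r • m))
    (fun f m m' r => by rw [smul_add, map_add])
    (fun f m r r' => by rw [← map_add, add_smul])
    (fun {Y Z} h f m r => by
      rw [M.mackey.tr_comp]
      exact congrArg _ (M.smul_tr h r m))
    (fun {Y Z} h f m r => by
      rw [M.mackey.tr_comp]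
      exact congrArg _ (M.tr_smul h r m))
    (fun {Y} f s m r => by
      refine congrArg _ ?_
      rw [smul_eq_mul, mul_smul, smul_comm])

theorem boxRegularHom_mk (X : FinGSet G) {Y : FinGSet G} (f : Y →[G] X) (m : M.obj Y)
    (r : R.obj Y) :
    boxRegularHom M X (BoxObj.mk (N := regular R) f m r) = M.mackey.tr f (r • m) :=
  FreeAbelianGroup.lift_apply_of _ _

/-- The inverse sends `m` to `[id, m, 1]`. -/
theorem boxRegularHom_bijective (M : GreenModule R) (X : FinGSet G) :
    Function.Bijective (boxRegularHom M X) := by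
  refine Poly.bij_of_inv (fun m => BoxObj.mk (MulActionHom.id G) m (1 : R.obj X)) ?_ fun m => ?_
  · let ψ : M.obj X →+ BoxObj M (regular R) X := AddMonoidHom.mk'
      (fun m => BoxObj.mk (MulActionHom.id G) m (1 : R.obj X))
      fun m m' => BoxObj.mk_add_left _ _ _ _
    refine DFunLike.congr_fun (show ψ.comp (boxRegularHom M X) = AddMonoidHom.id _ from
      BoxObj.hom_ext fun Y f m (r : R.obj Y) => ?_)
    rw [AddMonoidHom.comp_apply, boxRegularHom_mk, AddMonoidHom.id_apply]
    change BoxObj.mk (N := regular R) _ (M.mackey.tr f (r • m)) (1 : R.obj X) = _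
    rw [BoxObj.mk_tr_left, BoxObj.mk_balanced]
    refine congrArg (BoxObj.mk (N := regular R) f m) ?_
    rw [smul_eq_mul, R.res_one, mul_one]
  · rw [boxRegularHom_mk, M.mackey.tr_id, one_smul]

/-- The action `M ⊠_R R → M` as a morphism of modules. -/
def boxRegular (M : GreenModule R) : box M (regular R) ⟶ M where
  app X :=
    { boxRegularHom M X with
      map_smul' := fun r => DFunLike.congr_fun
        (show (boxRegularHom M X).comp (BoxObj.smulHom r) =
            (DistribSMul.toAddMonoidHom (M.obj X) r).comp (boxRegularHom M X) from
          BoxObj.hom_ext fun Y f m (s : R.obj Y) => by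
            rw [AddMonoidHom.comp_apply, AddMonoidHom.comp_apply, BoxObj.smulHom_mk,
              boxRegularHom_mk, boxRegularHom_mk, DistribSMul.toAddMonoidHom_apply, M.smul_tr,
              smul_comm]) }
  app_res {X Y} h := DFunLike.congr_fun
    (show (boxRegularHom M X).comp (BoxObj.res h) =
        (M.mackey.res h).comp (boxRegularHom M Y) from
      BoxObj.hom_ext fun Z f m (s : R.obj Z) => by
        rw [AddMonoidHom.comp_apply, AddMonoidHom.comp_apply, BoxObj.res_mk, boxRegularHom_mk,
          boxRegularHom_mk, M.mackey.base_change (isCartesian_pullback f h), M.res_smul])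
  app_tr {X Y} h := DFunLike.congr_fun
    (show (boxRegularHom M Y).comp (BoxObj.tr h) =
        (M.mackey.tr h).comp (boxRegularHom M X) from
      BoxObj.hom_ext fun Z f m (s : R.obj Z) => by
        rw [AddMonoidHom.comp_apply, AddMonoidHom.comp_apply, BoxObj.tr_mk, boxRegularHom_mk,
          boxRegularHom_mk, M.mackey.tr_comp])

instance (M : GreenModule R) : IsIso (boxRegular M) :=
  haveI := mono_of_injective (boxRegular M) fun X => (boxRegularHom_bijective M X).1
  haveI := epi_of_surjective (boxRegular M) fun X => (boxRegularHom_bijective M X).2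
  isIso_of_mono_of_epi _

/-- The regular module is a right unit for the box product. -/
noncomputable def boxRegularIso (M : GreenModule R) : (boxFunctor M).obj (regular R) ≅ M :=
  (asIso (boxRegular M) : box M (regular R) ≅ M)

/-- A sequence of modules is short exact if it is so at all levels. -/
theorem shortExact_of_levelwise {S : ShortComplex (GreenModule R)}
    (hf : ∀ X, Function.Injective (S.f.app X)) (hg : ∀ X, Function.Surjective (S.g.app X))
    (h : ∀ X m, S.g.app X m = 0 → ∃ l, S.f.app X l = m) : S.ShortExact := by
  have := mono_of_injective S.f hf
  have := epi_of_surjective S.g hg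
  refine ⟨ShortComplex.exact_of_f_is_kernel S (KernelFork.IsLimit.ofι' _ _ fun {P} k hk => ?_)⟩
  exact liftOfInjective S.f hf k fun X p => h X _ (congrArg (fun ψ : P ⟶ S.X₃ => ψ.app X p) hk)

/-! ### The resolution of the Burnside module -/

/-- The multiplication by the generator on the free Green functor. -/
noncomputable def mulVar (G : Type u) [Group G] :
    regular (freeGreen G) ⟶ regular (freeGreen G) :=
  regularDesc (M := regular (freeGreen G)) (freeGreenGen G)

/-- A morphism of Green functors as a morphism of modules over its source. -/
def ofGreenHom {R S : GreenFunctor G} (φ : GreenFunctor.Hom R S) : regular R ⟶ φ.toModule where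
  app X :=
    { toFun := φ.app X
      map_add' := map_add (φ.app X)
      map_smul' := map_mul (φ.app X) }
  app_res := φ.app_res
  app_tr := φ.app_tr

theorem toModule_smul_eq_zero {R S : GreenFunctor G} (φ : GreenFunctor.Hom R S) {X : FinGSet G}
    (r : R.obj X) (hr : φ.app X r = 0) (m : φ.toModule.obj X) : r • m = 0 :=
  (congrArg (fun s : S.obj X => s * (show S.obj X from m)) hr).trans (zero_mul _)

/-- The sequence `R → R → A` given by the multiplication by the generator and the augmentation. -/
noncomputable def koszul (G : Type u) [Group G] : ShortComplex (GreenModule (freeGreen G)) where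
  X₁ := regular (freeGreen G)
  X₂ := regular (freeGreen G)
  X₃ := burnsideModule G
  f := mulVar G
  g := ofGreenHom (augmentation G)
  zero := hom_ext fun X (a : (freeGreen G).obj X) => by
    change (augmentation G).app X (a * varAt X) = 0
    rw [map_mul, augmentation_varAt, mul_zero]

theorem koszul_shortExact (G : Type u) [Group G] : (koszul G).ShortExact :=
  shortExact_of_levelwise (S := koszul G) (fun X => mul_varAt_injective X)
    (fun X => augmentation_surjective X) (fun X => exists_mul_varAt_eq X)

instance (G : Type u) [Group G] : Projective (koszul G).X₁ :=
  inferInstanceAs (Projective (regular (freeGreen G)))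

instance (G : Type u) [Group G] : Projective (koszul G).X₂ :=
  inferInstanceAs (Projective (regular (freeGreen G)))

/-- The generator acts by zero on the Burnside module, so by balancedness
`[f, m, r x] = [f, x m, r] = 0`. -/
theorem boxFunctor_map_mulVar (G : Type u) [Group G] :
    (boxFunctor (burnsideModule G)).map (mulVar G) = 0 :=
  hom_ext fun X a => DFunLike.congr_fun
    (show BoxObj.map (burnsideModule G) (mulVar G) X = 0 from
      BoxObj.hom_ext fun Y f m (r : (freeGreen G).obj Y) => by
        have hr : (mulVar G).app Y r = varAt Y • (r : (regular (freeGreen G)).obj Y) :=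
          mul_comm r (varAt Y)
        have hm : varAt Y • m = 0 :=
          toModule_smul_eq_zero (augmentation G) (varAt Y) (augmentation_varAt Y) m
        rw [BoxObj.map_mk, hr, ← BoxObj.mk_balanced, hm, BoxObj.mk_zero_left]
        rfl) a

end GreenModule

end Equivariant

theorem mainTheorem9 {G : Type u} [Group G] [Finite G] :
    Nonempty (Equivariant.GreenModule.tor (Equivariant.burnsideModule G)
      (Equivariant.burnsideModule G) 0 ≅ Equivariant.burnsideModule G) ∧
    Nonempty (Equivariant.GreenModule.tor (Equivariant.burnsideModule G)
      (Equivariant.burnsideModule G) 1 ≅ Equivariant.burnsideModule G) ∧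
    ∀ n : ℕ, 1 < n → CategoryTheory.Limits.IsZero (Equivariant.GreenModule.tor
      (Equivariant.burnsideModule G) (Equivariant.burnsideModule G) n) := by
  open Equivariant GreenModule CategoryTheory HomologicalComplex in
  let F := boxFunctor (burnsideModule G)
  have e (n : ℕ) : tor (burnsideModule G) (burnsideModule G) n ≅
      F.obj ((double (mulVar G) down_rel_one_zero).X n) :=
    leftDerivedIsoOfMapEqZero (koszul_shortExact G) F (boxFunctor_map_mulVar G) n
  -- The boundary map of the length one complex goes from degree `1` to degree `0`, so that
  -- `doubleXIso₀` is about the source, in degree `1`.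
  refine ⟨⟨e 0 ≪≫ F.mapIso (doubleXIso₁ (mulVar G) down_rel_one_zero one_ne_zero) ≪≫
      boxRegularIso _⟩, ⟨e 1 ≪≫ F.mapIso (doubleXIso₀ (mulVar G) down_rel_one_zero) ≪≫
      boxRegularIso _⟩, fun n hn => ?_⟩
  exact (F.map_isZero (isZero_double_X _ down_rel_one_zero n (by omega) (by omega))).of_iso (e n)
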